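/- Setting. Let $\mathcal V_1$ (white) and $\mathcal V_2$ (black) be the points $(x,y)\in\mathbb Z^2$ with $x-y$ even, resp. odd, and let $\mathcal V_3=\mathbb Z^2+(\frac12,\frac12)$. Let $\mathcal G$ be the graph on $\mathcal V_1\cup\mathcal V_2\cup\mathcal V_3$ with edge set $\mathcal E_1\cup\mathcal E_2$, where $\mathcal E_1$ joins points of $\mathcal V_1\cup\mathcal V_2$ to points of $\mathcal V_3$ at distance $\frac{\sqrt2}2$ and $\mathcal E_2$ joins points of $\mathcal V_1$ to points of $\mathcal V_2$ at distance $1$. A basic block is the subgraph induced by a point of $\mathcal V_1$ and its eight neighbours. Let $k\ge 1$. A graph $G=G^{(k)}$ is a connected subgraph of $\mathcal G$ formed by a finite union of basic blocks together with $2k-1$ further vertices $T_1,\dots,T_{2k-1}\in\mathcal V_1$ (terminals); each $T_i$ is not a block centre, is adjacent in $\mathcal G$ to a point $z_i\in\mathcal V_3$ of some block, and is attached by the edges from $T_i$ to $z_i$ and to the two black neighbours of $z_i$. Put $V_i=V(G)\cap\mathcal V_i$; it is assumed that $|V_1|+|V_2|-|V_3|=2k$, i.e. that dimer coverings (perfect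 matchings) of $G$ have exactly $k$ impurities (edges in $\mathcal E_2$). Let $N=|V(G)|$, let $\mathcal D(G)$ be the set of dimer coverings of $G$, and let $\mathbf P$ be the uniform probability on it. A point $z\in V_3$ is a boundary vertex if some edge of $\mathcal G$ at $z$ is missing in $G$. Let $\overline{G_1}$ be the multigraph on $V_1\cup\{R\}$ ($R$ the root) which has one edge for each $z\in V_3$, joining the two white neighbours of $z$ in $G$ (or its only white neighbour and $R$, if $z$ is a boundary vertex), and one edge $T_iR$ for each $i$. Let $G_2$ be the graph on $V_2$ which has one edge for each $z\in V_3$, joining the two black neighbours of $z$. Let $\mathcal T(\overline{G_1})$ be the set of spanning trees of $\overline{G_1}$. Deleting $R$ from such a tree $T$ leaves subtrees, each joined to $R$ by one edge of $T$. A subtree with $l\ge1$ terminals is a $T^lI$-tree if it is joined to $R$ by the edge $T_iR$, where $i$ is the smallest index of its terminals (it counts as one TI-tree and $l-1$ TO-trees), and a $T^lO$-tree if it is joined to $R$ through a boundary vertex (it counts as $l$ TO-trees); a subtree without terminals which is joined to $R$ through a boundary vertex is an IO-tree. Let $\mathcal T(\overline{G_1},Q)$ be the set of $T\in\mathcal T(\overline{G_1})$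 composed of $k$ TI-trees, $k-1$ TO-trees and otherwise IO-trees, for which there are a spanning forest $S$ of $G_2$ with $k$ components, having no point of $V_3$ in common with $T$, and $k$ edges of $G$ in $\mathcal E_2$ which pair the $k$ TI-trees of $T$ with the $k$ trees of $S$. Let $\overline A$ be the matrix indexed by $V_1\cup\{R\}$ with diagonal entries the degrees in $\overline{G_1}$ (multiple edges counted), off-diagonal entries $-1$ for adjacent and $0$ for non-adjacent vertices, let $A$ be its restriction to $V_1$, let $b_j=1$ if $j\in V_1$ is a terminal and $b_j=0$ otherwise, and let $p=A^{-1}b$. Theorem. (1) $$2^k\,|\mathcal T(\overline{G_1},Q)|\le|\mathcal D(G)|\le|\det A|\left(\frac Nk\right)^k .$$ (2) For every $j\in V_1$, $$\mathbf P(\text{some impurity is incident to } j)\le\frac{|\mathcal T(\overline{G_1})|\left(\frac Nk\right)^k}{2^k\,|\mathcal T(\overline{G_1},Q)|}\;p_j .$$ Here $\det A\ne0$, and $p_j$ is the probability that the simple random walk on $\overline{G_1}$ started at $j$ first reaches $R$ by a step from a terminal. -/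

import Mathlib

/-- Points of the plane in doubled coordinates: `(a, b)` stands for the point `(a / 2, b / 2)`. -/
abbrev Pt := ℤ × ℤ

/-- White vertices: points `(x, y)` of `ℤ²` with `x - y` even. -/
def IsV1 (v : Pt) : Prop := Even v.1 ∧ Even v.2 ∧ (4 : ℤ) ∣ v.1 - v.2

/-- Black vertices: points `(x, y)` of `ℤ²` with `x - y` odd. -/
def IsV2 (v : Pt) : Prop := Even v.1 ∧ Even v.2 ∧ ¬ (4 : ℤ) ∣ v.1 - v.2

/-- Middle vertices: points of `ℤ² + (1/2, 1/2)`. -/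
def IsV3 (v : Pt) : Prop := Odd v.1 ∧ Odd v.2

instance : DecidablePred IsV1 := fun v => by unfold IsV1; infer_instance
instance : DecidablePred IsV2 := fun v => by unfold IsV2; infer_instance
instance : DecidablePred IsV3 := fun v => by unfold IsV3; infer_instance

/-- Squared distance in doubled coordinates (four times the actual squared distance). -/
def dsq (u v : Pt) : ℤ := (u.1 - v.1) ^ 2 + (u.2 - v.2) ^ 2

lemma dsq_comm (u v : Pt) : dsq u v = dsq v u := by unfold dsq; ring

/-- Edges of the first kind join a middle vertex to a white or black vertex at distance `√2/2`. -/
def IsE1 (u v : Pt) : Prop := (IsV1 u ∨ IsV2 u) ∧ IsV3 v ∧ dsq u v = 2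

/-- Edges of the second kind join two vertices of `ℤ²` at distance `1`. -/
def IsE2 (u v : Pt) : Prop := (IsV1 u ∨ IsV2 u) ∧ (IsV1 v ∨ IsV2 v) ∧ dsq u v = 4

/-- The radial graph of `ℤ²`. -/
def radial : SimpleGraph Pt where
  Adj u v := IsE1 u v ∨ IsE1 v u ∨ IsE2 u v
  symm := ⟨by
    rintro u v (h | h | ⟨hu, hv, h⟩)
    · exact Or.inr (Or.inl h)
    · exact Or.inl h
    · exact Or.inr (Or.inr ⟨hv, hu, by rw [dsq_comm]; exact h⟩)⟩
  loopless := ⟨by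
    rintro u (⟨_, _, h⟩ | ⟨_, _, h⟩ | ⟨_, _, h⟩) <;> simp [dsq] at h⟩

/-- The vertices of the basic block with centre the white vertex `b`: the centre, its four
middle neighbours and its four black neighbours. -/
def cell (b : Pt) : Finset Pt :=
  {b, (b.1 + 1, b.2 + 1), (b.1 + 1, b.2 - 1), (b.1 - 1, b.2 + 1), (b.1 - 1, b.2 - 1),
    (b.1 + 2, b.2), (b.1 - 2, b.2), (b.1, b.2 + 2), (b.1, b.2 - 2)}

/-- The data of a finite union of basic blocks with `2 * k - 1` numbered terminals. The terminal
`terminal i` is a white vertex which is not the centre of a block, and it is attached to the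
boundary of the union of blocks at the middle vertex `port i`. -/
structure BlockDomain (k : ℕ) where
  blocks : Finset Pt
  blocks_white : ∀ b ∈ blocks, IsV1 b
  terminal : Fin (2 * k - 1) → Pt
  terminal_white : ∀ i, IsV1 (terminal i)
  terminal_injective : Function.Injective terminal
  terminal_notMem : ∀ i, terminal i ∉ blocks
  port : Fin (2 * k - 1) → Pt
  port_mid : ∀ i, IsV3 (port i)
  port_adj_terminal : ∀ i, radial.Adj (terminal i) (port i)
  port_adj_block : ∀ i, ∃ b ∈ blocks, radial.Adj b (port i)

namespace BlockDomain

variable {k : ℕ} (X : BlockDomain k)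

/-- The vertices of the triangle through which the `i`-th terminal is attached: the terminal, its
middle vertex, and the two black neighbours of the middle vertex. -/
def terminalCell (i : Fin (2 * k - 1)) : Finset Pt :=
  {X.terminal i, X.port i} ∪
    ({((X.port i).1 + 1, (X.port i).2 + 1), ((X.port i).1 + 1, (X.port i).2 - 1),
      ((X.port i).1 - 1, (X.port i).2 + 1), ((X.port i).1 - 1, (X.port i).2 - 1)} :
        Finset Pt).filter IsV2

/-- The vertex set `V(G)`. -/
def verts : Finset Pt :=
  X.blocks.biUnion cell ∪ Finset.univ.biUnion X.terminalCell

/-- The graph `G`, a finite subgraph of the radial graph: the union of the basic blocks and of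
the triangles attaching the terminals. -/
def graph : radial.Subgraph where
  verts := ↑X.verts
  Adj u v := radial.Adj u v ∧
    ((∃ b ∈ X.blocks, u ∈ cell b ∧ v ∈ cell b) ∨
      ∃ i, u ∈ X.terminalCell i ∧ v ∈ X.terminalCell i)
  adj_sub h := h.1
  edge_vert := by
    rintro u v ⟨_, ⟨b, hb, hu, _⟩ | ⟨i, hu, _⟩⟩
    · exact Finset.mem_coe.2
        (Finset.mem_union_left _ (Finset.mem_biUnion.2 ⟨b, hb, hu⟩))
    · exact Finset.mem_coe.2
        (Finset.mem_union_right _ (Finset.mem_biUnion.2 ⟨i, Finset.mem_univ i, hu⟩))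
  symm := ⟨by
    rintro u v ⟨h, ⟨b, hb, hu, hv⟩ | ⟨i, hu, hv⟩⟩
    · exact ⟨h.symm, Or.inl ⟨b, hb, hv, hu⟩⟩
    · exact ⟨h.symm, Or.inr ⟨i, hv, hu⟩⟩⟩

/-- White vertices of `G`. -/
def V1 : Finset Pt := X.verts.filter IsV1

/-- Black vertices of `G`. -/
def V2 : Finset Pt := X.verts.filter IsV2

/-- Middle vertices of `G`. -/
def V3 : Finset Pt := X.verts.filter IsV3

/-- `G` is a graph `G^{(k)}`: it is connected, and its vertex numbers are such that every dimer
covering has exactly `k` edges of the second kind. -/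
structure IsImpurityDomain : Prop where
  connected : X.graph.Connected
  impurity_count : X.V1.card + X.V2.card = X.V3.card + 2 * k

/-- The set `D(G)` of dimer coverings of `G`. -/
def dimerCoverings : Set (Finset (Sym2 Pt)) :=
  {M | (↑M : Set (Sym2 Pt)) ⊆ X.graph.edgeSet ∧ ∀ v ∈ X.verts, ∃! e, e ∈ M ∧ v ∈ e}

/-- The probability, under the uniform distribution on dimer coverings, that some impurity is
incident to the white vertex `j`. -/
noncomputable def impurityProb (j : X.V1) : ℝ :=
  (({M ∈ X.dimerCoverings | ∃ x : X.V2, s((x : Pt), (j : Pt)) ∈ M}.ncard : ℕ) : ℝ) /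
    ((X.dimerCoverings.ncard : ℕ) : ℝ)

/-- A middle vertex lies on the boundary of `G` when some edge of the radial graph at it is
missing in `G`. -/
def IsBoundary (z : Pt) : Prop := z ∈ X.V3 ∧ ∃ v, radial.Adj z v ∧ ¬ X.graph.Adj z v

/-- The neighbours of the root: terminals and boundary vertices. -/
def AdjRoot (v : Pt) : Prop := (∃ i, X.terminal i = v) ∨ X.IsBoundary v

/-- The graph `Ḡ`, obtained from `G` by adding the root (here `none`). -/
def rootedGraph : SimpleGraph (Option Pt) where
  Adj
    | none, none => False
    | none, some v => X.AdjRoot v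
    | some u, none => X.AdjRoot u
    | some u, some v => X.graph.Adj u v
  symm := ⟨by
    rintro (_ | u) (_ | v) h
    · exact h
    · exact h
    · exact h
    · exact X.graph.symm.symm _ _ h⟩
  loopless := ⟨by
    rintro (_ | u) h
    · exact h
    · exact radial.loopless.irrefl u h.1⟩

/-- The vertices of `Ḡ₁`: the white vertices and the root `none`. -/
abbrev RootedV1 := Option X.V1

/-- The edges of the multigraph `Ḡ₁`: one edge for every middle vertex, and one edge from each
terminal to the root. -/
abbrev RootedEdge := X.V3 ⊕ Fin (2 * k - 1)

/-- `X.Inc e x`: the vertex `x` is an end of the edge `e` of `Ḡ₁`. -/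
def Inc : X.RootedEdge → X.RootedV1 → Prop
  | Sum.inl z, x => X.rootedGraph.Adj (some (z : Pt)) (x.map Subtype.val)
  | Sum.inr i, x => x = none ∨ x.map Subtype.val = some (X.terminal i)

/-- The simple graph on the vertices of `Ḡ₁` underlying a set `T` of edges of `Ḡ₁`. -/
def treeGraph (T : Finset X.RootedEdge) : SimpleGraph X.RootedV1 where
  Adj x y := x ≠ y ∧ ∃ e ∈ T, X.Inc e x ∧ X.Inc e y
  symm := ⟨fun _ _ ⟨h, e, he, hx, hy⟩ => ⟨h.symm, e, he, hy, hx⟩⟩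
  loopless := ⟨fun _ h => h.1 rfl⟩

/-- Spanning trees of the multigraph `Ḡ₁`: sets of edges, no two of them parallel, which form
a tree on all the vertices. -/
def spanningTrees : Set (Finset X.RootedEdge) :=
  {T | (X.treeGraph T).IsTree ∧
    ∀ e ∈ T, ∀ e' ∈ T, (∀ x, X.Inc e x ↔ X.Inc e' x) → e = e'}

lemma terminal_mem_V1 (i : Fin (2 * k - 1)) : X.terminal i ∈ X.V1 := by
  refine Finset.mem_filter.2 ⟨Finset.mem_union_right _ ?_, X.terminal_white i⟩
  exact Finset.mem_biUnion.2 ⟨i, Finset.mem_univ i, by simp [terminalCell]⟩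

/-- The graph on the white vertices obtained from `T` by cutting the edges at the root. -/
def cutGraph (T : Finset X.RootedEdge) : SimpleGraph X.V1 := (X.treeGraph T).comap some

/-- The subtrees of which `T` is composed. -/
abbrev Subtree (T : Finset X.RootedEdge) := (X.cutGraph T).ConnectedComponent

/-- The subtree of `T` containing the white vertex `v`. -/
def subtreeOf (T : Finset X.RootedEdge) (v : X.V1) : X.Subtree T :=
  (X.cutGraph T).connectedComponentMk v

/-- The subtree of `T` containing the `i`-th terminal. -/
def subtreeOfTerminal (T : Finset X.RootedEdge) (i : Fin (2 * k - 1)) : X.Subtree T :=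
  X.subtreeOf T ⟨X.terminal i, X.terminal_mem_V1 i⟩

/-- The subtree `c` contains a boundary vertex, and so is joined to the root through it. -/
def HasBoundary (T : Finset X.RootedEdge) (c : X.Subtree T) : Prop :=
  ∃ z : X.V3, X.IsBoundary z ∧ Sum.inl z ∈ T ∧
    ∃ v : X.V1, X.subtreeOf T v = c ∧ X.graph.Adj v z

/-- TI-trees, and `T^l I`-trees for `l ≥ 2`: the subtree contains terminals, of which the one with
the smallest index and no other is joined directly to the root, and no boundary vertices. -/
def IsTITree (T : Finset X.RootedEdge) (c : X.Subtree T) : Prop :=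
  (∃ i, X.subtreeOfTerminal T i = c ∧ Sum.inr i ∈ T ∧
    ∀ j, X.subtreeOfTerminal T j = c → i ≤ j ∧ (Sum.inr j ∈ T → j = i)) ∧
  ¬ X.HasBoundary T c

/-- TO-trees, and `T^l O`-trees for `l ≥ 2`: the subtree contains terminals, none of which is
joined directly to the root, and boundary vertices. -/
def IsTOTree (T : Finset X.RootedEdge) (c : X.Subtree T) : Prop :=
  (∃ i, X.subtreeOfTerminal T i = c) ∧
  (∀ i, X.subtreeOfTerminal T i = c → Sum.inr i ∉ T) ∧ X.HasBoundary T c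

/-- The third type of subtree (inner-outer trees): the subtree contains no terminals, but boundary vertices. -/
def IsIOTree (T : Finset X.RootedEdge) (c : X.Subtree T) : Prop :=
  (∀ i, X.subtreeOfTerminal T i ≠ c) ∧ X.HasBoundary T c

/-- The number of TO-trees of `T`: a `T^l O`-tree is counted as `l` TO-trees, a `T^l I`-tree as
one TI-tree and `l - 1` TO-trees. Thus every terminal of a `T^l O`-tree is counted, and every
terminal of a `T^l I`-tree except the one which is joined directly to the root. -/
noncomputable def numTO (T : Finset X.RootedEdge) : ℕ :=
  {i | X.IsTOTree T (X.subtreeOfTerminal T i) ∨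
    (X.IsTITree T (X.subtreeOfTerminal T i) ∧ Sum.inr i ∉ T)}.ncard

/-- The spanning subgraph of `G₂` with edge set `S`, where an edge of `G₂` is given by its middle
vertex. -/
def forestGraph (S : Finset X.V3) : SimpleGraph X.V2 where
  Adj x y := x ≠ y ∧ ∃ z ∈ S, X.graph.Adj x z ∧ X.graph.Adj z y
  symm := ⟨fun _ _ ⟨h, z, hz, hx, hy⟩ => ⟨h.symm, z, hz, hy.symm, hx.symm⟩⟩
  loopless := ⟨fun _ h => h.1 rfl⟩

/-- Condition (Q) on a set `T` of edges of `Ḡ₁`, a set `S` of edges of `G₂` and a set `J` of edges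
of the second kind, given as pairs (white end, black end). -/
structure CondQ (T : Finset X.RootedEdge) (S : Finset X.V3) (J : Finset (X.V1 × X.V2)) :
    Prop where
  /-- every subtree of `T` is of one of the three types -/
  types : ∀ c, X.IsTITree T c ∨ X.IsTOTree T c ∨ X.IsIOTree T c
  card_TI : {c | X.IsTITree T c}.ncard = k
  card_TO : X.numTO T = k - 1
  /-- `S` is composed of `k` trees -/
  card_forest : Nat.card (X.forestGraph S).ConnectedComponent = k
  /-- `T` and `S` are disjoint -/
  disjoint : ∀ z ∈ S, Sum.inl z ∉ T
  /-- the impurities are `k` edges of `G` joining white and black vertices -/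
  card_impurities : J.card = k
  adj : ∀ e ∈ J, X.graph.Adj e.1 e.2
  /-- the impurities pair the TI-trees of `T` with the trees of `S` -/
  mem_TI : ∀ e ∈ J, X.IsTITree T (X.subtreeOf T e.1)
  pair_TI : ∀ c, X.IsTITree T c → ∃! e, e ∈ J ∧ X.subtreeOf T e.1 = c
  pair_forest : ∀ s, ∃! e, e ∈ J ∧ (X.forestGraph S).connectedComponentMk e.2 = s

/-- The set `F(G, Q)`: spanning trees of `Ḡ₁`, spanning forests of `G₂` and impurities with
condition (Q). -/
def forestTriples : Set (Finset X.RootedEdge × Finset X.V3 × Finset (X.V1 × X.V2)) :=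
  {t | t.1 ∈ X.spanningTrees ∧ (X.forestGraph t.2.1).IsAcyclic ∧ X.CondQ t.1 t.2.1 t.2.2}

/-- The set `T(Ḡ₁, Q)`. -/
def spanningTreesQ : Set (Finset X.RootedEdge) :=
  {T ∈ X.spanningTrees | ∃ S J, (T, S, J) ∈ X.forestTriples}

/-- The degree in the multigraph `Ḡ₁`. -/
noncomputable def deg (x : X.RootedV1) : ℕ := {e | X.Inc e x}.ncard

/-- The number of edges of `Ḡ₁` between `x` and `y`. -/
noncomputable def mult (x y : X.RootedV1) : ℕ := {e | x ≠ y ∧ X.Inc e x ∧ X.Inc e y}.ncard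

open Classical in
/-- The matrix `Ā`. -/
noncomputable def rootedLaplacian : Matrix X.RootedV1 X.RootedV1 ℝ :=
  Matrix.of fun x y =>
    if x = y then (X.deg x : ℝ) else if ∃ e, X.Inc e x ∧ X.Inc e y then -1 else 0

/-- The matrix `A`, the restriction of `Ā` to the white vertices. -/
noncomputable def laplacian : Matrix X.V1 X.V1 ℝ := X.rootedLaplacian.submatrix some some

open Classical in
/-- The vector `b`, the indicator function of the terminals. -/
noncomputable def terminalVec : X.V1 → ℝ := fun j => if ∃ i, X.terminal i = j then 1 else 0

/-- The vector `p = A⁻¹ b`. -/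
noncomputable def p : X.V1 → ℝ := Matrix.mulVec (X.laplacian)⁻¹ X.terminalVec

/-- Transition probabilities, between white vertices, of the simple random walk on `Ḡ₁`. -/
noncomputable def walkMatrix : Matrix X.V1 X.V1 ℝ :=
  Matrix.of fun x y => (X.mult (some x) (some y) : ℝ) / X.deg (some x)

open Classical in
/-- The probability that the step of the random walk from `x` is the step to the root from
a terminal. -/
noncomputable def exitVec : X.V1 → ℝ := fun x =>
  if ∃ i, X.terminal i = x then (X.mult (some x) none : ℝ) / X.deg (some x) else 0

/-- The probability that the random walk started at `j` first reaches the root at time `n + 1`,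
coming from a terminal. -/
noncomputable def hitProb (n : ℕ) (j : X.V1) : ℝ :=
  Matrix.mulVec (X.walkMatrix ^ n) X.exitVec j

end BlockDomain

/-! A dimer covering is encoded by the map `h` that sends each vertex to its partner. A white vertex
matched with a middle vertex `z` steps to the white vertex across `z`, or to the root if `G` has
none there; a black vertex steps across its partner in the same way. Vertices matched by an impurity
are sinks, and the vertex count forces exactly `k` impurities. Everything rests on one fact: neither
flow has a cycle (`IsMate.not_isCycle`).

No cycles. Regard the blocks as diamond-shaped faces, the middle vertices as edges and the black
vertices as vertices of a plane complex. As there are `2k - 1` terminals, the impurity count says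
that its Euler characteristic is one. With connectedness, linear algebra modulo two then shows that
every cycle of black vertices bounds a set of blocks (`exists_bounding`), so there are no holes.
Inside a cycle of one colour the flow of the other colour cannot get out. Either it is trapped, and
then has a cycle, or it ends at an impurity inside. In the second case take the partner of that sink
and all vertices flowing into it; the middle vertices on the boundary of this basin are matched with
the other colour and carry a cycle of it. The new cycle has a smaller maximum of `x + y`, so
alternating the colours gives an infinite descent.

Correspondence. The middle vertices matched with white vertices form a forest oriented by the flow,
and those matched with black vertices form a spanning forest `S` of the black graph. A white subtree
that drains to an impurity contains a terminal, since otherwise its boundary would carry a black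
cycle (`exists_terminal_dest`). Joining the first such terminal to the root completes the spanning
tree `T`, and `T`, `S` and the impurities `J` satisfy condition (Q) (`exists_represents`).
Conversely, orienting `T` and `S` towards the root and the impurities gives a covering
(`exists_isMate_of_condQ`).

Bounds. An impurity is a side of a triangle whose apex is a middle vertex of `T` or of `S`; one of
its ends can be moved across the apex within the same tree. These `k` independent choices give the
factor `2 ^ k`. For the upper bound, a covering is determined by `T` and `J`, and `J` selects one
edge at each of the `k` TI-trees. There are at most `N` candidate edges, so by the inequality of the
means there are at most `(N / k) ^ k` selections. Expanding the determinant of `A` by rows counts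
the spanning trees, and the same expansion in Cramer's rule shows that `det A * p j` counts those
whose path from `j` reaches the root by a terminal edge. An impurity at `j` places `j` in such a
tree, which gives the second part after division by the lower bound of the first. -/

/-! ### Partial self-maps of a finite type -/

section Flow

/-- Iterating the partial map `s` leads out of its domain from every point. -/
def Drains {W : Type*} (s : W → Option W) : Prop := WellFounded fun u v => s v = some u

/-- A finite set which is closed under a map contains a set in which every point has a
predecessor. -/
lemma exists_subset_forall_exists_pred {α : Type*} (X : Finset α) (φ : α → α)
    (hX : X.Nonempty) (hφ : ∀ x ∈ X, φ x ∈ X) :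
    ∃ O ⊆ X, O.Nonempty ∧ ∀ p ∈ O, ∃ q ∈ O, φ q = p := by
  classical
  induction X using Finset.strongInduction with
  | H X ih =>
    -- The image of a closed set is closed; passing to images shrinks the set until the map is onto.
    by_cases h : X.image φ = X
    · refine ⟨X, subset_rfl, hX, fun p hp => ?_⟩
      rw [← h] at hp
      simpa using hp
    · have hsub : X.image φ ⊆ X := Finset.image_subset_iff.2 hφ
      obtain ⟨O, hO, h1, h2⟩ := ih (X.image φ) (hsub.ssubset_of_ne h) (hX.image φ)
        (fun x hx => Finset.mem_image_of_mem φ (hsub hx))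
      exact ⟨O, hO.trans hsub, h1, h2⟩

/-- If every point of a finite set has a predecessor in it, then the map permutes the set. -/
lemma cycle_bijective {α : Type*} [DecidableEq α] (O : Finset α) (φ : α → α) (P : α → Prop)
    (hO : ∀ p ∈ O, ∃ q ∈ O, P q ∧ φ q = p) :
    (∀ q ∈ O, P q ∧ φ q ∈ O) ∧ Set.InjOn φ O ∧ O.image φ = O := by
  classical
  -- By cardinality, a part of `O` whose image covers `O` is all of `O`, and the map is injective on
  -- it.
  have h1 : O ⊆ (O.filter P).image φ := by
    intro p hp
    obtain ⟨q, hq, hP, rfl⟩ := hO p hp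
    exact Finset.mem_image_of_mem φ (Finset.mem_filter.2 ⟨hq, hP⟩)
  have h2 : O.card ≤ (O.filter P).card := (Finset.card_le_card h1).trans Finset.card_image_le
  have h3 : O.filter P = O := Finset.eq_of_subset_of_card_le (Finset.filter_subset _ _) h2
  rw [h3] at h1
  have h4 : O.image φ = O := (Finset.eq_of_subset_of_card_le h1 Finset.card_image_le).symm
  refine ⟨fun q hq => ⟨(Finset.filter_eq_self.1 h3) q hq, ?_⟩, ?_, h4⟩
  · have := Finset.mem_image_of_mem φ hq
    rwa [h4] at this
  · exact Finset.card_image_iff.1 (by rw [h4])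

variable {W : Type*} {s : W → Option W}

/-- Recursion along trajectories, stated existentially so that the fixed point is unfolded only
here. Ranks and last points are instances. -/
lemma Drains.exists_rec (h : Drains s) {β : Type*} (a : W → β) (g : W → β → β) :
    ∃ F : W → β, (∀ v, s v = none → F v = a v) ∧ ∀ v u, s v = some u → F v = g v (F u) := by
  have hwf : WellFounded fun u v => s v = some u := h
  refine ⟨WellFounded.fix hwf fun v ih =>
    match hs : s v with
    | none => a v
    | some u => g v (ih u hs), fun v hv => ?_, fun v u hv => ?_⟩
  · rw [WellFounded.fix_eq]; split
    · rfl
    · simp_all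
  · rw [WellFounded.fix_eq]; split
    · simp_all
    · rename_i u' hu
      rw [hv] at hu
      cases hu
      rfl

lemma Drains.exists_rank (h : Drains s) :
    ∃ rank : W → ℕ, ∀ v u, s v = some u → rank u < rank v := by
  obtain ⟨F, -, hF⟩ := h.exists_rec (fun _ => 0) (fun _ n => n + 1)
  exact ⟨F, fun v u hv => by rw [hF v u hv]; exact Nat.lt_succ_self _⟩

/-- The last point of the trajectory of each point. -/
lemma Drains.exists_dest (h : Drains s) :
    ∃ dest : W → W, (∀ v, s v = none → dest v = v) ∧
      (∀ v u, s v = some u → dest v = dest u) ∧ ∀ v, s (dest v) = none := by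
  obtain ⟨F, h0, hF⟩ := h.exists_rec (fun v => v) (fun _ x => x)
  refine ⟨F, h0, hF, fun v => ?_⟩
  induction v using WellFounded.induction h with
  | _ v ih =>
    rcases hv : s v with _ | u
    · rw [h0 v hv, hv]
    · rw [hF v u hv]; exact ih u hv

lemma Drains.of_rank {rank : W → ℕ} (h : ∀ v u, s v = some u → rank u < rank v) : Drains s :=
  Subrelation.wf (h₂ := (measure rank).wf) fun {u v} huv => h v u huv

/-- Each point whose trajectory never ends is sent to another such point. By finiteness these points
would contain a set in which everything has a predecessor. -/
lemma drains_of_no_cycle [Fintype W]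
    (h : ∀ O : Finset W, O.Nonempty → (∀ p ∈ O, ∃ q ∈ O, s q = some p) → False) : Drains s := by
  classical
  by_contra hd
  set X : Finset W := Finset.univ.filter fun v => ¬ Acc (fun u v => s v = some u) v with hX
  have hne : X.Nonempty := by
    by_contra he
    rw [Finset.not_nonempty_iff_eq_empty] at he
    refine hd ⟨fun v => ?_⟩
    by_contra hv
    have : v ∈ X := by simp [hX, hv]
    simp [he] at this
  have hstep : ∀ v ∈ X, ∃ u ∈ X, s v = some u := by
    intro v hv
    by_contra hcon
    push Not at hcon
    refine (Finset.mem_filter.1 hv).2 ⟨_, fun u hu => ?_⟩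
    by_contra hacc
    exact hcon u (by simp [hX, hacc]) hu
  obtain ⟨O, hOX, hO, hpred⟩ := exists_subset_forall_exists_pred X
    (fun v => (s v).getD v) hne (by
      intro v hv
      obtain ⟨u, hu, h1⟩ := hstep v hv
      simpa [h1] using hu)
  refine h O hO fun p hp => ?_
  obtain ⟨q, hq, hqp⟩ := hpred p hp
  obtain ⟨u, -, hu⟩ := hstep q (hOX hq)
  exact ⟨q, hq, by simp [hu] at hqp; rw [hu, hqp]⟩

/-- The graph of a partial map. -/
structure IsFlowGraph (s : W → Option W) (H : SimpleGraph W) : Prop where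
  adj_iff : ∀ u v, u ≠ v → (H.Adj u v ↔ s u = some v ∨ s v = some u)

lemma Drains.ne (h : Drains s) {u v : W} (huv : s u = some v) : u ≠ v := by
  rintro rfl
  obtain ⟨rank, hr⟩ := h.exists_rank
  exact absurd (hr _ _ huv) (lt_irrefl _)

lemma IsFlowGraph.adj_of_step {H : SimpleGraph W} (hH : IsFlowGraph s H) (h : Drains s)
    {u v : W} (huv : s u = some v) : H.Adj u v :=
  (hH.adj_iff u v (h.ne huv)).2 (Or.inl huv)

lemma IsFlowGraph.reachable_dest {H : SimpleGraph W} (hH : IsFlowGraph s H) (h : Drains s)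
    {dest : W → W} (h0 : ∀ v, s v = none → dest v = v)
    (h1 : ∀ v u, s v = some u → dest v = dest u) (v : W) : H.Reachable v (dest v) := by
  induction v using WellFounded.induction h with
  | _ v ih =>
    rcases hv : s v with _ | u
    · rw [h0 v hv]
    · rw [h1 v u hv]
      exact (hH.adj_of_step h hv).reachable.trans (ih u hv)

/-- The last point is constant along edges and every point is joined to its own, so the components
are the basins of the sinks. -/
lemma IsFlowGraph.reachable_iff {H : SimpleGraph W} (hH : IsFlowGraph s H) (h : Drains s)
    {dest : W → W} (h0 : ∀ v, s v = none → dest v = v)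
    (h1 : ∀ v u, s v = some u → dest v = dest u) (u v : W) :
    H.Reachable u v ↔ dest u = dest v := by
  constructor
  · rintro ⟨w⟩
    induction w with
    | nil => rfl
    | cons hadj _ ih =>
      refine Eq.trans ?_ ih
      rcases (hH.adj_iff _ _ hadj.ne).1 hadj with h' | h'
      · exact h1 _ _ h'
      · exact (h1 _ _ h').symm
  · intro he
    exact (hH.reachable_dest h h0 h1 u).trans (he ▸ (hH.reachable_dest h h0 h1 v).symm)

/-- At a vertex of greatest rank on a cycle, both edges of the cycle would have to be its single
outgoing step. -/
lemma IsFlowGraph.isAcyclic {H : SimpleGraph W} (hH : IsFlowGraph s H) (h : Drains s) :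
    H.IsAcyclic := by
  classical
  obtain ⟨rank, hr⟩ := h.exists_rank
  intro v c hc
  obtain ⟨m, hm, hmax⟩ := c.support.toFinset.exists_max_image rank ⟨v, by simp⟩
  have hm' : m ∈ c.support := by simpa using hm
  have hc' := hc.rotate hm'
  have key : ∀ x, H.Adj m x → x ∈ (c.rotate m hm').support → s m = some x := by
    intro x hx hxs
    have hxs' : x ∈ c.support.toFinset := by
      have := (SimpleGraph.Walk.mem_support_rotate_iff c m hm').1 hxs
      simpa using this
    rcases (hH.adj_iff _ _ hx.ne).1 hx with h' | h'
    · exact h'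
    · exact absurd (hr _ _ h') (not_lt.2 (hmax x hxs'))
  have hnil := hc'.not_nil
  have h1 := key _ ((c.rotate m hm').adj_snd hnil) (SimpleGraph.Walk.getVert_mem_support _ _)
  have h2 := key _ ((c.rotate m hm').adj_penultimate hnil).symm
    (SimpleGraph.Walk.getVert_mem_support _ _)
  rw [h1] at h2
  exact hc'.snd_ne_penultimate (Option.some.inj h2)

lemma IsFlowGraph.card_components [Fintype W] {H : SimpleGraph W} (hH : IsFlowGraph s H)
    (h : Drains s) : Nat.card H.ConnectedComponent = {v | s v = none}.ncard := by
  obtain ⟨dest, h0, h1, h2⟩ := h.exists_dest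
  rw [← Nat.card_coe_set_eq]
  refine (Nat.card_congr (Equiv.ofBijective
    (fun v : {v | s v = none} => H.connectedComponentMk v.1) ⟨?_, ?_⟩)).symm
  · rintro ⟨u, hu⟩ ⟨v, hv⟩ huv
    have := (hH.reachable_iff h h0 h1 u v).1 (SimpleGraph.ConnectedComponent.exact huv)
    rw [h0 u hu, h0 v hv] at this
    exact Subtype.ext this
  · intro c
    induction c using SimpleGraph.ConnectedComponent.ind with
    | _ v =>
      exact ⟨⟨dest v, h2 v⟩, SimpleGraph.ConnectedComponent.sound
        (hH.reachable_dest h h0 h1 v).symm⟩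

end Flow

/-! ### Determinants of flows and the weighted matrix-tree theorem -/

section FlowMatrix

variable {W : Type*} [Fintype W] [DecidableEq W]

/-- The identity minus the matrix of a partial map. -/
def flowMatrix (s : W → Option W) : Matrix W W ℝ :=
  Matrix.of fun v u => (if v = u then 1 else 0) - (if s v = some u then 1 else 0)

lemma flowMatrix_mulVec (s : W → Option W) (x : W → ℝ) (v : W) :
    Matrix.mulVec (flowMatrix s) x v = x v - (s v).elim 0 x := by
  simp only [Matrix.mulVec, dotProduct, flowMatrix, Matrix.of_apply, sub_mul, ite_mul, one_mul,
    zero_mul, Finset.sum_sub_distrib, Finset.sum_ite_eq, Finset.mem_univ, if_true]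
  rcases s v with _ | u <;> simp

/-- Sorted by rank the matrix is block triangular, and its diagonal blocks are identities because a
step strictly lowers the rank. -/
lemma Drains.det_flowMatrix {s : W → Option W} (h : Drains s) : (flowMatrix s).det = 1 := by
  obtain ⟨rank, hr⟩ := h.exists_rank
  have hb : Matrix.BlockTriangular (flowMatrix s) (fun v => OrderDual.toDual (rank v)) := by
    intro i j hij
    rw [OrderDual.toDual_lt_toDual] at hij
    have h1 : i ≠ j := by rintro rfl; exact lt_irrefl _ hij
    have h2 : s i ≠ some j := fun h' => absurd (hr i j h') (not_lt.2 hij.le)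
    simp [flowMatrix, h1, h2]
  rw [hb.det]
  refine Finset.prod_eq_one fun a _ => ?_
  have : Matrix.toSquareBlock (flowMatrix s) (fun v => OrderDual.toDual (rank v)) a = 1 := by
    ext ⟨i, hi⟩ ⟨j, hj⟩
    have h2 : s i ≠ some j := by
      intro h'
      have h3 : rank i = rank j := OrderDual.toDual.injective (hi.trans hj.symm)
      exact absurd (hr i j h') (by rw [h3]; exact lt_irrefl _)
    simp [Matrix.toSquareBlock_def, flowMatrix, h2, Matrix.one_apply]
  rw [this, Matrix.det_one]

/-- The indicator function of the points whose trajectory never ends lies in the kernel. -/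
lemma det_flowMatrix_of_not_drains {s : W → Option W} (h : ¬ Drains s) :
    (flowMatrix s).det = 0 := by
  classical
  rw [← Matrix.exists_mulVec_eq_zero_iff]
  refine ⟨fun v => if Acc (fun u v => s v = some u) v then 0 else 1, ?_, ?_⟩
  · intro h0
    refine h ⟨fun v => ?_⟩
    by_contra hv
    have := congrFun h0 v
    simp [hv] at this
  · funext v
    rw [flowMatrix_mulVec]
    rcases hv : s v with _ | u
    · have : Acc (fun u v => s v = some u) v := ⟨_, fun u hu => by simp [hv] at hu⟩
      simp [this]
    · have : Acc (fun u v => s v = some u) v ↔ Acc (fun u v => s v = some u) u :=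
        ⟨fun h' => h'.inv hv, fun h' => ⟨_, fun u' hu' => by
          rw [hv] at hu'; cases hu'; exact h'⟩⟩
      simp [this]

open Classical in
lemma det_flowMatrix (s : W → Option W) :
    (flowMatrix s).det = if Drains s then 1 else 0 := by
  split_ifs with h
  · exact h.det_flowMatrix
  · exact det_flowMatrix_of_not_drains h

variable {E : Type*}

/-- The Laplacian of the graph in which the edges at `v` are `A v`, and the edge `e` leads from `v`
to `t v e`. -/
def edgeLaplacian (A : W → Finset E) (t : W → E → Option W) : Matrix W W ℝ :=
  Matrix.of fun v u => ∑ e ∈ A v, ((if v = u then 1 else 0) - (if t v e = some u then 1 else 0))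

/-- The functions selecting an edge at each point, such that following the selected edges leads
out of `W`. -/
noncomputable def arborescences (A : W → Finset E) (t : W → E → Option W) :
    Finset (W → E) := by
  classical exact (Fintype.piFinset A).filter fun f => Drains fun v => t v (f v)

lemma mem_arborescences {A : W → Finset E} {t : W → E → Option W} {f : W → E} :
    f ∈ arborescences A t ↔ (∀ v, f v ∈ A v) ∧ Drains fun v => t v (f v) := by
  simp [arborescences]

/-- Each row of the Laplacian is a sum, over the edges at its vertex, of rows of flow matrices.
Multilinearity leaves one term for every choice of edges, equal to 1 if the choice drains and to 0
otherwise. -/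
lemma det_edgeLaplacian (A : W → Finset E) (t : W → E → Option W) :
    (edgeLaplacian A t).det = (arborescences A t).card := by
  classical
  have h1 : (edgeLaplacian A t).det =
      Matrix.detRowAlternating.toMultilinearMap (fun v => ∑ e ∈ A v, fun u : W =>
        (((if v = u then 1 else 0) - (if t v e = some u then 1 else 0) : ℝ))) := by
    change Matrix.det _ = Matrix.det _
    congr 1
    ext v u
    simp [edgeLaplacian, Finset.sum_apply]
  rw [h1, MultilinearMap.map_sum_finset]
  have h2 : ∀ f : W → E, Matrix.detRowAlternating.toMultilinearMap (fun v => fun u : W =>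
        (((if v = u then 1 else 0) - (if t v (f v) = some u then 1 else 0) : ℝ)))
      = if Drains (fun v => t v (f v)) then 1 else 0 := fun f => det_flowMatrix _
  simp_rw [h2]
  rw [arborescences, Finset.sum_boole]

/-- Here `c v e` is a reward for using `e` at `v`, and `q f` the total reward along the trajectories
of `f`. The recursion says that `q f` solves the linear system of the flow matrix of `f`, so by
Cramer's rule the term of `f` is its determinant times `q f j`. The recursion is required also for
choices that do not drain; their terms vanish. -/
lemma cramer_edgeLaplacian (A : W → Finset E) (t : W → E → Option W) (c : W → E → ℝ)
    (q : (W → E) → W → ℝ)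
    (hq : ∀ f ∈ Fintype.piFinset A, ∀ v, q f v = c v (f v) + (t v (f v)).elim 0 (q f)) (j : W) :
    Matrix.cramer (edgeLaplacian A t) (fun v => ∑ e ∈ A v, c v e) j =
      ∑ f ∈ arborescences A t, q f j := by
  classical
  have h1 : Matrix.cramer (edgeLaplacian A t) (fun v => ∑ e ∈ A v, c v e) j =
      Matrix.detRowAlternating.toMultilinearMap (fun v => ∑ e ∈ A v, fun u : W =>
        (if u = j then c v e else
        (((if v = u then 1 else 0) - (if t v e = some u then 1 else 0) : ℝ)))) := by
    rw [Matrix.cramer_apply]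
    change Matrix.det _ = Matrix.det _
    congr 1
    ext v u
    rw [Matrix.updateCol_apply]
    split_ifs with h
    · simp [Finset.sum_apply, h]
    · simp [edgeLaplacian, Finset.sum_apply, h]
  rw [h1, MultilinearMap.map_sum_finset]
  have h2 : ∀ f ∈ Fintype.piFinset A,
      Matrix.detRowAlternating.toMultilinearMap (fun v => fun u : W =>
        (if u = j then c v (f v) else
        (((if v = u then 1 else 0) - (if t v (f v) = some u then 1 else 0) : ℝ))))
      = if Drains (fun v => t v (f v)) then q f j else 0 := by
    intro f hf
    have h3 : Matrix.cramer (flowMatrix fun v => t v (f v)) (fun v => c v (f v)) j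
        = Matrix.detRowAlternating.toMultilinearMap (fun v => fun u : W =>
        (if u = j then c v (f v) else
        (((if v = u then 1 else 0) - (if t v (f v) = some u then 1 else 0) : ℝ)))) := by
      rw [Matrix.cramer_apply]
      change Matrix.det _ = Matrix.det _
      congr 1
      ext v u
      rw [Matrix.updateCol_apply]
      by_cases h : u = j
      · simp [h]
      · simp [flowMatrix, h]
    have h4 : (fun v => c v (f v)) = Matrix.mulVec (flowMatrix fun v => t v (f v)) (q f) := by
      funext v
      rw [flowMatrix_mulVec, hq f hf v]
      simp
    rw [← h3, h4, Matrix.cramer_eq_adjugate_mulVec, Matrix.mulVec_mulVec, Matrix.adjugate_mul,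
      Matrix.smul_mulVec, Matrix.one_mulVec, det_flowMatrix]
    split_ifs <;> simp
  rw [Finset.sum_congr rfl h2, arborescences, Finset.sum_filter]

end FlowMatrix

/-! ### Random walks killed at the root -/

section Walk

variable {W : Type*} [Fintype W] [DecidableEq W]

/-- The expected reward collected at the exit by a killed random walk whose Laplacian
`D (1 - P)` is invertible. -/
lemma hasSum_killed_walk (P : Matrix W W ℝ) (hP : ∀ x y, 0 ≤ P x y) (hrow : ∀ x, ∑ y, P x y ≤ 1)
    (hdet : (1 - P).det ≠ 0) (r p : W → ℝ) (hr : ∀ x, 0 ≤ r x)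
    (hp : Matrix.mulVec (1 - P) p = r) (j : W) :
    HasSum (fun n : ℕ => Matrix.mulVec (P ^ n) r j) (p j) := by
  have hpow : ∀ n x y, 0 ≤ (P ^ n) x y := by
    intro n
    induction n with
    | zero => intro x y; simp only [pow_zero, Matrix.one_apply]; split_ifs <;> norm_num
    | succ n ih =>
      intro x y
      rw [pow_succ, Matrix.mul_apply]
      exact Finset.sum_nonneg fun z _ => mul_nonneg (ih x z) (hP z y)
  -- Survival probabilities: `u n x` decreases with `n` to a limit that is fixed by `P`, and
  -- invertibility of `1 - P` makes this limit zero.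
  set u : ℕ → W → ℝ := fun n x => ∑ y, (P ^ n) x y with hu
  have hu' : ∀ n, u n = Matrix.mulVec (P ^ n) 1 := by
    intro n; funext x; simp [hu, Matrix.mulVec, dotProduct]
  have hanti : ∀ x, Antitone fun n => u n x := by
    intro x
    refine antitone_nat_of_succ_le fun n => ?_
    simp only [hu, pow_succ, Matrix.mul_apply]
    rw [Finset.sum_comm]
    refine Finset.sum_le_sum fun z _ => ?_
    rw [← Finset.mul_sum]
    exact mul_le_of_le_one_right (hpow n x z) (hrow z)
  have hbdd : ∀ x, BddBelow (Set.range fun n => u n x) := fun x =>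
    ⟨0, by rintro _ ⟨n, rfl⟩; exact Finset.sum_nonneg fun y _ => hpow n x y⟩
  set v : W → ℝ := fun x => ⨅ n, u n x with hv
  have hlim : ∀ x, Filter.Tendsto (fun n => u n x) Filter.atTop (nhds (v x)) := fun x =>
    tendsto_atTop_ciInf (hanti x) (hbdd x)
  have hfix : Matrix.mulVec P v = v := by
    funext x
    have h1 : Filter.Tendsto (fun n => ∑ y, P x y * u n y) Filter.atTop
        (nhds (∑ y, P x y * v y)) :=
      tendsto_finsetSum _ fun y _ => (hlim y).const_mul _
    have h2 : (fun n => ∑ y, P x y * u n y) = fun n => u (n + 1) x := by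
      funext n
      rw [hu' (n + 1), pow_succ', ← Matrix.mulVec_mulVec, ← hu' n]
      rfl
    rw [h2] at h1
    exact tendsto_nhds_unique h1 ((hlim x).comp (Filter.tendsto_add_atTop_nat 1))
  have hv0 : v = 0 := by
    by_contra hne
    refine hdet (Matrix.exists_mulVec_eq_zero_iff.1 ⟨v, hne, ?_⟩)
    rw [Matrix.sub_mulVec, Matrix.one_mulVec, hfix, sub_self]
  have hentry : ∀ x y, Filter.Tendsto (fun n => (P ^ n) x y) Filter.atTop (nhds 0) := by
    intro x y
    have h0 : Filter.Tendsto (fun n => u n x) Filter.atTop (nhds 0) := by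
      have := hlim x
      rwa [hv0] at this
    exact squeeze_zero (fun n => hpow n x y) (fun n =>
      Finset.single_le_sum (f := fun y => (P ^ n) x y) (fun y _ => hpow n x y)
        (Finset.mem_univ y)) h0
  -- The sum telescopes because `r = (1 - P) p`.
  have hpart : ∀ n, ∑ i ∈ Finset.range n, Matrix.mulVec (P ^ i) r j =
      p j - Matrix.mulVec (P ^ n) p j := by
    intro n
    induction n with
    | zero => simp
    | succ n ih =>
      rw [Finset.sum_range_succ, ih, ← hp, Matrix.mulVec_mulVec, mul_sub, mul_one, ← pow_succ,
        Matrix.sub_mulVec, Pi.sub_apply]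
      ring
  rw [hasSum_iff_tendsto_nat_of_nonneg]
  · simp_rw [hpart]
    have h1 : Filter.Tendsto (fun n => ∑ y, (P ^ n) j y * p y) Filter.atTop
        (nhds (∑ y, 0 * p y)) :=
      tendsto_finsetSum _ fun y _ => (hentry j y).mul_const _
    have h2 := h1.const_sub (p j)
    simpa [Matrix.mulVec, dotProduct] using h2
  · intro n
    exact Finset.sum_nonneg fun y _ => mul_nonneg (hpow n j y) (hr y)

end Walk

/-! ### Multigraphs -/

section Multigraph

/-- Every edge `e` has exactly two ends; `oth e x` is the end of `e` other than `x`. -/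
structure TwoEnded {V E : Type*} (Inc : E → V → Prop) (oth : E → V → V) : Prop where
  exists_inc : ∀ e, ∃ x, Inc e x
  ne : ∀ e x, Inc e x → oth e x ≠ x
  inc_iff : ∀ e x, Inc e x → ∀ y, Inc e y ↔ y = x ∨ y = oth e x

/-- The simple graph underlying a set of edges. -/
def edgeGraph {V E : Type*} (Inc : E → V → Prop) (T : Finset E) : SimpleGraph V where
  Adj x y := x ≠ y ∧ ∃ e ∈ T, Inc e x ∧ Inc e y
  symm := ⟨fun _ _ ⟨h, e, he, hx, hy⟩ => ⟨h.symm, e, he, hy, hx⟩⟩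
  loopless := ⟨fun _ h => h.1 rfl⟩

variable {V E : Type*} {Inc : E → V → Prop} {oth : E → V → V}

lemma exists_twoEnded (h : ∀ e, ∃ x y, x ≠ y ∧ ∀ w, Inc e w ↔ w = x ∨ w = y) :
    ∃ oth : E → V → V, TwoEnded Inc oth := by
  classical
  choose a b hab hinc using h
  refine ⟨fun e x => if x = a e then b e else a e, fun e => ⟨a e, (hinc e _).2 (Or.inl rfl)⟩,
    fun e x hx => ?_, fun e x hx y => ?_⟩
  · rcases (hinc e x).1 hx with rfl | rfl
    · simpa using (hab e).symm
    · simpa [(hab e).symm] using hab e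
  · rcases (hinc e x).1 hx with rfl | rfl
    · simpa using hinc e y
    · rw [hinc e y]
      simp [(hab e).symm, or_comm]

namespace TwoEnded

variable (hE : TwoEnded Inc oth)
include hE

lemma inc_oth {e : E} {x : V} (h : Inc e x) : Inc e (oth e x) := (hE.inc_iff e x h _).2 (Or.inr rfl)

lemma oth_eq {e : E} {x y : V} (hx : Inc e x) (hy : Inc e y) (hxy : x ≠ y) : oth e x = y :=
  (((hE.inc_iff e x hx y).1 hy).resolve_left hxy.symm).symm

lemma adj_iff {T : Finset E} {x y : V} :
    (edgeGraph Inc T).Adj x y ↔ ∃ e ∈ T, Inc e x ∧ oth e x = y := by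
  constructor
  · rintro ⟨hne, e, he, hx, hy⟩
    exact ⟨e, he, hx, hE.oth_eq hx hy hne⟩
  · rintro ⟨e, he, hx, rfl⟩
    exact ⟨(hE.ne e x hx).symm, e, he, hx, hE.inc_oth hx⟩

/-- If every vertex is joined to a root, then from each other vertex there is an edge to a vertex
nearer to the roots. -/
lemma exists_descent (T : Finset E) (ρ : V → Prop)
    (hreach : ∀ v, ∃ r, ρ r ∧ (edgeGraph Inc T).Reachable v r) :
    ∃ (f : {v // ¬ ρ v} → E) (d : V → ℕ),
      ∀ v, f v ∈ T ∧ Inc (f v) v ∧ d (oth (f v) v) < d v := by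
  classical
  -- `D v` collects the lengths of walks from `v` to a root; the first edge of a shortest walk
  -- descends.
  set D : V → Set ℕ := fun v => {n | ∃ r, ρ r ∧ ∃ w : (edgeGraph Inc T).Walk v r, w.length = n}
    with hD
  have hDne : ∀ v, (D v).Nonempty := by
    intro v
    obtain ⟨r, hr, ⟨w⟩⟩ := hreach v
    exact ⟨w.length, r, hr, w, rfl⟩
  have key : ∀ v : {v // ¬ ρ v}, ∃ e ∈ T, Inc e v ∧ sInf (D (oth e v)) < sInf (D v) := by
    rintro ⟨v, hv⟩
    obtain ⟨r, hr, w, hw⟩ := Nat.sInf_mem (hDne v)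
    cases w with
    | nil => exact absurd hr hv
    | cons hadj w' =>
      obtain ⟨e, he, hx, rfl⟩ := hE.adj_iff.1 hadj
      refine ⟨e, he, hx, ?_⟩
      have : sInf (D (oth e v)) ≤ w'.length := Nat.sInf_le ⟨r, hr, w', rfl⟩
      rw [SimpleGraph.Walk.length_cons] at hw
      show sInf (D (oth e v)) < sInf (D v)
      omega
  choose f hf using key
  exact ⟨f, fun v => sInf (D v), hf⟩

/-- An edge descending from both ends would make each end lower than the other. Hence choices of
descending edges are injective. -/
lemma eq_of_descent {d : V → ℕ} {e : E} {v v' : V} (hv : Inc e v) (hd : d (oth e v) < d v)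
    (hv' : Inc e v') (hd' : d (oth e v') < d v') : v = v' := by
  by_contra hne
  rw [hE.oth_eq hv hv' hne] at hd
  rw [hE.oth_eq hv' hv (Ne.symm hne)] at hd'
  omega

/-- A forest has only one orientation towards given roots. -/
lemma orientation_unique (N : Finset V) (f f' : V → E) (rank : V → ℕ)
    (hf : ∀ v ∈ N, Inc (f v) v) (hf' : ∀ v ∈ N, Inc (f' v) v)
    (hrank : ∀ v ∈ N, rank (oth (f v) v) < rank v)
    (hinj : Set.InjOn f' N) (himg : ∀ v ∈ N, ∃ u ∈ N, f u = f' v) : ∀ v ∈ N, f v = f' v := by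
  classical
  by_contra! hcon
  obtain ⟨v₀, hv₀, hne₀⟩ := hcon
  -- At a disagreement `v` of greatest rank, `f' v` is the edge `f u` of another vertex `u`, which
  -- steps to `v`. Since `f'` is injective, `u` is also a disagreement, of greater rank.
  obtain ⟨v, hv, hmax⟩ := (N.filter fun v => f v ≠ f' v).exists_max_image rank
    ⟨v₀, by simp [hv₀, hne₀]⟩
  rw [Finset.mem_filter] at hv
  obtain ⟨u, hu, hfu⟩ := himg v hv.1
  have huv : u ≠ v := by rintro rfl; exact hv.2 hfu
  have h1 : oth (f u) u = v := hE.oth_eq (hf u hu) (hfu ▸ hf' v hv.1) huv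
  have h2 : f u ≠ f' u := fun h => huv (hinj hu hv.1 (h ▸ hfu))
  have h3 := hmax u (by simp [hu, h2])
  have h4 := hrank u hu
  rw [h1] at h4
  omega

/-- Parallel edges receive the same pair of ends, so multigraph trees can be counted through the
edge set of a simple graph. -/
lemma exists_ends_map : ∃ ε : E → Sym2 V,
    (∀ e x, Inc e x → ε e = s(x, oth e x)) ∧
    (∀ e e', ε e = ε e' ↔ ∀ x, Inc e x ↔ Inc e' x) := by
  choose a ha using hE.exists_inc
  have hoth : ∀ {e x}, Inc e x → oth e (oth e x) = x := fun {e x} hx =>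
    hE.oth_eq (hE.inc_oth hx) hx (hE.ne _ _ hx)
  have hmem : ∀ e x, x ∈ s(a e, oth e (a e)) ↔ Inc e x := by
    intro e x
    rw [Sym2.mem_iff, hE.inc_iff e _ (ha e)]
  refine ⟨fun e => s(a e, oth e (a e)), fun e x hx => ?_, fun e e' => ?_⟩
  · rcases (hE.inc_iff e _ (ha e) x).1 hx with rfl | rfl
    · rfl
    · rw [hoth (ha e), Sym2.eq_swap]
  · constructor
    · intro h x
      rw [← hmem, ← hmem]
      exact iff_of_eq (congrArg (x ∈ ·) h)
    · intro h
      refine Sym2.ext fun x => ?_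
      rw [hmem, hmem, h]

lemma edgeSet_eq {T : Finset E} {ε : E → Sym2 V} (hε : ∀ e x, Inc e x → ε e = s(x, oth e x)) :
    (edgeGraph Inc T).edgeSet = ε '' T := by
  ext z
  induction z with
  | _ x y =>
    rw [SimpleGraph.mem_edgeSet, hE.adj_iff]
    constructor
    · rintro ⟨e, he, hx, rfl⟩
      exact ⟨e, he, hε e x hx⟩
    · rintro ⟨e, he, h⟩
      have h2 : Inc e x := by
        obtain ⟨a, ha⟩ := hE.exists_inc e
        rw [hε e a ha] at h
        rcases Sym2.eq_iff.1 h with ⟨rfl, -⟩ | ⟨-, rfl⟩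
        · exact ha
        · exact hE.inc_oth ha
      refine ⟨e, he, h2, ?_⟩
      rw [hε e x h2] at h
      rcases Sym2.eq_iff.1 h with ⟨-, h⟩ | ⟨h3, h4⟩
      · exact h
      · rw [h4, ← h3]

/-- A connected graph on `n` vertices needs at least `n - 1` edges, and `T` supplies at most that
many pairs of ends. Equality holds throughout, which also excludes parallel edges. -/
lemma isTree_of_card_le [Fintype V] {T : Finset E} (hc : (edgeGraph Inc T).Connected)
    (hT : T.card + 1 ≤ Fintype.card V) :
    (edgeGraph Inc T).IsTree ∧
      ∀ e ∈ T, ∀ e' ∈ T, (∀ x, Inc e x ↔ Inc e' x) → e = e' := by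
  classical
  obtain ⟨ε, hε, hεinj⟩ := hE.exists_ends_map
  have h1 := hc.card_vert_le_card_edgeSet_add_one
  have h2 : Nat.card (edgeGraph Inc T).edgeSet = (T.image ε).card := by
    rw [hE.edgeSet_eq hε, ← Finset.coe_image, Nat.card_coe_set_eq, Set.ncard_coe_finset]
  have h3 : (T.image ε).card ≤ T.card := Finset.card_image_le
  rw [Nat.card_eq_fintype_card] at h1
  refine ⟨SimpleGraph.isTree_iff_connected_and_card.2 ⟨hc, ?_⟩, fun e he e' he' h => ?_⟩
  · rw [Nat.card_eq_fintype_card (α := V)]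
    omega
  · exact Finset.card_image_iff.1 (by omega : (T.image ε).card = T.card) he he'
      ((hεinj e e').2 h)

lemma card_of_isTree [Fintype V] {T : Finset E} (ht : (edgeGraph Inc T).IsTree)
    (hT : ∀ e ∈ T, ∀ e' ∈ T, (∀ x, Inc e x ↔ Inc e' x) → e = e') :
    T.card + 1 = Fintype.card V := by
  classical
  obtain ⟨ε, hε, hεinj⟩ := hE.exists_ends_map
  have h1 := (SimpleGraph.isTree_iff_connected_and_card.1 ht).2
  have h2 : Nat.card (edgeGraph Inc T).edgeSet = (T.image ε).card := by
    rw [hE.edgeSet_eq hε, ← Finset.coe_image, Nat.card_coe_set_eq, Set.ncard_coe_finset]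
  have h3 : (T.image ε).card = T.card :=
    Finset.card_image_iff.2 fun e he e' he' h => hT e he e' he' ((hεinj e e').1 h)
  rw [Nat.card_eq_fintype_card (α := V)] at h1
  omega

end TwoEnded

end Multigraph

/-! ### Spanning trees of a multigraph as choices of one edge at each vertex -/

section RootedTrees

variable {W E : Type*} [Fintype W] [DecidableEq W] [Fintype E]
  {Inc : E → Option W → Prop} {oth : E → Option W → Option W}

open Classical in
/-- The edges at a vertex. -/
noncomputable def edgesAt (Inc : E → Option W → Prop) (v : W) : Finset E :=
  Finset.univ.filter fun e => Inc e (some v)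

/-- The spanning trees with root `none`, oriented towards the root. -/
noncomputable def rootedTrees (Inc : E → Option W → Prop) (oth : E → Option W → Option W) :
    Finset (W → E) :=
  arborescences (edgesAt Inc) fun v e => oth e (some v)

lemma mem_rootedTrees {f : W → E} : f ∈ rootedTrees Inc oth ↔
    (∀ v, Inc (f v) (some v)) ∧ Drains fun v => oth (f v) (some v) := by
  simp [rootedTrees, mem_arborescences, edgesAt]

variable [DecidableEq E]

lemma TwoEnded.isTree_image (hE : TwoEnded Inc oth) {f : W → E}
    (hf : f ∈ rootedTrees Inc oth) :
    (edgeGraph Inc (Finset.univ.image f)).IsTree ∧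
      ∀ e ∈ Finset.univ.image f, ∀ e' ∈ Finset.univ.image f,
        (∀ x, Inc e x ↔ Inc e' x) → e = e' := by
  rw [mem_rootedTrees] at hf
  refine hE.isTree_of_card_le ?_ ?_
  · have : ∀ x, (edgeGraph Inc (Finset.univ.image f)).Reachable x none := by
      rintro (_ | v)
      · rfl
      · induction v using WellFounded.induction hf.2 with
        | _ v ih =>
          have hadj : (edgeGraph Inc (Finset.univ.image f)).Adj (some v) (oth (f v) (some v)) :=
            hE.adj_iff.2 ⟨f v, by simp, hf.1 v, rfl⟩
          rcases hv : oth (f v) (some v) with _ | u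
          · rw [hv] at hadj; exact hadj.reachable
          · rw [hv] at hadj
            exact hadj.reachable.trans (ih u hv)
    exact { preconnected := fun x y => (this x).trans (this y).symm, nonempty := ⟨none⟩ }
  · rw [Fintype.card_option, add_le_add_iff_right]
    exact Finset.card_image_le

/-- A tree has only one orientation towards its root. -/
lemma TwoEnded.rootedTrees_injOn (hE : TwoEnded Inc oth) :
    Set.InjOn (fun f : W → E => Finset.univ.image f) (rootedTrees Inc oth) := by
  intro f hf f' hf' h
  have hcard := hE.card_of_isTree (hE.isTree_image hf').1 (hE.isTree_image hf').2
  have hT' := Finset.card_image_iff.1 (show (Finset.univ.image f').card = (Finset.univ).card by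
    rw [Fintype.card_option] at hcard
    rw [Finset.card_univ]
    omega)
  rw [Finset.mem_coe, mem_rootedTrees] at hf hf'
  obtain ⟨rank, hr⟩ := hf.2.exists_rank
  by_cases hW : IsEmpty W
  · funext v
    exact hW.elim v
  rw [not_isEmpty_iff] at hW
  obtain ⟨w₀⟩ := hW
  -- At the root the functions take the dummy value `f w₀`, which plays no role since the root is
  -- left out of `N`. Ranks are raised by one to put the root at rank 0.
  have := hE.orientation_unique (Finset.univ.filter fun x : Option W => x ≠ none)
    (fun x => x.elim (f w₀) f) (fun x => x.elim (f w₀) f')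
    (fun x => x.elim 0 fun v => rank v + 1) ?_ ?_ ?_ ?_ ?_
  · funext v
    exact this (some v) (by simp)
  · rintro (_ | v) hv
    · simp at hv
    · exact hf.1 v
  · rintro (_ | v) hv
    · simp at hv
    · exact hf'.1 v
  · rintro (_ | v) hv
    · simp at hv
    · simp only [Option.elim_some]
      rcases hv : oth (f v) (some v) with _ | u
      · simp
      · simpa using hr v u hv
  · rintro (_ | v) hv (_ | u) hu huv
    · rfl
    · simp at hv
    · simp at hu
    · rw [hT' (by simp) (by simp) (show f' v = f' u from huv)]
  · rintro (_ | v) hv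
    · simp at hv
    · have : f' v ∈ Finset.univ.image f' := by simp
      rw [← (show Finset.univ.image f = Finset.univ.image f' from h)] at this
      obtain ⟨u, -, hu⟩ := Finset.mem_image.1 this
      exact ⟨some u, by simp, hu⟩

/-- Every vertex other than the root takes an edge towards it; these edges are distinct and as
numerous as the edges of `T`. -/
lemma TwoEnded.exists_rootedTree (hE : TwoEnded Inc oth) {T : Finset E}
    (ht : (edgeGraph Inc T).IsTree)
    (hT : ∀ e ∈ T, ∀ e' ∈ T, (∀ x, Inc e x ↔ Inc e' x) → e = e') :
    ∃ f ∈ rootedTrees Inc oth, Finset.univ.image f = T := by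
  obtain ⟨g, d, hg⟩ := hE.exists_descent T (fun x => x = none)
    (fun v => ⟨none, rfl, ht.1.preconnected v none⟩)
  have hsome : ∀ v : W, ¬ (some v = none) := fun v => by simp
  refine ⟨fun v => g ⟨some v, hsome v⟩, ?_, ?_⟩
  · rw [mem_rootedTrees]
    refine ⟨fun v => (hg ⟨some v, hsome v⟩).2.1, Drains.of_rank (rank := fun v => d (some v)) ?_⟩
    intro v u hvu
    have := (hg ⟨some v, hsome v⟩).2.2
    rw [hvu] at this
    exact this
  · have hcard := hE.card_of_isTree ht hT
    rw [Fintype.card_option] at hcard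
    refine Finset.eq_of_subset_of_card_le ?_ ?_
    · intro e he
      obtain ⟨v, -, rfl⟩ := Finset.mem_image.1 he
      exact (hg ⟨some v, hsome v⟩).1
    · rw [Finset.card_image_of_injective, Finset.card_univ]
      · omega
      · intro v u hvu
        have h1 := hg ⟨some v, hsome v⟩
        have h2 := hg ⟨some u, hsome u⟩
        have hvu' : g ⟨some v, hsome v⟩ = g ⟨some u, hsome u⟩ := hvu
        rw [← hvu'] at h2
        exact Option.some.inj (hE.eq_of_descent h1.2.1 h1.2.2 h2.2.1 h2.2.2)

end RootedTrees

/-! ### The geometry of the radial graph -/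

/-- Colours are turned into congruences, on which `omega` can work. -/
lemma isV1_iff {v : Pt} : IsV1 v ↔ v.1 % 2 = 0 ∧ v.2 % 2 = 0 ∧ (v.1 - v.2) % 4 = 0 := by
  unfold IsV1
  rw [Int.even_iff, Int.even_iff]
  omega

lemma isV2_iff {v : Pt} : IsV2 v ↔ v.1 % 2 = 0 ∧ v.2 % 2 = 0 ∧ (v.1 - v.2) % 4 ≠ 0 := by
  unfold IsV2
  rw [Int.even_iff, Int.even_iff]
  omega

lemma isV3_iff {v : Pt} : IsV3 v ↔ v.1 % 2 = 1 ∧ v.2 % 2 = 1 := by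
  unfold IsV3
  rw [Int.odd_iff, Int.odd_iff]

lemma pt_ext_iff {u v : Pt} : u = v ↔ u.1 = v.1 ∧ u.2 = v.2 := Prod.ext_iff

/-- `u` and `v` are joined by half a diagonal of a unit square. -/
def Near (u v : Pt) : Prop := (v.1 = u.1 + 1 ∨ v.1 = u.1 - 1) ∧ (v.2 = u.2 + 1 ∨ v.2 = u.2 - 1)

/-- `u` and `v` are joined by the side of a unit square. -/
def Side (u v : Pt) : Prop :=
  (v.1 = u.1 ∧ (v.2 = u.2 + 2 ∨ v.2 = u.2 - 2)) ∨ (v.2 = u.2 ∧ (v.1 = u.1 + 2 ∨ v.1 = u.1 - 2))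

/-- The point opposite to `u` with respect to `z`. -/
def opp (z u : Pt) : Pt := (2 * z.1 - u.1, 2 * z.2 - u.2)

instance : DecidableRel Near := fun u v => by unfold Near; infer_instance

lemma Near.symm {u v : Pt} (h : Near u v) : Near v u := by unfold Near at *; omega

lemma Side.symm {u v : Pt} (h : Side u v) : Side v u := by unfold Side at *; omega

lemma near_comm {u v : Pt} : Near u v ↔ Near v u := ⟨Near.symm, Near.symm⟩

lemma opp_opp (z u : Pt) : opp z (opp z u) = u := by
  rw [pt_ext_iff]; simp [opp]

lemma Near.opp {u z : Pt} (h : Near u z) : Near (opp z u) z := by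
  unfold Near _root_.opp at *; simp only; omega

lemma Near.opp_ne {u z : Pt} (h : Near u z) : _root_.opp z u ≠ u := by
  rw [Ne, pt_ext_iff]
  unfold Near _root_.opp at *; simp only; omega

lemma Near.isV1_opp {u z : Pt} (h : Near u z) (hu : IsV1 u) : IsV1 (_root_.opp z u) := by
  rw [isV1_iff] at *
  unfold Near _root_.opp at *; simp only; omega

lemma Near.isV2_opp {u z : Pt} (h : Near u z) (hu : IsV2 u) : IsV2 (_root_.opp z u) := by
  rw [isV2_iff] at *
  unfold Near _root_.opp at *; simp only; omega

lemma Near.isV3 {u z : Pt} (h : Near u z) (hu : IsV1 u ∨ IsV2 u) : IsV3 z := by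
  rw [isV1_iff, isV2_iff] at hu
  rw [isV3_iff]
  unfold Near at h; omega

/-- The colours alternate around a middle vertex, so two distinct corners of equal colour are
opposite. -/
lemma eq_or_eq_opp_of_isV1 {u v z : Pt} (hu : Near u z) (hv : Near v z) (h1 : IsV1 u)
    (h2 : IsV1 v) : v = u ∨ v = opp z u := by
  rw [isV1_iff] at h1 h2
  rw [pt_ext_iff, pt_ext_iff]
  unfold Near opp at *; simp only; omega

lemma eq_or_eq_opp_of_isV2 {u v z : Pt} (hu : Near u z) (hv : Near v z) (h1 : IsV2 u)
    (h2 : IsV2 v) : v = u ∨ v = opp z u := by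
  rw [isV2_iff] at h1 h2
  rw [pt_ext_iff, pt_ext_iff]
  unfold Near opp at *; simp only; omega

lemma side_of_near {u v z : Pt} (hu : Near u z) (hv : Near v z) (h1 : IsV1 u) (h2 : IsV2 v) :
    Side u v := by
  rw [isV1_iff] at h1; rw [isV2_iff] at h2
  unfold Near Side at *; omega

lemma Side.isV2 {u v : Pt} (h : Side u v) (hu : IsV1 u) : IsV2 v := by
  rw [isV1_iff] at hu; rw [isV2_iff]
  unfold Side at h; omega

lemma Side.isV1 {u v : Pt} (h : Side u v) (hu : IsV2 u) : IsV1 v := by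
  rw [isV2_iff] at hu; rw [isV1_iff]
  unfold Side at h; omega

lemma Side.exists_near {u v : Pt} (h : Side u v) : ∃ z, Near u z ∧ Near v z := by
  unfold Side at h
  rcases h with ⟨h1, h2 | h2⟩ | ⟨h1, h2 | h2⟩
  · refine ⟨(u.1 + 1, u.2 + 1), ?_⟩
    simp only [Near, true_or, true_and]
    omega
  · refine ⟨(u.1 + 1, u.2 - 1), ?_⟩
    simp only [Near, true_or, true_and, or_true]
    omega
  · refine ⟨(u.1 + 1, u.2 + 1), ?_⟩
    simp only [Near, true_or, true_and]
    omega
  · refine ⟨(u.1 - 1, u.2 + 1), ?_⟩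
    simp only [Near, true_or, true_and, or_true]
    omega

lemma exists_isV2_near {z : Pt} (hz : IsV3 z) : ∃ p, IsV2 p ∧ Near p z := by
  rw [isV3_iff] at hz
  by_cases h : (z.1 - z.2) % 4 = 0
  · exact ⟨(z.1 + 1, z.2 - 1), by rw [isV2_iff]; simp only; omega, by unfold Near; simp⟩
  · exact ⟨(z.1 + 1, z.2 + 1), by rw [isV2_iff]; simp only; omega, by unfold Near; simp⟩

lemma sq_add_sq_eq_two {a b : ℤ} (h : a ^ 2 + b ^ 2 = 2) : (a = 1 ∨ a = -1) ∧ (b = 1 ∨ b = -1) := by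
  have h1 : a ≤ 1 := by nlinarith [sq_nonneg b]
  have h2 : -1 ≤ a := by nlinarith [sq_nonneg b]
  have h3 : b ≤ 1 := by nlinarith [sq_nonneg a]
  have h4 : -1 ≤ b := by nlinarith [sq_nonneg a]
  interval_cases a <;> interval_cases b <;> simp_all

lemma sq_add_sq_eq_four {a b : ℤ} (h : a ^ 2 + b ^ 2 = 4) :
    (a = 0 ∧ (b = 2 ∨ b = -2)) ∨ (b = 0 ∧ (a = 2 ∨ a = -2)) := by
  have h1 : a ≤ 2 := by nlinarith [sq_nonneg b]
  have h2 : -2 ≤ a := by nlinarith [sq_nonneg b]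
  have h3 : b ≤ 2 := by nlinarith [sq_nonneg a]
  have h4 : -2 ≤ b := by nlinarith [sq_nonneg a]
  interval_cases a <;> interval_cases b <;> simp_all

lemma dsq_eq_two_iff {u v : Pt} : dsq u v = 2 ↔ Near u v := by
  unfold dsq Near
  constructor
  · intro h
    have := sq_add_sq_eq_two h
    omega
  · rintro ⟨h1 | h1, h2 | h2⟩ <;> rw [h1, h2] <;> ring

lemma dsq_eq_four_iff {u v : Pt} : dsq u v = 4 ↔ Side u v := by
  unfold dsq Side
  constructor
  · intro h
    have := sq_add_sq_eq_four h
    omega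
  · rintro (⟨h1, h2 | h2⟩ | ⟨h1, h2 | h2⟩) <;> rw [h1, h2] <;> ring

lemma IsV1.not_isV2 {v : Pt} (h : IsV1 v) : ¬ IsV2 v := fun h' => h'.2.2 h.2.2
lemma IsV1.not_isV3 {v : Pt} (h : IsV1 v) : ¬ IsV3 v := by rw [isV1_iff] at h; rw [isV3_iff]; omega
lemma IsV2.not_isV3 {v : Pt} (h : IsV2 v) : ¬ IsV3 v := by rw [isV2_iff] at h; rw [isV3_iff]; omega

lemma radial_adj_iff {u v : Pt} : radial.Adj u v ↔
    ((IsV1 u ∨ IsV2 u) ∧ IsV3 v ∧ Near u v) ∨ ((IsV1 v ∨ IsV2 v) ∧ IsV3 u ∧ Near v u) ∨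
      ((IsV1 u ∨ IsV2 u) ∧ (IsV1 v ∨ IsV2 v) ∧ Side u v) := by
  change IsE1 u v ∨ IsE1 v u ∨ IsE2 u v ↔ _
  simp only [IsE1, IsE2, dsq_eq_two_iff, dsq_eq_four_iff]

lemma radial_adj_mid {u z : Pt} (hz : IsV3 z) :
    radial.Adj u z ↔ (IsV1 u ∨ IsV2 u) ∧ Near u z := by
  rw [radial_adj_iff]
  have h1 : ¬ IsV1 z := fun h => h.not_isV3 hz
  have h2 : ¬ IsV2 z := fun h => h.not_isV3 hz
  simp [h1, h2, hz]

lemma radial_adj_side {u v : Pt} (hu : IsV1 u ∨ IsV2 u) (hv : IsV1 v ∨ IsV2 v) :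
    radial.Adj u v ↔ Side u v := by
  rw [radial_adj_iff]
  have h1 : ¬ IsV3 u := fun h => hu.elim (fun h' => h'.not_isV3 h) fun h' => h'.not_isV3 h
  have h2 : ¬ IsV3 v := fun h => hv.elim (fun h' => h'.not_isV3 h) fun h' => h'.not_isV3 h
  simp [h1, h2, hu, hv]

lemma mem_cell {b v : Pt} : v ∈ cell b ↔ v = b ∨ Near b v ∨ Side b v := by
  simp only [cell, Finset.mem_insert, Finset.mem_singleton, pt_ext_iff, Near, Side]
  omega

/-! ### Vertices and edges of `G` -/

namespace BlockDomain

variable {k : ℕ} (X : BlockDomain k)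

lemma mem_terminalCell {i : Fin (2 * k - 1)} {v : Pt} :
    v ∈ X.terminalCell i ↔ v = X.terminal i ∨ v = X.port i ∨ (Near v (X.port i) ∧ IsV2 v) := by
  simp only [terminalCell, Finset.mem_union, Finset.mem_filter, Finset.mem_insert,
    Finset.mem_singleton, pt_ext_iff, Near, or_assoc]
  have : ∀ a b c d : Prop, (c ↔ d) → (a ∨ b ∨ c ↔ a ∨ b ∨ d) := by intros; tauto
  apply this
  refine and_congr_left fun _ => ?_
  omega

lemma near_terminal_port (i : Fin (2 * k - 1)) : Near (X.terminal i) (X.port i) :=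
  ((radial_adj_mid (X.port_mid i)).1 (X.port_adj_terminal i)).2

lemma exists_block_near_port (i : Fin (2 * k - 1)) : ∃ b ∈ X.blocks, Near b (X.port i) := by
  obtain ⟨b, hb, h⟩ := X.port_adj_block i
  exact ⟨b, hb, ((radial_adj_mid (X.port_mid i)).1 h).2⟩

lemma terminal_ne_block (i : Fin (2 * k - 1)) {b : Pt} (hb : b ∈ X.blocks) : X.terminal i ≠ b :=
  fun h => X.terminal_notMem i (h ▸ hb)

/-- The port of a terminal lies between the terminal and a block centre. -/
lemma opp_port_mem_blocks (i : Fin (2 * k - 1)) :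
    opp (X.port i) (X.terminal i) ∈ X.blocks := by
  obtain ⟨b, hb, h⟩ := X.exists_block_near_port i
  rcases eq_or_eq_opp_of_isV1 (X.near_terminal_port i) h (X.terminal_white i)
    (X.blocks_white b hb) with h' | h'
  · exact absurd h'.symm (X.terminal_ne_block i hb)
  · rwa [← h']

lemma mem_verts {v : Pt} : v ∈ X.verts ↔
    (∃ b ∈ X.blocks, v ∈ cell b) ∨ ∃ i, v ∈ X.terminalCell i := by
  simp [verts]

lemma mem_V1 {w : Pt} : w ∈ X.V1 ↔ w ∈ X.blocks ∨ ∃ i, X.terminal i = w := by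
  rw [V1, Finset.mem_filter, mem_verts]
  constructor
  · rintro ⟨⟨b, hb, h⟩ | ⟨i, h⟩, hw⟩
    · rcases mem_cell.1 h with rfl | h | h
      · exact Or.inl hb
      · exact absurd (h.isV3 (Or.inl (X.blocks_white b hb))) hw.not_isV3
      · exact absurd (h.isV2 (X.blocks_white b hb)) hw.not_isV2
    · rcases X.mem_terminalCell.1 h with rfl | rfl | h
      · exact Or.inr ⟨i, rfl⟩
      · exact absurd (X.port_mid i) hw.not_isV3
      · exact absurd h.2 hw.not_isV2
  · rintro (h | ⟨i, rfl⟩)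
    · exact ⟨Or.inl ⟨w, h, mem_cell.2 (Or.inl rfl)⟩, X.blocks_white w h⟩
    · exact ⟨Or.inr ⟨i, X.mem_terminalCell.2 (Or.inl rfl)⟩, X.terminal_white i⟩

lemma isV1_of_mem {w : Pt} (h : w ∈ X.V1) : IsV1 w := (Finset.mem_filter.1 h).2
lemma isV2_of_mem {w : Pt} (h : w ∈ X.V2) : IsV2 w := (Finset.mem_filter.1 h).2
lemma isV3_of_mem {w : Pt} (h : w ∈ X.V3) : IsV3 w := (Finset.mem_filter.1 h).2

lemma blocks_subset_V1 : X.blocks ⊆ X.V1 := fun _ h => X.mem_V1.2 (Or.inl h)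

/-- The triangle at a terminal contributes no new middle vertex, because its port already belongs to
a block; the same holds for its black vertices. -/
lemma mem_V3 {z : Pt} : z ∈ X.V3 ↔ ∃ b ∈ X.blocks, Near b z := by
  rw [V3, Finset.mem_filter, mem_verts]
  constructor
  · rintro ⟨⟨b, hb, h⟩ | ⟨i, h⟩, hw⟩
    · rcases mem_cell.1 h with rfl | h | h
      · exact absurd hw (X.blocks_white _ hb).not_isV3
      · exact ⟨b, hb, h⟩
      · exact absurd hw (h.isV2 (X.blocks_white b hb)).not_isV3
    · rcases X.mem_terminalCell.1 h with rfl | rfl | h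
      · exact absurd hw (X.terminal_white i).not_isV3
      · exact X.exists_block_near_port i
      · exact absurd hw h.2.not_isV3
  · rintro ⟨b, hb, h⟩
    exact ⟨Or.inl ⟨b, hb, mem_cell.2 (Or.inr (Or.inl h))⟩, h.isV3 (Or.inl (X.blocks_white b hb))⟩

lemma mem_V2_of_near {p z : Pt} (hz : z ∈ X.V3) (hp : IsV2 p) (h : Near p z) : p ∈ X.V2 := by
  obtain ⟨b, hb, hbz⟩ := X.mem_V3.1 hz
  exact Finset.mem_filter.2 ⟨X.mem_verts.2 (Or.inl ⟨b, hb, mem_cell.2 (Or.inr (Or.inr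
    (side_of_near hbz h (X.blocks_white b hb) hp)))⟩), hp⟩

lemma mem_V2 {p : Pt} : p ∈ X.V2 ↔ ∃ b ∈ X.blocks, Side b p := by
  constructor
  · rintro h
    rw [V2, Finset.mem_filter, mem_verts] at h
    obtain ⟨⟨b, hb, h⟩ | ⟨i, h⟩, hw⟩ := h
    · rcases mem_cell.1 h with rfl | h | h
      · exact absurd hw (X.blocks_white _ hb).not_isV2
      · exact absurd (h.isV3 (Or.inl (X.blocks_white b hb))) hw.not_isV3
      · exact ⟨b, hb, h⟩
    · rcases X.mem_terminalCell.1 h with rfl | rfl | h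
      · exact absurd hw (X.terminal_white i).not_isV2
      · exact absurd (X.port_mid i) hw.not_isV3
      · obtain ⟨b, hb, hbz⟩ := X.exists_block_near_port i
        exact ⟨b, hb, side_of_near hbz h.1 (X.blocks_white b hb) h.2⟩
  · rintro ⟨b, hb, h⟩
    exact Finset.mem_filter.2 ⟨X.mem_verts.2 (Or.inl ⟨b, hb, mem_cell.2 (Or.inr (Or.inr h))⟩),
      h.isV2 (X.blocks_white b hb)⟩

lemma port_mem_V3 (i : Fin (2 * k - 1)) : X.port i ∈ X.V3 :=
  X.mem_V3.2 (X.exists_block_near_port i)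

/-- The white point `w` is joined to the middle vertices and black vertices of the square with
centre `z` by edges of `G`. -/
def Sees (w z : Pt) : Prop :=
  (w ∈ X.blocks ∧ Near w z) ∨ ∃ i, X.terminal i = w ∧ X.port i = z

lemma Sees.near {X : BlockDomain k} {w z : Pt} (h : X.Sees w z) : Near w z := by
  rcases h with ⟨_, h⟩ | ⟨i, rfl, rfl⟩
  · exact h
  · exact X.near_terminal_port i

lemma Sees.mem_V1 {X : BlockDomain k} {w z : Pt} (h : X.Sees w z) : w ∈ X.V1 := by
  rcases h with ⟨h, _⟩ | ⟨i, rfl, rfl⟩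
  · exact X.mem_V1.2 (Or.inl h)
  · exact X.terminal_mem_V1 i

lemma Sees.mem_V3 {X : BlockDomain k} {w z : Pt} (h : X.Sees w z) : z ∈ X.V3 := by
  rcases h with ⟨h, h'⟩ | ⟨i, rfl, rfl⟩
  · exact X.mem_V3.2 ⟨w, h, h'⟩
  · exact X.port_mem_V3 i

/-- `u` and `v` lie in a common basic block, or in a common triangle at a terminal. -/
def SameCell (u v : Pt) : Prop := (∃ b ∈ X.blocks, u ∈ cell b ∧ v ∈ cell b) ∨
      ∃ i, u ∈ X.terminalCell i ∧ v ∈ X.terminalCell i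

lemma graph_adj {u v : Pt} : X.graph.Adj u v ↔ radial.Adj u v ∧ X.SameCell u v := Iff.rfl

lemma sees_of_sameCell {w v : Pt} (hw : IsV1 w) (h : X.SameCell w v) :
    (w ∈ X.blocks ∧ v ∈ cell w) ∨ ∃ i, X.terminal i = w ∧ v ∈ X.terminalCell i := by
  rcases h with ⟨b, hb, h1, h2⟩ | ⟨i, h1, h2⟩
  · left
    rcases mem_cell.1 h1 with rfl | h | h
    · exact ⟨hb, h2⟩
    · exact absurd (h.isV3 (Or.inl (X.blocks_white b hb))) hw.not_isV3
    · exact absurd (h.isV2 (X.blocks_white b hb)) hw.not_isV2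
  · right
    rcases X.mem_terminalCell.1 h1 with rfl | rfl | h
    · exact ⟨i, rfl, h2⟩
    · exact absurd (X.port_mid i) hw.not_isV3
    · exact absurd h.2 hw.not_isV2

lemma adj_white_mid {w z : Pt} (hw : IsV1 w) (hz : IsV3 z) : X.graph.Adj w z ↔ X.Sees w z := by
  rw [graph_adj, radial_adj_mid hz]
  constructor
  · rintro ⟨⟨_, hn⟩, h⟩
    rcases X.sees_of_sameCell hw h with ⟨hb, _⟩ | ⟨i, rfl, ht⟩
    · exact Or.inl ⟨hb, hn⟩
    · refine Or.inr ⟨i, rfl, ?_⟩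
      rcases X.mem_terminalCell.1 ht with rfl | rfl | h
      · exact absurd hz hw.not_isV3
      · rfl
      · exact absurd hz h.2.not_isV3
  · intro h
    refine ⟨⟨Or.inl hw, h.near⟩, ?_⟩
    rcases h with ⟨h, h'⟩ | ⟨i, rfl, rfl⟩
    · exact Or.inl ⟨w, h, mem_cell.2 (Or.inl rfl), mem_cell.2 (Or.inr (Or.inl h'))⟩
    · exact Or.inr ⟨i, X.mem_terminalCell.2 (Or.inl rfl),
        X.mem_terminalCell.2 (Or.inr (Or.inl rfl))⟩

/-- A block containing a middle vertex contains both of its black neighbours, so no such edge is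
missing in `G`. What is missing at a boundary vertex is therefore always a white neighbour. -/
lemma adj_black_mid {p z : Pt} (hp : IsV2 p) (hz : z ∈ X.V3) : X.graph.Adj p z ↔ Near p z := by
  have hz3 := X.isV3_of_mem hz
  rw [graph_adj, radial_adj_mid hz3]
  refine ⟨fun h => h.1.2, fun h => ⟨⟨Or.inr hp, h⟩, ?_⟩⟩
  obtain ⟨b, hb, hbz⟩ := X.mem_V3.1 hz
  exact Or.inl ⟨b, hb, mem_cell.2 (Or.inr (Or.inr (side_of_near hbz h (X.blocks_white b hb) hp))),
    mem_cell.2 (Or.inr (Or.inl hbz))⟩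

lemma adj_white_black {w p : Pt} (hw : IsV1 w) (hp : IsV2 p) :
    X.graph.Adj w p ↔ ∃ z, X.Sees w z ∧ Near p z := by
  rw [graph_adj, radial_adj_side (Or.inl hw) (Or.inr hp)]
  constructor
  · rintro ⟨hs, h⟩
    rcases X.sees_of_sameCell hw h with ⟨hb, _⟩ | ⟨i, rfl, ht⟩
    · obtain ⟨z, h1, h2⟩ := hs.exists_near
      exact ⟨z, Or.inl ⟨hb, h1⟩, h2⟩
    · rcases X.mem_terminalCell.1 ht with rfl | rfl | h
      · exact absurd hp hw.not_isV2
      · exact absurd (X.port_mid i) hp.not_isV3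
      · exact ⟨_, Or.inr ⟨i, rfl, rfl⟩, h.1⟩
  · rintro ⟨z, h, hpz⟩
    have hs := side_of_near h.near hpz hw hp
    refine ⟨hs, ?_⟩
    rcases h with ⟨h, h'⟩ | ⟨i, rfl, rfl⟩
    · exact Or.inl ⟨w, h, mem_cell.2 (Or.inl rfl), mem_cell.2 (Or.inr (Or.inr hs))⟩
    · exact Or.inr ⟨i, X.mem_terminalCell.2 (Or.inl rfl),
        X.mem_terminalCell.2 (Or.inr (Or.inr ⟨hpz, hp⟩))⟩

lemma verts_cases {v : Pt} (h : v ∈ X.verts) : v ∈ X.V1 ∨ v ∈ X.V2 ∨ v ∈ X.V3 := by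
  have : IsV1 v ∨ IsV2 v ∨ IsV3 v := by
    rcases X.mem_verts.1 h with ⟨b, hb, h⟩ | ⟨i, h⟩
    · rcases mem_cell.1 h with rfl | h | h
      · exact Or.inl (X.blocks_white _ hb)
      · exact Or.inr (Or.inr (h.isV3 (Or.inl (X.blocks_white b hb))))
      · exact Or.inr (Or.inl (h.isV2 (X.blocks_white b hb)))
    · rcases X.mem_terminalCell.1 h with rfl | rfl | h
      · exact Or.inl (X.terminal_white i)
      · exact Or.inr (Or.inr (X.port_mid i))
      · exact Or.inr (Or.inl h.2)
  rcases this with h' | h' | h'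
  · exact Or.inl (Finset.mem_filter.2 ⟨h, h'⟩)
  · exact Or.inr (Or.inl (Finset.mem_filter.2 ⟨h, h'⟩))
  · exact Or.inr (Or.inr (Finset.mem_filter.2 ⟨h, h'⟩))

lemma V1_subset_verts : X.V1 ⊆ X.verts := Finset.filter_subset _ _
lemma V2_subset_verts : X.V2 ⊆ X.verts := Finset.filter_subset _ _
lemma V3_subset_verts : X.V3 ⊆ X.verts := Finset.filter_subset _ _

lemma card_verts : X.verts.card = X.V1.card + X.V2.card + X.V3.card := by
  have h : X.verts = (X.V1 ∪ X.V2) ∪ X.V3 := by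
    ext v
    rw [Finset.mem_union, Finset.mem_union, or_assoc]
    exact ⟨X.verts_cases, fun h => h.elim (fun h => X.V1_subset_verts h) fun h =>
      h.elim (fun h => X.V2_subset_verts h) fun h => X.V3_subset_verts h⟩
  rw [h, Finset.card_union_of_disjoint, Finset.card_union_of_disjoint]
  · exact Finset.disjoint_left.2 fun v h1 h2 => (X.isV1_of_mem h1).not_isV2 (X.isV2_of_mem h2)
  · refine Finset.disjoint_left.2 fun v h1 h2 => ?_
    rcases Finset.mem_union.1 h1 with h1 | h1
    · exact (X.isV1_of_mem h1).not_isV3 (X.isV3_of_mem h2)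
    · exact (X.isV2_of_mem h1).not_isV3 (X.isV3_of_mem h2)

lemma card_V1 : X.V1.card = X.blocks.card + (2 * k - 1) := by
  have h : X.V1 = X.blocks ∪ Finset.univ.image X.terminal := by
    ext v; simp [mem_V1]
  rw [h, Finset.card_union_of_disjoint, Finset.card_image_of_injective _ X.terminal_injective,
    Finset.card_univ, Fintype.card_fin]
  refine Finset.disjoint_left.2 fun v h1 h2 => ?_
  obtain ⟨i, -, rfl⟩ := Finset.mem_image.1 h2
  exact X.terminal_notMem i h1

lemma graph_adj_mem_verts {u v : Pt} (h : X.graph.Adj u v) : u ∈ X.verts ∧ v ∈ X.verts :=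
  ⟨X.graph.edge_vert h, X.graph.edge_vert h.symm⟩

/-- Edges of `G` join vertices of different colours. -/
lemma adj_color {u v : Pt} (h : X.graph.Adj u v) :
    (u ∈ X.V1 ∧ (v ∈ X.V2 ∨ v ∈ X.V3)) ∨ (u ∈ X.V2 ∧ (v ∈ X.V1 ∨ v ∈ X.V3)) ∨
      (u ∈ X.V3 ∧ (v ∈ X.V1 ∨ v ∈ X.V2)) := by
  obtain ⟨hu, hv⟩ := X.graph_adj_mem_verts h
  have hr := radial_adj_iff.1 h.1
  rcases X.verts_cases hu with h1 | h1 | h1 <;> rcases X.verts_cases hv with h2 | h2 | h2 <;>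
    simp only [h1, h2, true_and, true_or, or_true, and_true]
  · exfalso
    have e1 := X.isV1_of_mem h1; have e2 := X.isV1_of_mem h2
    rcases hr with ⟨_, h3, _⟩ | ⟨_, h3, _⟩ | ⟨_, _, h3⟩
    · exact e2.not_isV3 h3
    · exact e1.not_isV3 h3
    · exact e2.not_isV2 (h3.isV2 e1)
  · exfalso
    have e1 := X.isV2_of_mem h1; have e2 := X.isV2_of_mem h2
    rcases hr with ⟨_, h3, _⟩ | ⟨_, h3, _⟩ | ⟨_, _, h3⟩
    · exact e2.not_isV3 h3
    · exact e1.not_isV3 h3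
    · exact (h3.isV1 e1).not_isV2 e2
  · exfalso
    have e1 := X.isV3_of_mem h1; have e2 := X.isV3_of_mem h2
    rcases hr with ⟨h3, _, _⟩ | ⟨h3, _, _⟩ | ⟨h3, _, _⟩
    · exact h3.elim (fun h => h.not_isV3 e1) fun h => h.not_isV3 e1
    · exact h3.elim (fun h => h.not_isV3 e2) fun h => h.not_isV3 e2
    · exact h3.elim (fun h => h.not_isV3 e1) fun h => h.not_isV3 e1

end BlockDomain

/-! ### Homology of the union of the basic blocks -/

lemma Near.eq_corner {x z : Pt} (h : Near x z) : z = (x.1 + 1, x.2 + 1) ∨ z = (x.1 + 1, x.2 - 1) ∨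
    z = (x.1 - 1, x.2 + 1) ∨ z = (x.1 - 1, x.2 - 1) := by
  simp only [pt_ext_iff]
  unfold Near at h
  omega

lemma near_corner (x : Pt) : Near x (x.1 + 1, x.2 + 1) ∧ Near x (x.1 + 1, x.2 - 1) ∧
    Near x (x.1 - 1, x.2 + 1) ∧ Near x (x.1 - 1, x.2 - 1) := by
  simp [Near]

/-- The sum of a function over the four corners of a square. -/
def cornerSum {R : Type*} [Add R] (φ : Pt → R) (x : Pt) : R :=
  φ (x.1 + 1, x.2 + 1) + φ (x.1 + 1, x.2 - 1) + φ (x.1 - 1, x.2 + 1) + φ (x.1 - 1, x.2 - 1)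

lemma sum_near_eq_cornerSum {R : Type*} [AddCommMonoid R] (F : Finset Pt) (φ : Pt → R)
    (hφ : ∀ z, z ∉ F → φ z = 0) (x : Pt) :
    ∑ z ∈ F, (if Near x z then φ z else 0) = cornerSum φ x := by
  rw [← Finset.sum_filter]
  have h : ∑ z ∈ F.filter (fun z => Near x z), φ z =
      ∑ z ∈ ({(x.1 + 1, x.2 + 1), (x.1 + 1, x.2 - 1), (x.1 - 1, x.2 + 1), (x.1 - 1, x.2 - 1)} :
        Finset Pt), φ z := by
    refine Finset.sum_subset (fun z hz => ?_) (fun z hz hz' => ?_)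
    · have := (Finset.mem_filter.1 hz).2.eq_corner
      simpa using this
    · refine hφ z fun hF => hz' (Finset.mem_filter.2 ⟨hF, ?_⟩)
      simp only [Finset.mem_insert, Finset.mem_singleton] at hz
      obtain ⟨h1, h2, h3, h4⟩ := near_corner x
      rcases hz with rfl | rfl | rfl | rfl <;> assumption
  rw [h, Finset.sum_insert, Finset.sum_insert, Finset.sum_insert, Finset.sum_singleton, cornerSum,
    ← add_assoc, ← add_assoc]
  all_goals
    simp only [Finset.mem_insert, Finset.mem_singleton, Prod.mk.injEq]
    omega

/-- The terms at the centre and on the axes occur an even number of times. For a function carried by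
white points, evaluated at a black point, the remaining far corners are black, so the boundary of a
boundary vanishes. -/
lemma cornerSum_cornerSum (φ : Pt → ZMod 2) (x : Pt) : cornerSum (cornerSum φ) x =
    φ (x.1 + 2, x.2 + 2) + φ (x.1 + 2, x.2 - 2) + φ (x.1 - 2, x.2 + 2) + φ (x.1 - 2, x.2 - 2) := by
  have h2 : (2 : ZMod 2) = 0 := rfl
  have e1 : ∀ a : ℤ, a + 1 + 1 = a + 2 := fun a => by ring
  have e2 : ∀ a : ℤ, a + 1 - 1 = a := fun a => by ring
  have e3 : ∀ a : ℤ, a - 1 + 1 = a := fun a => by ring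
  have e4 : ∀ a : ℤ, a - 1 - 1 = a - 2 := fun a => by ring
  simp only [cornerSum, e1, e2, e3, e4]
  linear_combination (φ (x.1 + 2, x.2) + φ (x.1 - 2, x.2) + φ (x.1, x.2 + 2) + φ (x.1, x.2 - 2) +
    2 * φ (x.1, x.2)) * h2

/-- The indicator function of a finite set, modulo two. -/
def ind (D : Finset Pt) (x : Pt) : ZMod 2 := if x ∈ D then 1 else 0

lemma ind_eq_zero {D : Finset Pt} {x : Pt} (h : x ∉ D) : ind D x = 0 := if_neg h

lemma cornerSum_of_isV1 {φ : Pt → ZMod 2} (hφ : ∀ x, φ x ≠ 0 → IsV1 x) {w z : Pt} (hw : IsV1 w)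
    (h : Near w z) : cornerSum φ z = φ w + φ (opp z w) := by
  have h0 : ∀ x, ¬ IsV1 x → φ x = 0 := fun x hx => by
    by_contra h'; exact hx (hφ x h')
  have hne : ∀ x, Near x z → x ≠ w → x ≠ opp z w → φ x = 0 := fun x hx h1 h2 =>
    h0 x fun hx1 => (eq_or_eq_opp_of_isV1 h hx hw hx1).elim h1 h2
  obtain ⟨a, b⟩ := z
  obtain ⟨c1, c2, c3, c4⟩ := near_corner (a, b)
  unfold cornerSum
  rcases h.symm.eq_corner with rfl | rfl | rfl | rfl
  · rw [hne _ c2.symm, hne _ c3.symm, add_zero, add_zero]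
    · congr 2; simp [opp]; omega
    all_goals (simp only [opp, Ne, pt_ext_iff]; omega)
  · rw [hne _ c1.symm, hne _ c4.symm, add_zero, zero_add]
    · congr 2; simp [opp]; omega
    all_goals (simp only [opp, Ne, pt_ext_iff]; omega)
  · rw [hne _ c1.symm, hne _ c4.symm, add_zero, zero_add, add_comm]
    · congr 2; simp [opp]; omega
    all_goals (simp only [opp, Ne, pt_ext_iff]; omega)
  · rw [hne _ c2.symm, hne _ c3.symm, add_zero, add_zero, add_comm]
    · congr 2; simp [opp]; omega
    all_goals (simp only [opp, Ne, pt_ext_iff]; omega)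

namespace BlockDomain

variable {k : ℕ} {X : BlockDomain k}

lemma eq_of_side_block {α : Type*} {φ : Pt → α}
    (hφ : ∀ z ∈ X.V3, ∀ p p', IsV2 p → IsV2 p' → Near p z → Near p' z → φ p = φ p') {b : Pt}
    (hb : b ∈ X.blocks) {p p' : Pt} (hp : Side b p) (hp' : Side b p') : φ p = φ p' := by
  have hbw := X.blocks_white b hb
  have key : ∀ p p' z, Side b p → Side b p' → Near b z → Near p z → Near p' z → φ p = φ p' :=
    fun p p' z h1 h2 h3 h4 h5 =>
      hφ z (X.mem_V3.2 ⟨b, hb, h3⟩) p p' (h1.isV2 hbw) (h2.isV2 hbw) h4 h5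
  obtain ⟨x, y⟩ := b
  have e1 : φ (x + 2, y) = φ (x, y + 2) := key _ _ (x + 1, y + 1) (by simp [Side])
    (by simp [Side]) (by simp [Near]) (by simp [Near]; omega) (by simp [Near]; omega)
  have e2 : φ (x + 2, y) = φ (x, y - 2) := key _ _ (x + 1, y - 1) (by simp [Side])
    (by simp [Side]) (by simp [Near]) (by simp [Near]; omega) (by simp [Near]; omega)
  have e3 : φ (x - 2, y) = φ (x, y + 2) := key _ _ (x - 1, y + 1) (by simp [Side])
    (by simp [Side]) (by simp [Near]) (by simp [Near]; omega) (by simp [Near]; omega)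
  have all : ∀ p, Side (x, y) p → φ p = φ (x, y + 2) := by
    rintro ⟨u, v⟩ (⟨h1, h2 | h2⟩ | ⟨h1, h2 | h2⟩) <;> simp only at h1 h2 <;> subst h1 h2
    · rfl
    · rw [← e2, e1]
    · exact e1
    · exact e3
  rw [all p hp, all p' hp']

/-- The black graph inherits connectedness from `G`. Along a walk in `G`, the property preserved is
that all black vertices equal or adjacent to the current vertex have the value of the first; this
works because consecutive vertices share a block or a triangle. -/
lemma eq_on_V2_of_connected (hX : X.graph.Connected) {α : Type*} {φ : Pt → α}
    (hφ : ∀ z ∈ X.V3, ∀ p p', IsV2 p → IsV2 p' → Near p z → Near p' z → φ p = φ p') {p q : Pt}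
    (hp : p ∈ X.V2) (hq : q ∈ X.V2) : φ p = φ q := by
  have hnb : ∀ {p p'}, IsV2 p → IsV2 p' → ¬ X.graph.Adj p p' := by
    intro p p' h h' hadj
    rcases X.adj_color hadj with ⟨h1, _⟩ | ⟨_, h1 | h1⟩ | ⟨h1, _⟩
    · exact (X.isV1_of_mem h1).not_isV2 h
    · exact (X.isV1_of_mem h1).not_isV2 h'
    · exact h'.not_isV3 (X.isV3_of_mem h1)
    · exact h.not_isV3 (X.isV3_of_mem h1)
  have step : ∀ u v, X.SameCell u v →
      (∀ p', IsV2 p' → (p' = u ∨ X.graph.Adj u p') → φ p' = φ p) →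
      ∀ p', IsV2 p' → (p' = v ∨ X.graph.Adj v p') → φ p' = φ p := by
    rintro u v (⟨b, hb, hu, hv⟩ | ⟨i, hu, hv⟩) hc p' hp' hvp
    · have hbw := X.blocks_white b hb
      have h1 : ∃ p₀, Side b p₀ ∧ (p₀ = u ∨ X.graph.Adj u p₀) := by
        rcases mem_cell.1 hu with rfl | hu | hu
        · have hs : Side u (u.1 + 2, u.2) := by simp [Side]
          obtain ⟨z, hz1, hz2⟩ := hs.exists_near
          exact ⟨_, hs, Or.inr ((X.adj_white_black hbw (hs.isV2 hbw)).2 ⟨z, Or.inl ⟨hb, hz1⟩, hz2⟩)⟩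
        · obtain ⟨p₀, hp₀, hn⟩ := exists_isV2_near (hu.isV3 (Or.inl hbw))
          exact ⟨p₀, side_of_near hu hn hbw hp₀,
            Or.inr ((X.adj_black_mid hp₀ (X.mem_V3.2 ⟨b, hb, hu⟩)).2 hn).symm⟩
        · exact ⟨u, hu, Or.inl rfl⟩
      obtain ⟨p₀, hs, h1⟩ := h1
      rw [← hc p₀ (hs.isV2 hbw) h1]
      refine eq_of_side_block hφ hb ?_ hs
      rcases mem_cell.1 hv with rfl | hv | hv
      · rcases hvp with rfl | hvp
        · exact absurd hp' hbw.not_isV2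
        · exact (radial_adj_side (Or.inl hbw) (Or.inr hp')).1 hvp.1
      · rcases hvp with rfl | hvp
        · exact absurd (hv.isV3 (Or.inl hbw)) hp'.not_isV3
        · exact side_of_near hv
            ((X.adj_black_mid hp' (X.mem_V3.2 ⟨b, hb, hv⟩)).1 hvp.symm) hbw hp'
      · rcases hvp with rfl | hvp
        · exact hv
        · exact absurd hvp (hnb (hv.isV2 hbw) hp')
    · have h1 : ∃ p₀, IsV2 p₀ ∧ Near p₀ (X.port i) ∧ (p₀ = u ∨ X.graph.Adj u p₀) := by
        obtain ⟨p₀, hp₀, hn⟩ := exists_isV2_near (X.port_mid i)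
        rcases X.mem_terminalCell.1 hu with rfl | rfl | hu
        · exact ⟨p₀, hp₀, hn, Or.inr ((X.adj_white_black (X.terminal_white i) hp₀).2
            ⟨_, Or.inr ⟨i, rfl, rfl⟩, hn⟩)⟩
        · exact ⟨p₀, hp₀, hn, Or.inr ((X.adj_black_mid hp₀ (X.port_mem_V3 i)).2 hn).symm⟩
        · exact ⟨u, hu.2, hu.1, Or.inl rfl⟩
      obtain ⟨p₀, hp₀, hn, h1⟩ := h1
      rw [← hc p₀ hp₀ h1]
      refine hφ _ (X.port_mem_V3 i) _ _ hp' hp₀ ?_ hn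
      rcases X.mem_terminalCell.1 hv with rfl | rfl | hv
      · rcases hvp with rfl | hvp
        · exact absurd hp' (X.terminal_white i).not_isV2
        · obtain ⟨z, ⟨hz, -⟩ | ⟨j, hj, rfl⟩, hz'⟩ :=
            (X.adj_white_black (X.terminal_white i) hp').1 hvp
          · exact absurd hz (X.terminal_notMem i)
          · rwa [X.terminal_injective hj] at hz'
      · rcases hvp with rfl | hvp
        · exact absurd (X.port_mid i) hp'.not_isV3
        · exact (X.adj_black_mid hp' (X.port_mem_V3 i)).1 hvp.symm
      · rcases hvp with rfl | hvp
        · exact hv.1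
        · exact absurd hvp (hnb hv.2 hp')
  have walk : ∀ u v : X.graph.verts, X.graph.coe.Walk u v →
      (∀ p', IsV2 p' → (p' = u ∨ X.graph.Adj u p') → φ p' = φ p) →
      ∀ p', IsV2 p' → (p' = v ∨ X.graph.Adj v p') → φ p' = φ p := by
    intro u v w
    induction w with
    | nil => exact id
    | cons hadj _ ih => exact fun h => ih (step _ _ hadj.2 h)
  obtain ⟨w⟩ := hX.coe.preconnected ⟨p, X.V2_subset_verts hp⟩ ⟨q, X.V2_subset_verts hq⟩
  refine (walk _ _ w ?_ q (X.isV2_of_mem hq) (Or.inl rfl)).symm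
  rintro p' hp' (rfl | h)
  · rfl
  · exact absurd h (hnb (X.isV2_of_mem hp) hp')

end BlockDomain

namespace BlockDomain

variable {k : ℕ} {X : BlockDomain k}

/-- Euler's relation: faces are the blocks, edges the middle vertices, vertices the black ones, and
the characteristic is one. The number `2k - 1` of terminals is what turns the impurity count into
this. -/
lemma card_blocks_add (hk : 1 ≤ k) (hX : X.IsImpurityDomain) :
    X.blocks.card + X.V2.card = X.V3.card + 1 := by
  have h1 := hX.impurity_count
  have h2 := X.card_V1
  omega

/-- Extension by zero. -/
def extend (F : Finset Pt) (x : F → ZMod 2) (v : Pt) : ZMod 2 := if h : v ∈ F then x ⟨v, h⟩ else 0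

lemma extend_apply (F : Finset Pt) (x : F → ZMod 2) (v : F) : extend F x v = x v := by
  simp [extend]

lemma extend_of_notMem {F : Finset Pt} (x : F → ZMod 2) {v : Pt} (h : v ∉ F) :
    extend F x v = 0 := by
  simp [extend, h]

/-- The incidence matrix, modulo two, of the nearness relation. -/
def nearMatrix (F F' : Finset Pt) : Matrix F F' (ZMod 2) :=
  Matrix.of fun x y => if Near x y then 1 else 0

lemma nearMatrix_mulVec (F F' : Finset Pt) (x : F' → ZMod 2) (v : F) :
    Matrix.mulVec (nearMatrix F F') x v = cornerSum (extend F' x) v := by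
  rw [← sum_near_eq_cornerSum F' _ (fun z hz => extend_of_notMem x hz)]
  simp only [Matrix.mulVec, dotProduct, nearMatrix, Matrix.of_apply, ite_mul, one_mul, zero_mul]
  rw [← Finset.sum_coe_sort F']
  exact Finset.sum_congr rfl fun z _ => by rw [extend_apply]

lemma nearMatrix_transpose (F F' : Finset Pt) :
    (nearMatrix F F').transpose = nearMatrix F' F := by
  ext x y
  simp [nearMatrix, near_comm]

/-- At the point of the support with the greatest `x + y`, nothing cancels across the upper right
corner. Thus a finite region is determined by its boundary. -/
lemma eq_zero_of_cornerSum_eq_zero {S : Finset Pt} (hS : ∀ v ∈ S, IsV1 v) {φ : Pt → ZMod 2}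
    (hφ : ∀ v, φ v ≠ 0 → v ∈ S) (h : ∀ w ∈ S, ∀ z, Near w z → cornerSum φ z = 0) :
    ∀ v, φ v = 0 := by
  by_contra! hcon
  obtain ⟨v, hv⟩ := hcon
  obtain ⟨w, hw, hmax⟩ := (S.filter fun v => φ v ≠ 0).exists_max_image
    (fun v => v.1 + v.2) ⟨v, by simp [hv, hφ v hv]⟩
  rw [Finset.mem_filter] at hw
  have hn : Near w (w.1 + 1, w.2 + 1) := (near_corner w).1
  have h1 := h w hw.1 _ hn
  rw [cornerSum_of_isV1 (fun x hx => hS x (hφ x hx)) (hS w hw.1) hn] at h1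
  have h2 : φ (opp (w.1 + 1, w.2 + 1) w) = 0 := by
    by_contra h0
    have := hmax (opp (w.1 + 1, w.2 + 1) w) (Finset.mem_filter.2 ⟨hφ _ h0, h0⟩)
    simp only [opp] at this
    omega
  rw [h2, add_zero] at h1
  exact hw.2 h1

lemma nearMatrix_blocks_injective :
    Function.Injective (nearMatrix X.V3 X.blocks).mulVecLin := by
  rw [← LinearMap.ker_eq_bot, LinearMap.ker_eq_bot']
  intro x hx
  have := eq_zero_of_cornerSum_eq_zero X.blocks_white (φ := extend X.blocks x)
    (fun v hv => by
      by_contra h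
      exact hv (extend_of_notMem x h))
    (fun w hw z hz => by
      have := congrFun hx ⟨z, X.mem_V3.2 ⟨w, hw, hz⟩⟩
      rwa [Matrix.mulVecLin_apply, nearMatrix_mulVec] at this)
  funext v
  rw [← extend_apply X.blocks x v, this v]
  rfl

lemma range_le_ker_nearMatrix : LinearMap.range (nearMatrix X.V3 X.blocks).mulVecLin ≤
    LinearMap.ker (nearMatrix X.V2 X.V3).mulVecLin := by
  rintro _ ⟨x, rfl⟩
  rw [LinearMap.mem_ker]
  funext p
  rw [Matrix.mulVecLin_apply, nearMatrix_mulVec]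
  have h1 : extend X.V3 ((nearMatrix X.V3 X.blocks).mulVecLin x) = fun z =>
      if z ∈ X.V3 then cornerSum (extend X.blocks x) z else 0 := by
    funext z
    split_ifs with hz
    · rw [← nearMatrix_mulVec X.V3 X.blocks x ⟨z, hz⟩]
      exact extend_apply X.V3 _ ⟨z, hz⟩
    · exact extend_of_notMem _ hz
  have hp := X.isV2_of_mem p.2
  have h2 : ∀ z, Near p z → extend X.V3 ((nearMatrix X.V3 X.blocks).mulVecLin x) z =
      cornerSum (extend X.blocks x) z := by
    intro z hz
    rw [h1]
    simp only
    split_ifs with h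
    · rfl
    · have h0 : ∀ w, Near z w → extend X.blocks x w = 0 := fun w hw =>
        extend_of_notMem x fun hwB => h (X.mem_V3.2 ⟨w, hwB, hw.symm⟩)
      obtain ⟨c1, c2, c3, c4⟩ := near_corner z
      rw [cornerSum, h0 _ c1, h0 _ c2, h0 _ c3, h0 _ c4]
      rfl
  have h3 : cornerSum (extend X.V3 ((nearMatrix X.V3 X.blocks).mulVecLin x)) p =
      cornerSum (cornerSum (extend X.blocks x)) p := by
    obtain ⟨c1, c2, c3, c4⟩ := near_corner p
    rw [cornerSum, h2 _ c1, h2 _ c2, h2 _ c3, h2 _ c4]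
    rfl
  rw [h3, cornerSum_cornerSum]
  have h4 : ∀ v, IsV2 v → extend X.blocks x v = 0 := fun v hv =>
    extend_of_notMem x fun h => (X.blocks_white v h).not_isV2 hv
  rw [isV2_iff] at hp
  rw [h4, h4, h4, h4]
  · rfl
  all_goals
    rw [isV2_iff]
    simp only
    omega

/-- A function killed by the coboundary has equal values at the ends of every edge, hence is
constant by connectedness. -/
lemma finrank_ker_nearMatrix_le (hX : X.graph.Connected) :
    Module.finrank (ZMod 2) (LinearMap.ker (nearMatrix X.V3 X.V2).mulVecLin) ≤ 1 := by
  have hle : LinearMap.ker (nearMatrix X.V3 X.V2).mulVecLin ≤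
      Submodule.span (ZMod 2) {fun _ => 1} := by
    intro y hy
    rw [LinearMap.mem_ker] at hy
    by_cases hne : Nonempty X.V2
    · obtain ⟨p₀⟩ := hne
      rw [Submodule.mem_span_singleton]
      refine ⟨y p₀, ?_⟩
      funext p
      simp only [Pi.smul_apply, smul_eq_mul, mul_one]
      rw [← extend_apply X.V2 y p₀, ← extend_apply X.V2 y p]
      refine eq_on_V2_of_connected hX ?_ p₀.2 p.2
      intro z hz p p' hp hp' hpz hpz'
      have h1 := congrFun hy ⟨z, hz⟩
      rw [Matrix.mulVecLin_apply, nearMatrix_mulVec,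
        ← sum_near_eq_cornerSum X.V2 _ (fun z hz => extend_of_notMem y hz), ← Finset.sum_filter] at h1
      have hpV := X.mem_V2_of_near hz hp hpz
      have hpV' := X.mem_V2_of_near hz hp' hpz'
      by_cases hpp : p = p'
      · rw [hpp]
      have h2 : X.V2.filter (fun q => Near z q) = {p, p'} := by
        ext q
        simp only [Finset.mem_filter, Finset.mem_insert, Finset.mem_singleton]
        constructor
        · rintro ⟨hq, hn⟩
          rcases eq_or_eq_opp_of_isV2 hpz hn.symm hp (X.isV2_of_mem hq) with h | h
          · exact Or.inl h
          · rcases eq_or_eq_opp_of_isV2 hpz hpz' hp hp' with h' | h'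
            · exact absurd h'.symm hpp
            · exact Or.inr (h.trans h'.symm)
        · rintro (rfl | rfl)
          · exact ⟨hpV, hpz.symm⟩
          · exact ⟨hpV', hpz'.symm⟩
      change ∑ q ∈ X.V2.filter (fun q => Near z q), extend X.V2 y q = 0 at h1
      rw [h2, Finset.sum_pair hpp] at h1
      exact CharTwo.add_eq_zero.1 h1
    · have : y = 0 := by
        funext p
        exact absurd ⟨p⟩ hne
      rw [this]
      exact Submodule.zero_mem _
  exact (Submodule.finrank_mono hle).trans ((finrank_span_le_card _).trans (by simp))

/-- Every cycle of the graph on the black vertices is the boundary of a set of basic blocks. -/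
lemma exists_bounding (hk : 1 ≤ k) (hX : X.IsImpurityDomain) (a : Pt → ZMod 2)
    (ha : ∀ z, a z ≠ 0 → z ∈ X.V3) (hcyc : ∀ p, IsV2 p → cornerSum a p = 0) :
    ∃ D ⊆ X.blocks, ∀ z, IsV3 z → a z = cornerSum (ind D) z := by
  classical
  set M := nearMatrix X.V2 X.V3 with hM
  set M' := nearMatrix X.V3 X.blocks with hM'
  have hcard := card_blocks_add hk hX
  have h1 := LinearMap.finrank_range_add_finrank_ker M.mulVecLin
  have h2 := LinearMap.finrank_range_add_finrank_ker M.transpose.mulVecLin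
  have h3 : Module.finrank (ZMod 2) (LinearMap.range M.transpose.mulVecLin) =
      Module.finrank (ZMod 2) (LinearMap.range M.mulVecLin) := Matrix.rank_transpose M
  have h4 := finrank_ker_nearMatrix_le hX.connected
  rw [← nearMatrix_transpose, ← hM] at h4
  have h5 := LinearMap.finrank_range_of_inj (nearMatrix_blocks_injective (X := X))
  rw [Module.finrank_fintype_fun_eq_card, Fintype.card_coe] at h1 h2 h5
  -- Boundaries of sets of blocks form a space of dimension equal to the number of blocks. Cycles
  -- form a space of dimension at most `|V3| - |V2| + 1`, which is the same number by Euler's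
  -- relation.
  have heq := Submodule.eq_of_le_of_finrank_le (range_le_ker_nearMatrix (X := X)) (by
    rw [← hM, h5]; omega)
  have hamem : (fun z : X.V3 => a z) ∈ LinearMap.ker M.mulVecLin := by
    rw [LinearMap.mem_ker]
    funext p
    rw [Matrix.mulVecLin_apply, nearMatrix_mulVec]
    have : extend X.V3 (fun z : X.V3 => a z) = a := by
      funext z
      simp only [extend]
      split_ifs with h
      · rfl
      · by_contra h'
        exact h (ha z (Ne.symm h'))
    rw [this]
    exact hcyc p (X.isV2_of_mem p.2)
  rw [← heq] at hamem
  obtain ⟨x, hx⟩ := hamem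
  have hext : ind (X.blocks.filter fun b => extend X.blocks x b ≠ 0) = extend X.blocks x := by
    funext v
    unfold ind
    by_cases hv : v ∈ X.blocks
    · simp only [Finset.mem_filter, hv, true_and]
      have : ∀ t : ZMod 2, (if t ≠ 0 then (1 : ZMod 2) else 0) = t := by decide
      exact this _
    · simp [Finset.mem_filter, hv, extend_of_notMem x hv]
  refine ⟨X.blocks.filter fun b => extend X.blocks x b ≠ 0, Finset.filter_subset _ _,
    fun z hz3 => ?_⟩
  rw [hext]
  by_cases hz : z ∈ X.V3
  · have := congrFun hx ⟨z, hz⟩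
    rw [Matrix.mulVecLin_apply, nearMatrix_mulVec] at this
    exact this.symm
  · have h0 : ∀ w, Near z w → extend X.blocks x w = 0 := fun w hw =>
      extend_of_notMem x fun hwB => hz (X.mem_V3.2 ⟨w, hwB, hw.symm⟩)
    obtain ⟨c1, c2, c3, c4⟩ := near_corner z
    rw [cornerSum, h0 _ c1, h0 _ c2, h0 _ c3, h0 _ c4]
    by_contra h'
    exact hz (ha z (by simpa using h'))

end BlockDomain

/-! ### Boundaries and cycles in the plane -/

/-- The segment through `z` joins a point of `c` to a point outside `c`. -/
def Bd (c : Finset Pt) (z : Pt) : Prop := ∃ w ∈ c, Near w z ∧ opp z w ∉ c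

lemma Near.exists_signs {p z : Pt} (h : Near p z) : ∃ s t : ℤ, (s = 1 ∨ s = -1) ∧
    (t = 1 ∨ t = -1) ∧ z = (p.1 + s, p.2 + t) := by
  refine ⟨z.1 - p.1, z.2 - p.2, ?_⟩
  rw [pt_ext_iff]
  unfold Near at h
  simp only
  omega

lemma near_of_signs (p : Pt) {s t : ℤ} (hs : s = 1 ∨ s = -1) (ht : t = 1 ∨ t = -1) :
    Near p (p.1 + s, p.2 + t) := by
  unfold Near
  simp only
  omega

lemma bd_iff {c : Finset Pt} {p : Pt} {s t : ℤ} (hs : s = 1 ∨ s = -1) (ht : t = 1 ∨ t = -1)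
    (hc : ∀ w ∈ c, Near w (p.1 + s, p.2 + t) → Side p w) :
    Bd c (p.1 + s, p.2 + t) ↔ ¬ ((p.1 + 2 * s, p.2) ∈ c ↔ (p.1, p.2 + 2 * t) ∈ c) := by
  have e1 : opp (p.1 + s, p.2 + t) (p.1 + 2 * s, p.2) = (p.1, p.2 + 2 * t) := by
    simp only [opp, pt_ext_iff]; omega
  have e2 : opp (p.1 + s, p.2 + t) (p.1, p.2 + 2 * t) = (p.1 + 2 * s, p.2) := by
    simp only [opp, pt_ext_iff]; omega
  have n1 : Near (p.1 + 2 * s, p.2) (p.1 + s, p.2 + t) := by simp only [Near]; omega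
  have n2 : Near (p.1, p.2 + 2 * t) (p.1 + s, p.2 + t) := by simp only [Near]; omega
  constructor
  · rintro ⟨w, hw, hn, ho⟩
    have hcases : w = (p.1 + 2 * s, p.2) ∨ w = (p.1, p.2 + 2 * t) := by
      have := hc w hw hn
      unfold Side at this
      unfold Near at hn
      simp only [pt_ext_iff]
      omega
    rcases hcases with rfl | rfl
    · rw [e1] at ho; tauto
    · rw [e2] at ho; tauto
  · intro h
    by_cases h1 : (p.1 + 2 * s, p.2) ∈ c
    · exact ⟨_, h1, n1, by rw [e1]; tauto⟩
    · exact ⟨_, by tauto, n2, by rwa [e2]⟩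

/-- A boundary does not end at a point. -/
lemma Bd.exists_ne {c : Finset Pt} {p z : Pt} (hpz : Near p z)
    (hc : ∀ w ∈ c, ∀ z, Near p z → Near w z → Side p w) (hz : Bd c z) :
    ∃ z', z' ≠ z ∧ Near p z' ∧ Bd c z' := by
  obtain ⟨s, t, hs, ht, rfl⟩ := hpz.exists_signs
  have hs' : -s = 1 ∨ -s = -1 := by omega
  have ht' : -t = 1 ∨ -t = -1 := by omega
  -- Around `p` membership in `c` changes an even number of times, and each change is a boundary
  -- point near `p`.
  have key : ∀ s t : ℤ, (s = 1 ∨ s = -1) → (t = 1 ∨ t = -1) → (Bd c (p.1 + s, p.2 + t) ↔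
      ¬ ((p.1 + 2 * s, p.2) ∈ c ↔ (p.1, p.2 + 2 * t) ∈ c)) := fun s t hs ht =>
    bd_iff hs ht fun w hw hn => hc w hw _ (near_of_signs p hs ht) hn
  by_contra! hcon
  have h1 := hcon (p.1 + s, p.2 + -t) (by simp only [Ne, pt_ext_iff]; omega)
    (near_of_signs p hs ht')
  have h2 := hcon (p.1 + -s, p.2 + t) (by simp only [Ne, pt_ext_iff]; omega)
    (near_of_signs p hs' ht)
  have h3 := hcon (p.1 + -s, p.2 + -t) (by simp only [Ne, pt_ext_iff]; omega)
    (near_of_signs p hs' ht')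
  rw [key _ _ hs ht'] at h1
  rw [key _ _ hs' ht] at h2
  rw [key _ _ hs' ht'] at h3
  rw [key _ _ hs ht] at hz
  tauto

/-- If no boundary passes at a point, then its neighbours are all inside or all outside. -/
lemma forall_side_mem {c : Finset Pt} {p : Pt}
    (hz : ∀ z, Near p z → ∀ w, Side p w → Near w z → (w ∈ c ↔ opp z w ∈ c)) {w w' : Pt}
    (hw : Side p w) (hw' : Side p w') (h : w ∈ c) : w' ∈ c := by
  have key : ∀ s t : ℤ, (s = 1 ∨ s = -1) → (t = 1 ∨ t = -1) →
      ((p.1 + 2 * s, p.2) ∈ c ↔ (p.1, p.2 + 2 * t) ∈ c) := by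
    intro s t hs ht
    have := hz (p.1 + s, p.2 + t) (near_of_signs p hs ht) (p.1 + 2 * s, p.2)
      (by simp only [Side, true_and]; omega) (by simp only [Near]; omega)
    rwa [show opp (p.1 + s, p.2 + t) (p.1 + 2 * s, p.2) = (p.1, p.2 + 2 * t) by
      simp only [opp, pt_ext_iff]; omega] at this
  have e : ∀ v, Side p v → ∃ s, (s = 1 ∨ s = -1) ∧
      (v = (p.1 + 2 * s, p.2) ∨ v = (p.1, p.2 + 2 * s)) := by
    intro v hv
    unfold Side at hv
    rcases hv with ⟨h1, h2 | h2⟩ | ⟨h1, h2 | h2⟩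
    · exact ⟨1, by simp, Or.inr (pt_ext_iff.2 (by simp only; omega))⟩
    · exact ⟨-1, by simp, Or.inr (pt_ext_iff.2 (by simp only; omega))⟩
    · exact ⟨1, by simp, Or.inl (pt_ext_iff.2 (by simp only; omega))⟩
    · exact ⟨-1, by simp, Or.inl (pt_ext_iff.2 (by simp only; omega))⟩
  have k1 := key 1 1 (by simp) (by simp)
  have k2 := key 1 (-1) (by simp) (by simp)
  have k3 := key (-1) 1 (by simp) (by simp)
  have k4 := key (-1) (-1) (by simp) (by simp)
  obtain ⟨s, hs, h1⟩ := e w hw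
  obtain ⟨s', hs', h2⟩ := e w' hw'
  rcases hs with rfl | rfl <;> rcases hs' with rfl | rfl <;> rcases h1 with rfl | rfl <;>
    rcases h2 with rfl | rfl <;> tauto

lemma Side.exists_isV {p : Pt} : Side p (p.1 + 2, p.2) := by simp [Side]

lemma Near.exists_side {p z : Pt} (h : Near p z) : ∃ w, Side p w ∧ Near w z ∧ Side (_root_.opp z p) w := by
  obtain ⟨s, t, hs, ht, rfl⟩ := h.exists_signs
  refine ⟨(p.1 + 2 * s, p.2), ?_, ?_, ?_⟩
  · simp only [Side, true_and]; omega
  · simp only [Near]; omega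
  · simp only [Side, _root_.opp]; omega

/-! ### Cycles carried by the boundary of a region -/

namespace BlockDomain

variable {k : ℕ} (X : BlockDomain k)

/-- `h` sends every vertex to the one it is matched with in a dimer covering. -/
structure IsMate (h : Pt → Pt) : Prop where
  invol : ∀ v ∈ X.verts, h (h v) = v
  adj : ∀ v ∈ X.verts, X.graph.Adj v (h v)

/-- Every point of `O` is reached from a point of `O` by a straight step through the middle vertex
which it is matched with. -/
def IsCycle (h : Pt → Pt) (O : Finset Pt) : Prop :=
  O.Nonempty ∧ ∀ p ∈ O, ∃ q ∈ O, IsV3 (h q) ∧ opp (h q) q = p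

variable {X} {h : Pt → Pt}

lemma exists_isCycle {S : Finset Pt} (hS : S.Nonempty)
    (hstep : ∀ x ∈ S, IsV3 (h x) ∧ opp (h x) x ∈ S) : ∃ O ⊆ S, IsCycle h O := by
  obtain ⟨O, hO, h1, h2⟩ := exists_subset_forall_exists_pred S (fun x => opp (h x) x) hS
    fun x hx => (hstep x hx).2
  refine ⟨O, hO, h1, fun p hp => ?_⟩
  obtain ⟨q, hq, hqp⟩ := h2 p hp
  exact ⟨q, hq, (hstep q (hO hq)).1, hqp⟩

namespace IsMate

variable (hm : X.IsMate h)
include hm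

lemma white {w : Pt} (hw : w ∈ X.V1) : h w ∈ X.V2 ∨ (h w ∈ X.V3 ∧ X.Sees w (h w)) := by
  have hadj := hm.adj w (X.V1_subset_verts hw)
  have hw1 := X.isV1_of_mem hw
  rcases X.adj_color hadj with ⟨_, h1 | h1⟩ | ⟨h1, _⟩ | ⟨h1, _⟩
  · exact Or.inl h1
  · exact Or.inr ⟨h1, (X.adj_white_mid hw1 (X.isV3_of_mem h1)).1 hadj⟩
  · exact absurd (X.isV2_of_mem h1) hw1.not_isV2
  · exact absurd (X.isV3_of_mem h1) hw1.not_isV3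

lemma black {p : Pt} (hp : p ∈ X.V2) :
    (h p ∈ X.V1 ∧ X.graph.Adj (h p) p) ∨ (h p ∈ X.V3 ∧ Near p (h p)) := by
  have hadj := hm.adj p (X.V2_subset_verts hp)
  have hp2 := X.isV2_of_mem hp
  rcases X.adj_color hadj with ⟨h1, _⟩ | ⟨_, h1 | h1⟩ | ⟨h1, _⟩
  · exact absurd hp2 (X.isV1_of_mem h1).not_isV2
  · exact Or.inl ⟨h1, hadj.symm⟩
  · exact Or.inr ⟨h1, (X.adj_black_mid hp2 h1).1 hadj⟩
  · exact absurd (X.isV3_of_mem h1) hp2.not_isV3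

lemma mid {z : Pt} (hz : z ∈ X.V3) :
    (h z ∈ X.V1 ∧ X.Sees (h z) z) ∨ (h z ∈ X.V2 ∧ Near (h z) z) := by
  have hadj := hm.adj z (X.V3_subset_verts hz)
  have hz3 := X.isV3_of_mem hz
  rcases X.adj_color hadj with ⟨h1, _⟩ | ⟨h1, _⟩ | ⟨_, h1 | h1⟩
  · exact absurd hz3 (X.isV1_of_mem h1).not_isV3
  · exact absurd hz3 (X.isV2_of_mem h1).not_isV3
  · exact Or.inl ⟨h1, (X.adj_white_mid (X.isV1_of_mem h1) hz3).1 hadj.symm⟩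
  · exact Or.inr ⟨h1, (X.adj_black_mid (X.isV2_of_mem h1) hz).1 hadj.symm⟩

lemma near_white {w : Pt} (hw : w ∈ X.V1) (h3 : IsV3 (h w)) : Near w (h w) := by
  rcases hm.white hw with h' | h'
  · exact absurd h3 (X.isV2_of_mem h').not_isV3
  · exact h'.2.near

lemma near_black {p : Pt} (hp : p ∈ X.V2) (h3 : IsV3 (h p)) : Near p (h p) := by
  rcases hm.black hp with h' | h'
  · exact absurd h3 (X.isV1_of_mem h'.1).not_isV3
  · exact h'.2

/-- If the boundary of a set of blocks is matched with black vertices, then it carries a cycle of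
black vertices. -/
lemma exists_black_cycle {c : Finset Pt} (hc : c ⊆ X.blocks) (hne : c.Nonempty)
    (hbd : ∀ z, Bd c z → h z ∈ X.V2) :
    ∃ O ⊆ X.V2, IsCycle h O ∧ ∀ p ∈ O, ∃ w ∈ c, Side w p := by
  classical
  -- These are the black vertices on the boundary of `c`. At least two boundary points lie near each
  -- of them, and one of these is not matched with it; that one is matched with the opposite black
  -- vertex, which therefore steps to it.
  set O := X.V2.filter fun p => ∃ z, Near p z ∧ Bd c z with hO
  have hcV3 : ∀ {z}, Bd c z → z ∈ X.V3 := fun ⟨w, hw, hn, _⟩ => X.mem_V3.2 ⟨w, hc hw, hn⟩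
  refine ⟨O, Finset.filter_subset _ _, ⟨?_, ?_⟩, ?_⟩
  · obtain ⟨w, hw, hmax⟩ := c.exists_max_image (fun v => v.1 + v.2) hne
    have hz : Bd c (w.1 + 1, w.2 + 1) := by
      refine ⟨w, hw, (near_corner w).1, fun ho => ?_⟩
      have := hmax _ ho
      simp only [opp] at this
      omega
    obtain ⟨p, hp, hpz⟩ := exists_isV2_near (X.isV3_of_mem (hcV3 hz))
    exact ⟨p, Finset.mem_filter.2 ⟨X.mem_V2_of_near (hcV3 hz) hp hpz, _, hpz, hz⟩⟩
  · intro p hp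
    obtain ⟨hpV, z, hpz, hz⟩ := Finset.mem_filter.1 hp
    have hp2 := X.isV2_of_mem hpV
    have key : ∀ z, Near p z → Bd c z → h z ≠ p → ∃ q ∈ O, IsV3 (h q) ∧ opp (h q) q = p := by
      intro z hpz hz hne
      have hV := hbd z hz
      have hzV := hcV3 hz
      rcases hm.mid hzV with h' | h'
      · exact absurd (X.isV2_of_mem hV) (X.isV1_of_mem h'.1).not_isV2
      have hhz := hm.invol z (X.V3_subset_verts hzV)
      have ho := (eq_or_eq_opp_of_isV2 hpz h'.2 hp2 (X.isV2_of_mem hV)).resolve_left hne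
      refine ⟨h z, Finset.mem_filter.2 ⟨hV, z, h'.2, hz⟩, ?_, ?_⟩
      · rw [hhz]; exact X.isV3_of_mem hzV
      · rw [hhz, ho, opp_opp]
    obtain ⟨z', hne', hpz', hz'⟩ := hz.exists_ne hpz fun w hw z h1 h2 =>
      (side_of_near h2 h1 (X.blocks_white w (hc hw)) hp2).symm
    by_cases h1 : h z = p
    · refine key z' hpz' hz' fun h2 => hne' ?_
      rw [← hm.invol z (X.V3_subset_verts (hcV3 hz)),
        ← hm.invol z' (X.V3_subset_verts (hcV3 hz')), h1, h2]
    · exact key z hpz hz h1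
  · intro p hp
    obtain ⟨hpV, z, hpz, w, hw, hwz, _⟩ := Finset.mem_filter.1 hp
    exact ⟨w, hw, side_of_near hwz hpz (X.blocks_white w (hc hw)) (X.isV2_of_mem hpV)⟩

/-- If the edges leaving a set of interior black vertices are matched with white vertices, then
they carry a cycle of white vertices. -/
lemma exists_white_cycle {c : Finset Pt} (hc : ∀ p ∈ c, IsV2 p) (hne : c.Nonempty)
    (hB : ∀ p ∈ c, ∀ w, Side p w → w ∈ X.blocks) (hbd : ∀ z, Bd c z → h z ∈ X.V1) :
    ∃ O ⊆ X.blocks, IsCycle h O ∧ ∀ w ∈ O, ∃ p ∈ c, Side p w := by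
  classical
  -- The previous argument with the colours exchanged; `hB` makes the white ends of the boundary
  -- edges block centres.
  set O := X.blocks.filter fun w => ∃ z, Near w z ∧ Bd c z with hO
  have hcV3 : ∀ {z}, Bd c z → z ∈ X.V3 := by
    rintro z ⟨p, hp, hn, _⟩
    obtain ⟨w, hpw, hwz, _⟩ := hn.exists_side
    exact X.mem_V3.2 ⟨w, hB p hp w hpw, hwz⟩
  have hcB : ∀ {z w}, Bd c z → Near w z → IsV1 w → w ∈ X.blocks := by
    rintro z w ⟨p, hp, hn, _⟩ hwz hw
    exact hB p hp w (side_of_near hwz hn hw (hc p hp)).symm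
  refine ⟨O, Finset.filter_subset _ _, ⟨?_, ?_⟩, ?_⟩
  · obtain ⟨p, hp, hmax⟩ := c.exists_max_image (fun v => v.1 + v.2) hne
    have hz : Bd c (p.1 + 1, p.2 + 1) := by
      refine ⟨p, hp, (near_corner p).1, fun ho => ?_⟩
      have := hmax _ ho
      simp only [opp] at this
      omega
    obtain ⟨w, hpw, hwz, _⟩ := (near_corner p).1.exists_side
    exact ⟨w, Finset.mem_filter.2 ⟨hB p hp w hpw, _, hwz, hz⟩⟩
  · intro w hw
    obtain ⟨hwB, z, hwz, hz⟩ := Finset.mem_filter.1 hw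
    have hw1 := X.blocks_white w hwB
    have key : ∀ z, Near w z → Bd c z → h z ≠ w → ∃ q ∈ O, IsV3 (h q) ∧ opp (h q) q = w := by
      intro z hwz hz hne
      have hV := hbd z hz
      have hzV := hcV3 hz
      rcases hm.mid hzV with h' | h'
      swap
      · exact absurd (X.isV2_of_mem h'.1) (X.isV1_of_mem hV).not_isV2
      have hhz := hm.invol z (X.V3_subset_verts hzV)
      have ho := (eq_or_eq_opp_of_isV1 hwz h'.2.near hw1 (X.isV1_of_mem hV)).resolve_left hne
      refine ⟨h z, Finset.mem_filter.2 ⟨hcB hz h'.2.near (X.isV1_of_mem hV), z, h'.2.near, hz⟩,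
        ?_, ?_⟩
      · rw [hhz]; exact X.isV3_of_mem hzV
      · rw [hhz, ho, opp_opp]
    obtain ⟨z', hne', hwz', hz'⟩ := hz.exists_ne hwz fun p hp z h1 h2 =>
      side_of_near h1 h2 hw1 (hc p hp)
    by_cases h1 : h z = w
    · refine key z' hwz' hz' fun h2 => hne' ?_
      rw [← hm.invol z (X.V3_subset_verts (hcV3 hz)),
        ← hm.invol z' (X.V3_subset_verts (hcV3 hz')), h1, h2]
    · exact key z hwz hz h1
  · intro w hw
    obtain ⟨hwB, z, hwz, p, hp, hpz, _⟩ := Finset.mem_filter.1 hw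
    exact ⟨p, hp, (side_of_near hwz hpz (X.blocks_white w hwB) (hc p hp)).symm⟩

end IsMate

end BlockDomain

/-! ### The inside of a closed polygon, by parity of ray crossings -/

/-- `z` lies on the diagonal ray which starts at `v`. -/
abbrev OnRay (v z : Pt) : Prop := z.1 - v.1 = z.2 - v.2 ∧ v.1 < z.1

lemma sum_add_sum_step {O : Finset Pt} {φ : Pt → Pt} (hinj : Set.InjOn φ O) (himg : O.image φ = O)
    (f : Pt → ZMod 2) : ∑ q ∈ O, (f q + f (φ q)) = 0 := by
  rw [Finset.sum_add_distrib]
  have h : ∑ q ∈ O, f (φ q) = ∑ q ∈ O, f q := by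
    conv_rhs => rw [← himg]
    rw [Finset.sum_image hinj]
  rw [h]
  exact CharTwo.add_self_eq_zero _

section Inside

variable {O : Finset Pt} {h : Pt → Pt}

/-- The parity of the number of the points `h q` on a ray. -/
def rayParity (O : Finset Pt) (h : Pt → Pt) (v : Pt) : ZMod 2 :=
  ∑ q ∈ O, if OnRay v (h q) then 1 else 0

/-- The two rays contain the same middle vertices except for the first one on the longer ray. -/
lemma rayParity_diag (hO : ∀ q ∈ O, IsV1 q ∧ Near q (h q)) {v : Pt} (hv : IsV2 v) :
    rayParity O h v + rayParity O h (v.1 + 2, v.2 + 2) =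
      ∑ q ∈ O, if h q = (v.1 + 1, v.2 + 1) then 1 else 0 := by
  rw [rayParity, rayParity, ← Finset.sum_add_distrib]
  refine Finset.sum_congr rfl fun q hq => ?_
  obtain ⟨h1, h2⟩ := hO q hq
  have h3 := h2.isV3 (Or.inl h1)
  rw [isV2_iff] at hv
  rw [isV3_iff] at h3
  simp only [OnRay, pt_ext_iff]
  split_ifs <;> first | rfl | decide | (exfalso; omega)

lemma ite_add_ite_of_xor {P₁ P₂ P₃ P₄ P₅ : Prop} [Decidable P₁] [Decidable P₂] [Decidable P₃]
    [Decidable P₄] [Decidable P₅] (h₁ : ¬ P₁) (h₂ : ¬ P₂) (h : P₅ ↔ ¬ (P₃ ↔ P₄)) :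
    ((if P₁ then 1 else 0) + (if P₂ then 1 else 0) : ZMod 2) =
      (if P₅ then 1 else 0) + ((if P₃ then 1 else 0) + (if P₄ then 1 else 0)) := by
  by_cases h₃ : P₃ <;> by_cases h₄ : P₄ <;> simp only [h, h₁, h₂, h₃, h₄] <;> rfl

lemma ite_add_ite_of_iff {P₁ P₂ P₃ P₄ P₅ : Prop} [Decidable P₁] [Decidable P₂] [Decidable P₃]
    [Decidable P₄] [Decidable P₅] (h₅ : ¬ P₅) (h₁ : P₁ ↔ P₃) (h₂ : P₂ ↔ P₄) :
    ((if P₁ then 1 else 0) + (if P₂ then 1 else 0) : ZMod 2) =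
      (if P₅ then 1 else 0) + ((if P₃ then 1 else 0) + (if P₄ then 1 else 0)) := by
  simp only [h₁, h₂, h₅, if_false, zero_add]

/-- Between the two rays runs a diagonal ray of white points. A step of the polygon crossing either
ray enters or leaves this middle ray, and a step along the diagonal does so only through the middle
vertex at its start. A closed polygon enters as often as it leaves. -/
lemma rayParity_anti (hO : ∀ q ∈ O, IsV1 q ∧ Near q (h q))
    (hinj : Set.InjOn (fun q => opp (h q) q) O) (himg : O.image (fun q => opp (h q) q) = O)
    {v : Pt} (hv : IsV2 v) :
    rayParity O h v + rayParity O h (v.1 + 2, v.2 - 2) =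
      ∑ q ∈ O, if h q = (v.1 + 1, v.2 - 1) then 1 else 0 := by
  have hσ := sum_add_sum_step hinj himg
    (fun w => if w.1 - v.1 - 2 = w.2 - v.2 ∧ v.1 < w.1 then 1 else 0)
  refine Eq.trans ?_ ((congrArg (fun t : ZMod 2 =>
    (∑ q ∈ O, if h q = (v.1 + 1, v.2 - 1) then 1 else 0) + t) hσ).trans (add_zero _))
  simp only [rayParity]
  rw [← Finset.sum_add_distrib, ← Finset.sum_add_distrib]
  refine Finset.sum_congr rfl fun q hq => ?_
  obtain ⟨h1, h2⟩ := hO q hq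
  obtain ⟨s, t, hs, ht, hst⟩ := h2.exists_signs
  rw [isV2_iff] at hv
  rw [isV1_iff] at h1
  rw [hst]
  clear hst
  simp only [OnRay, pt_ext_iff, opp]
  rcases hs with rfl | rfl <;> rcases ht with rfl | rfl
  · refine ite_add_ite_of_xor ?_ ?_ ?_ <;> omega
  · rw [add_comm (ite _ _ _) (ite _ _ _)]
    refine ite_add_ite_of_iff ?_ ?_ ?_ <;> omega
  · refine ite_add_ite_of_iff ?_ ?_ ?_ <;> omega
  · refine ite_add_ite_of_xor ?_ ?_ ?_ <;> omega

/-- A closed polygon through white points has an inside, consisting of finitely many black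
points. -/
lemma exists_inside (hO : ∀ q ∈ O, IsV1 q ∧ Near q (h q)) (hinjh : Set.InjOn h O)
    (hinj : Set.InjOn (fun q => opp (h q) q) O) (himg : O.image (fun q => opp (h q) q) = O) :
    ∃ I : Finset Pt, (∀ v ∈ I, IsV2 v) ∧
      ∀ v z, IsV2 v → Near v z → ((v ∈ I ↔ opp z v ∈ I) ↔ ∀ q ∈ O, h q ≠ z) := by
  classical
  obtain ⟨N, hN⟩ : ∃ N : ℤ, ∀ q ∈ O, |(h q).1| ≤ N ∧ |(h q).2| ≤ N := by
    refine ⟨∑ q ∈ O, (|(h q).1| + |(h q).2|), fun q hq => ?_⟩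
    have := Finset.single_le_sum (f := fun q => |(h q).1| + |(h q).2|)
      (fun q _ => by positivity) hq
    have h1 := abs_nonneg (h q).1
    have h2 := abs_nonneg (h q).2
    constructor <;> linarith
  simp only [abs_le] at hN
  have hcount : ∀ z, ∑ q ∈ O, (if h q = z then (1 : ZMod 2) else 0) =
      if ∀ q ∈ O, h q ≠ z then 0 else 1 := by
    intro z
    split_ifs with hz
    · exact Finset.sum_eq_zero fun q hq => if_neg (hz q hq)
    · push Not at hz
      obtain ⟨q, hq, rfl⟩ := hz
      rw [Finset.sum_eq_single q]
      · simp
      · intro q' hq' hne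
        exact if_neg fun he => hne (hinjh hq' hq he)
      · intro h'; exact absurd hq h'
  have hray : ∀ v, rayParity O h v ≠ 0 → ∃ q ∈ O, OnRay v (h q) := by
    intro v hv
    by_contra! hcon
    exact hv (Finset.sum_eq_zero fun q hq => if_neg (hcon q hq))
  -- Below the polygon nothing is crossed on the way to the lower right, and far enough out the ray
  -- is empty.
  have hlow : ∀ v, IsV2 v → v.2 < - N → rayParity O h v = 0 := by
    intro v hv hvN
    have hall : ∀ m : ℕ, rayParity O h (v.1 + 2 * m, v.2 - 2 * m) = rayParity O h v := by
      intro m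
      induction m with
      | zero => simp
      | succ m ih =>
        have hv' : IsV2 (v.1 + 2 * m, v.2 - 2 * m) := by
          rw [isV2_iff] at *; simp only; omega
        have h1 := rayParity_anti hO hinj himg hv'
        rw [hcount, if_pos] at h1
        · rw [← ih]
          simp only at h1
          rw [CharTwo.add_eq_zero.1 h1]
          congr 2
          · push_cast; ring
          · push_cast; ring
        · intro q hq he
          have h2 := (hN q hq).2.1
          rw [he] at h2
          simp only at h2
          omega
    by_contra hne
    rw [← hall (N - v.1).toNat] at hne
    obtain ⟨q, hq, h1, h2⟩ := hray _ hne
    have h3 := (hN q hq).1.2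
    simp only at h2
    have := Int.self_le_toNat (N - v.1)
    have : (0 : ℤ) ≤ ((N - v.1).toNat : ℤ) := by positivity
    omega
  -- A point of odd parity has second coordinate at least `-N`, and its ray rises by at most `2 * N`
  -- before it meets the polygon; this accounts for `-(3 * N)`.
  set I := (Finset.Icc (-(3 * N)) N ×ˢ Finset.Icc (-N) N).filter fun v =>
    IsV2 v ∧ rayParity O h v ≠ 0 with hI
  have hmemI : ∀ v, IsV2 v → (v ∈ I ↔ rayParity O h v ≠ 0) := by
    intro v hv
    refine ⟨fun h' => (Finset.mem_filter.1 h').2.2, fun h' => Finset.mem_filter.2 ⟨?_, hv, h'⟩⟩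
    have h1 : - N ≤ v.2 := by
      by_contra hlt
      exact h' (hlow v hv (by omega))
    obtain ⟨q, hq, h2, h3⟩ := hray v h'
    obtain ⟨⟨h4, h5⟩, h6, h7⟩ := hN q hq
    rw [Finset.mem_product, Finset.mem_Icc, Finset.mem_Icc]
    omega
  refine ⟨I, fun v hv => (Finset.mem_filter.1 hv).2.1, fun v z hv hvz => ?_⟩
  have hmain : rayParity O h v + rayParity O h (opp z v) = if ∀ q ∈ O, h q ≠ z then 0 else 1 := by
    rw [← hcount]
    have hv' : IsV2 (opp z v) := hvz.isV2_opp hv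
    rcases hvz.eq_corner with hz | hz | hz | hz
    · rw [hz, ← rayParity_diag hO hv]
      congr 2
      rw [pt_ext_iff]; simp only [opp]; omega
    · rw [hz, ← rayParity_anti hO hinj himg hv]
      congr 2
      rw [pt_ext_iff]; simp only [opp]; omega
    · have e1 : z = ((opp z v).1 + 1, (opp z v).2 - 1) := by
        rw [pt_ext_iff] at hz ⊢; simp only [opp] at *; omega
      have e2 := rayParity_anti hO hinj himg hv'
      rw [← e1] at e2
      rw [← e2, add_comm]
      congr 2
      rw [pt_ext_iff] at hz ⊢; simp only [opp] at *; omega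
    · have e1 : z = ((opp z v).1 + 1, (opp z v).2 + 1) := by
        rw [pt_ext_iff] at hz ⊢; simp only [opp] at *; omega
      have e2 := rayParity_diag hO hv'
      rw [← e1] at e2
      rw [← e2, add_comm]
      congr 2
      rw [pt_ext_iff] at hz ⊢; simp only [opp] at *; omega
  rw [hmemI v hv, hmemI _ (hvz.isV2_opp hv)]
  have hF2 : ∀ a b : ZMod 2, (a ≠ 0 ↔ b ≠ 0) ↔ a + b = 0 := by decide
  rw [hF2, hmain]
  split_ifs with hz
  · simpa using hz
  · simpa using hz

end Inside

/-! ### Descent through nested cycles of alternating colours -/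

namespace BlockDomain

variable {k : ℕ} {X : BlockDomain k} {h : Pt → Pt}

/-- Every point of `c` is lower, in the diagonal direction, than some point of `c'`. -/
def Lower (c c' : Finset Pt) : Prop := ∀ x ∈ c, ∃ y ∈ c', x.1 + x.2 < y.1 + y.2

/-- A step of the flow, through the middle vertex which `u` is matched with. -/
def Step (h : Pt → Pt) (F : Finset Pt) (u v : Pt) : Prop := u ∈ F ∧ IsV3 (h u) ∧ opp (h u) u = v

namespace IsMate

variable (hm : X.IsMate h)
include hm

/-- Inside a cycle of black vertices there is a cycle of white vertices. -/
lemma exists_lower_white_cycle (hk : 1 ≤ k) (hX : X.IsImpurityDomain) {O : Finset Pt}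
    (hO : O ⊆ X.V2) (hcyc : IsCycle h O) : ∃ O' ⊆ X.blocks, IsCycle h O' ∧ Lower O' O := by
  classical
  obtain ⟨hstep, hinj, himg⟩ := cycle_bijective O (fun q => opp (h q) q) (fun q => IsV3 (h q))
    hcyc.2
  have hV2 : ∀ q ∈ O, IsV2 q := fun q hq => X.isV2_of_mem (hO hq)
  have hnear : ∀ q ∈ O, Near q (h q) := fun q hq => hm.near_black (hO hq) (hstep q hq).1
  have hhV3 : ∀ q ∈ O, h q ∈ X.V3 := fun q hq => by
    rcases hm.black (hO hq) with h' | h'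
    · exact absurd (hstep q hq).1 (X.isV1_of_mem h'.1).not_isV3
    · exact h'.1
  -- The cycle as a chain of edges modulo two. Each of its vertices lies on one outgoing and one
  -- incoming edge, so the chain is closed and bounds a set `D` of blocks.
  set a : Pt → ZMod 2 := fun z => ∑ q ∈ O, if h q = z then 1 else 0 with ha
  have hhinj : ∀ q ∈ O, ∀ q' ∈ O, h q = h q' → q = q' := fun q hq q' hq' he => by
    rw [← hm.invol q (X.V2_subset_verts (hO hq)), he, hm.invol q' (X.V2_subset_verts (hO hq'))]
  have ha0 : ∀ z, a z = 0 ↔ ∀ q ∈ O, h q ≠ z := by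
    intro z
    constructor
    · rintro hz q hq rfl
      rw [ha] at hz
      simp only at hz
      rw [Finset.sum_eq_single q] at hz
      · simp at hz
      · intro q' hq' hne
        exact if_neg fun he => hne (hhinj q' hq' q hq he)
      · intro h'; exact absurd hq h'
    · intro hz
      exact Finset.sum_eq_zero fun q hq => if_neg (hz q hq)
  obtain ⟨D, hD, haD⟩ := exists_bounding hk hX a (fun z hz => by
      rw [Ne, ha0] at hz
      push Not at hz
      obtain ⟨q, hq, rfl⟩ := hz
      exact hhV3 q hq) (fun p hp => by
      have h1 : cornerSum a p = ∑ q ∈ O, (if Near p (h q) then (1 : ZMod 2) else 0) := by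
        simp only [cornerSum, ha]
        rw [← Finset.sum_add_distrib, ← Finset.sum_add_distrib, ← Finset.sum_add_distrib]
        refine Finset.sum_congr rfl fun q hq => ?_
        have := sum_near_eq_cornerSum {h q} (fun z => if h q = z then (1 : ZMod 2) else 0)
          (fun z hz => if_neg fun he => hz (by simp [he])) p
        rw [Finset.sum_singleton] at this
        simp only [if_true, cornerSum] at this
        exact this.symm
      rw [h1]
      refine Eq.trans ?_ (sum_add_sum_step hinj himg fun q => if p = q then (1 : ZMod 2) else 0)
      refine Finset.sum_congr rfl fun q hq => ?_
      have hn := hnear q hq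
      by_cases hpn : Near p (h q)
      · rcases eq_or_eq_opp_of_isV2 hn hpn (hV2 q hq) hp with rfl | rfl
        · simp [hpn, hpn.opp_ne.symm]
        · simp [hpn, hn.opp_ne]
      · have e1 : p ≠ q := by rintro rfl; exact hpn hn
        have e2 : p ≠ opp (h q) q := by rintro rfl; exact hpn hn.opp
        simp [hpn, e1, e2])
  have hDw : ∀ w ∈ D, IsV1 w := fun w hw => X.blocks_white w (hD hw)
  have hcut : ∀ w z, IsV1 w → Near w z → ((w ∈ D ↔ opp z w ∈ D) ↔ ∀ q ∈ O, h q ≠ z) := by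
    intro w z hw hn
    rw [← ha0, haD z (hn.isV3 (Or.inl hw)), cornerSum_of_isV1 (fun x hx => by
      by_contra h'
      exact hx (ind_eq_zero fun hxD => h' (hDw x hxD))) hw hn]
    unfold ind
    by_cases h1 : w ∈ D <;> by_cases h2 : opp z w ∈ D <;> simp [h1, h2]
    rfl
  have hDne : D.Nonempty := by
    obtain ⟨q, hq⟩ := hcyc.1
    by_contra hne
    rw [Finset.not_nonempty_iff_eq_empty] at hne
    obtain ⟨w, hw⟩ := X.mem_V3.1 (hhV3 q hq)
    refine (hcut w (h q) (X.blocks_white w hw.1) hw.2).1 ?_ q hq rfl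
    simp [hne]
  -- At the upper right of the highest point of `D` there must be an edge of the cycle, and both its
  -- black ends are higher than all of `D`.
  have hlow : Lower D O := by
    intro x hx
    obtain ⟨w, hw, hmax⟩ := D.exists_max_image (fun v => v.1 + v.2) hDne
    have hn := (near_corner w).1
    have h1 : ¬ ∀ q ∈ O, h q ≠ (w.1 + 1, w.2 + 1) := by
      rw [← hcut w _ (hDw w hw) hn]
      intro h2
      have := hmax _ (h2.1 hw)
      simp only [opp] at this
      omega
    push Not at h1
    obtain ⟨q, hq, hqz⟩ := h1
    refine ⟨q, hq, ?_⟩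
    have h3 := hnear q hq
    rw [hqz] at h3
    have h4 := hV2 q hq
    have h5 := hDw w hw
    have h6 := hmax x hx
    rw [isV2_iff] at h4
    rw [isV1_iff] at h5
    unfold Near at h3
    simp only at h3 h6
    omega
  -- A white vertex inside cannot step across the cycle, whose middle vertices are already matched
  -- with black vertices.
  have hclosed : ∀ w ∈ D, IsV3 (h w) → opp (h w) w ∈ D := by
    intro w hw h3
    refine ((hcut w (h w) (hDw w hw)
      (hm.near_white (X.blocks_subset_V1 (hD hw)) h3)).2 fun q hq he => ?_).1 hw
    have : q = w := by
      rw [← hm.invol q (X.V2_subset_verts (hO hq)), he,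
        hm.invol w (X.V1_subset_verts (X.blocks_subset_V1 (hD hw)))]
    exact (hDw w hw).not_isV2 (this ▸ hV2 q hq)
  by_cases hall : ∀ w ∈ D, IsV3 (h w)
  · obtain ⟨O', hO', hc⟩ := exists_isCycle hDne fun w hw => ⟨hall w hw, hclosed w hw (hall w hw)⟩
    exact ⟨O', hO'.trans hD, hc, fun x hx => hlow x (hO' hx)⟩
  push Not at hall
  obtain ⟨w₀, hw₀, h3⟩ := hall
  have hw₀V := X.blocks_subset_V1 (hD hw₀)
  have hr : h w₀ ∈ X.V2 := by
    rcases hm.white hw₀V with h' | h'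
    · exact h'
    · exact absurd (X.isV3_of_mem h'.1) h3
  have hhr : h (h w₀) = w₀ := hm.invol w₀ (X.V1_subset_verts hw₀V)
  set r := h w₀ with hrdef
  have haround : ∀ p, IsV2 p → p ∉ O → ∀ w w', Side p w → Side p w' → w ∈ D → w' ∈ D := by
    intro p hp hpO w w' hw hw' hwD
    refine forall_side_mem (fun z hpz v hv hvz => ?_) hw hw' hwD
    rw [hcut v z (hv.isV1 hp) hvz]
    rintro q hq rfl
    rcases eq_or_eq_opp_of_isV2 (hnear q hq) hpz (hV2 q hq) hp with rfl | rfl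
    · exact hpO hq
    · exact hpO (hstep q hq).2
  -- The cycle is closed under the black flow and avoids `r`, so no vertex flowing into `r` lies on
  -- it. By `haround` the basin of `r` then stays inside.
  have hgood : ∀ u, Relation.ReflTransGen (Step h X.V2) u r →
      u ∈ X.V2 ∧ u ∉ O ∧ ∀ w, Side u w → w ∈ D := by
    intro u hu
    induction hu using Relation.ReflTransGen.head_induction_on with
    | refl =>
      have hrO : r ∉ O := fun hrO => by
        have := (hstep r hrO).1
        rw [hhr] at this
        exact (hDw w₀ hw₀).not_isV3 this
      have hs : Side r w₀ := by
        have := hm.adj w₀ (X.V1_subset_verts hw₀V)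
        exact ((radial_adj_side (Or.inl (hDw w₀ hw₀)) (Or.inr (X.isV2_of_mem hr))).1 this.1).symm
      exact ⟨hr, hrO, fun w hw => haround r (X.isV2_of_mem hr) hrO w₀ w hs hw hw₀⟩
    | head huv hvr ih =>
      rename_i u v
      obtain ⟨huV, hu3, rfl⟩ := huv
      have hn := hm.near_black huV hu3
      have huO : u ∉ O := fun huO => ih.2.1 (hstep u huO).2
      refine ⟨huV, huO, fun w hw => ?_⟩
      obtain ⟨w', h1, h2, h3⟩ := hn.exists_side
      exact haround u (X.isV2_of_mem huV) huO w' w h1 hw (ih.2.2 w' h3)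
  -- No edge leaving the basin is matched with a black vertex. Its inner end would step out,
  -- although it has to flow into `r`; its outer end would step into the basin and thus belong to
  -- it.
  set Q := X.V2.filter fun u => Relation.ReflTransGen (Step h X.V2) u r with hQ
  obtain ⟨O', hO', hc, hside⟩ := hm.exists_white_cycle (c := Q)
    (fun p hp => X.isV2_of_mem (Finset.mem_filter.1 hp).1)
    ⟨r, Finset.mem_filter.2 ⟨hr, Relation.ReflTransGen.refl⟩⟩
    (fun p hp w hw => hD ((hgood p (Finset.mem_filter.1 hp).2).2.2 w hw)) (by
      rintro z ⟨p, hp, hpz, hpo⟩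
      obtain ⟨hpV, hpr⟩ := Finset.mem_filter.1 hp
      have hp2 := X.isV2_of_mem hpV
      obtain ⟨w, hpw, hwz, _⟩ := hpz.exists_side
      have hz : z ∈ X.V3 := X.mem_V3.2 ⟨w, hD ((hgood p hpr).2.2 w hpw), hwz⟩
      have hoV : opp z p ∈ X.V2 := X.mem_V2_of_near hz (hpz.isV2_opp hp2) hpz.opp
      have hhz := hm.invol z (X.V3_subset_verts hz)
      rcases hm.mid hz with h' | h'
      · exact h'.1
      exfalso
      rcases eq_or_eq_opp_of_isV2 hpz h'.2 hp2 (X.isV2_of_mem h'.1) with he | he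
      · rw [he] at hhz
        rcases Relation.ReflTransGen.cases_head hpr with heq | ⟨v, ⟨_, _, hv⟩, hvr⟩
        · rw [heq, hhr] at hhz
          exact (hDw w₀ hw₀).not_isV3 (hhz ▸ X.isV3_of_mem hz)
        · rw [hhz] at hv
          subst hv
          exact hpo (Finset.mem_filter.2 ⟨hoV, hvr⟩)
      · rw [he] at hhz
        refine hpo (Finset.mem_filter.2 ⟨hoV, Relation.ReflTransGen.head ⟨hoV, ?_, ?_⟩ hpr⟩)
        · rw [hhz]; exact X.isV3_of_mem hz
        · rw [hhz, opp_opp])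
  refine ⟨O', hO', hc, fun w hw => hlow w ?_⟩
  obtain ⟨p, hp, hpw⟩ := hside w hw
  exact (hgood p (Finset.mem_filter.1 hp).2).2.2 w hpw

/-- Inside a cycle of white vertices there is a cycle of black vertices. -/
lemma exists_lower_black_cycle (hk : 1 ≤ k) (hX : X.IsImpurityDomain) {O : Finset Pt}
    (hO : O ⊆ X.blocks) (hcyc : IsCycle h O) : ∃ O' ⊆ X.V2, IsCycle h O' ∧ Lower O' O := by
  classical
  obtain ⟨hstep, hinj, himg⟩ := cycle_bijective O (fun q => opp (h q) q) (fun q => IsV3 (h q))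
    hcyc.2
  have hOV : ∀ q ∈ O, q ∈ X.V1 := fun q hq => X.blocks_subset_V1 (hO hq)
  have hV1 : ∀ q ∈ O, IsV1 q := fun q hq => X.isV1_of_mem (hOV q hq)
  have hnear : ∀ q ∈ O, Near q (h q) := fun q hq => hm.near_white (hOV q hq) (hstep q hq).1
  have hhinj : Set.InjOn h O := fun q hq q' hq' he => by
    rw [← hm.invol q (X.V1_subset_verts (hOV q hq)), he,
      hm.invol q' (X.V1_subset_verts (hOV q' hq'))]
  -- It is not yet known that the inside of a white cycle is filled with blocks, so the inside is
  -- first taken in the whole plane.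
  obtain ⟨I, hI2, hcut⟩ := exists_inside (fun q hq => ⟨hV1 q hq, hnear q hq⟩) hhinj hinj himg
  have hIne : I.Nonempty := by
    obtain ⟨q, hq⟩ := hcyc.1
    obtain ⟨p, hp, hn⟩ := exists_isV2_near (hstep q hq).1
    by_contra hne
    rw [Finset.not_nonempty_iff_eq_empty] at hne
    refine (hcut p (h q) hp hn).1 ?_ q hq rfl
    simp [hne]
  have hlow : Lower I O := by
    intro x hx
    obtain ⟨p, hp, hmax⟩ := I.exists_max_image (fun v => v.1 + v.2) hIne
    have hn := (near_corner p).1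
    have h1 : ¬ ∀ q ∈ O, h q ≠ (p.1 + 1, p.2 + 1) := by
      rw [← hcut p _ (hI2 p hp) hn]
      intro h2
      have := hmax _ (h2.1 hp)
      simp only [opp] at this
      omega
    push Not at h1
    obtain ⟨q, hq, hqz⟩ := h1
    refine ⟨q, hq, ?_⟩
    have h3 := hnear q hq
    rw [hqz] at h3
    have h4 := hV1 q hq
    have h5 := hI2 p hp
    have h6 := hmax x hx
    rw [isV1_iff] at h4
    rw [isV2_iff] at h5
    unfold Near at h3
    simp only at h3 h6
    omega
  have haround : ∀ w, IsV1 w → w ∉ O → ∀ p p', Side w p → Side w p' → p ∈ I → p' ∈ I := by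
    intro w hw hwO p p' hp hp' hpI
    refine forall_side_mem (fun z hwz v hv hvz => ?_) hp hp' hpI
    rw [hcut v z (hv.isV2 hw) hvz]
    rintro q hq rfl
    rcases eq_or_eq_opp_of_isV1 (hnear q hq) hwz (hV1 q hq) hw with rfl | rfl
    · exact hwO hq
    · exact hwO (hstep q hq).2
  -- the white points inside which are not block centres
  set H : Finset Pt := (I.biUnion fun p =>
    {(p.1 + 2, p.2), (p.1 - 2, p.2), (p.1, p.2 + 2), (p.1, p.2 - 2)}).filter
      fun w => w ∉ X.blocks with hH
  have hmemH : ∀ w, w ∈ H ↔ w ∉ X.blocks ∧ ∃ p ∈ I, Side p w := by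
    intro w
    rw [hH, Finset.mem_filter, and_comm, Finset.mem_biUnion]
    refine and_congr_right fun _ => exists_congr fun p => and_congr_right fun _ => ?_
    simp only [Finset.mem_insert, Finset.mem_singleton, pt_ext_iff, Side]
    omega
  have hHw : ∀ w ∈ H, IsV1 w := fun w hw => by
    obtain ⟨-, p, hp, hs⟩ := (hmemH w).1 hw
    exact hs.isV1 (hI2 p hp)
  have hHind : ∀ x, ind H x ≠ 0 → IsV1 x := fun x hx => by
    by_contra h'
    exact hx (ind_eq_zero fun hxD => h' (hHw x hxD))
  have hHb : ∀ z, IsV3 z → cornerSum (ind H) z ≠ 0 → z ∈ X.V3 := by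
    intro z hz hne
    have : ∃ w ∈ H, Near w z ∧ opp z w ∉ H := by
      by_contra! hcon
      have hex : ∃ w, IsV1 w ∧ Near w z := by
        obtain ⟨p, hp, hn⟩ := exists_isV2_near hz
        obtain ⟨w, h1, h2, _⟩ := hn.exists_side
        exact ⟨w, h1.isV1 hp, h2⟩
      obtain ⟨w, hw, hwz⟩ := hex
      refine hne ?_
      rw [cornerSum_of_isV1 hHind hw hwz]
      unfold ind
      have h1 := hcon w
      have h2 := hcon (opp z w)
      rw [opp_opp] at h2
      have h3 : w ∈ H ↔ opp z w ∈ H := ⟨fun h' => h1 h' hwz, fun h' => h2 h' hwz.opp⟩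
      by_cases h4 : w ∈ H <;> simp [h4, ← h3]
      rfl
    obtain ⟨w, hw, hwz, ho⟩ := this
    obtain ⟨hwB, p, hp, hpw⟩ := (hmemH w).1 hw
    obtain ⟨p', hwp', hp'z, hop'⟩ := hwz.exists_side
    have hp'I := haround w (hHw w hw) (fun hwO => hwB (hO hwO)) p p' hpw.symm hwp' hp
    have hoB : opp z w ∈ X.blocks := by
      by_contra h'
      exact ho ((hmemH _).2 ⟨h', p', hp'I, hop'.symm⟩)
    exact X.mem_V3.2 ⟨_, hoB, hwz.opp⟩
  -- The boundary of the set `H` of holes is a cycle of the black graph, so it also bounds a set `D`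
  -- of blocks. A region is determined by its boundary, hence `H` equals `D`; as `H` contains no
  -- block centre, both are empty.
  obtain ⟨D, hD, hDa⟩ := exists_bounding hk hX (fun z => if IsV3 z then cornerSum (ind H) z else 0)
    (fun z hz => by
      by_cases h3 : IsV3 z
      · simp only [h3, if_true] at hz
        exact hHb z h3 hz
      · simp [h3] at hz)
    (fun p hp => by
      have h1 : ∀ z, Near p z →
          (if IsV3 z then cornerSum (ind H) z else 0) = cornerSum (ind H) z :=
        fun z hz => if_pos (hz.isV3 (Or.inr hp))
      obtain ⟨c1, c2, c3, c4⟩ := near_corner p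
      have h2 : cornerSum (fun z => if IsV3 z then cornerSum (ind H) z else 0) p =
          cornerSum (cornerSum (ind H)) p := by
        rw [cornerSum, h1 _ c1, h1 _ c2, h1 _ c3, h1 _ c4]
        rfl
      rw [h2, cornerSum_cornerSum]
      have h3 : ∀ x, IsV2 x → ind H x = 0 := fun x hx =>
        ind_eq_zero fun hxH => (hHw x hxH).not_isV2 hx
      rw [isV2_iff] at hp
      rw [h3, h3, h3, h3]
      · rfl
      all_goals
        rw [isV2_iff]
        simp only
        omega)
  have hHD : ∀ v, ind H v + ind D v = 0 := by
    refine eq_zero_of_cornerSum_eq_zero (S := H ∪ D) ?_ (φ := fun v => ind H v + ind D v) ?_ ?_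
    · intro v hv
      rcases Finset.mem_union.1 hv with hv | hv
      · exact hHw v hv
      · exact X.blocks_white v (hD hv)
    · intro v hv
      by_contra h'
      rw [Finset.mem_union, not_or] at h'
      simp [ind_eq_zero h'.1, ind_eq_zero h'.2] at hv
    · intro w hw z hz
      have hw1 : IsV1 w := by
        rcases Finset.mem_union.1 hw with hv | hv
        · exact hHw w hv
        · exact X.blocks_white w (hD hv)
      have h3 := hz.isV3 (Or.inl hw1)
      have h4 := hDa z h3
      rw [if_pos h3] at h4
      have h5 : cornerSum (fun v => ind H v + ind D v) z =
          cornerSum (ind H) z + cornerSum (ind D) z := by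
        simp only [cornerSum]; ring
      rw [h5, h4]
      exact CharTwo.add_self_eq_zero _
  have hIB : ∀ p ∈ I, ∀ w, Side p w → w ∈ X.blocks := by
    intro p hp w hw
    by_contra hwB
    have hwH : w ∈ H := (hmemH w).2 ⟨hwB, p, hp, hw⟩
    have := hHD w
    rw [ind_eq_zero (fun hwD => hwB (hD hwD))] at this
    simp [ind, hwH] at this
  have hIV : I ⊆ X.V2 := fun p hp =>
    X.mem_V2.2 ⟨_, hIB p hp _ Side.exists_isV, Side.exists_isV.symm⟩
  by_cases hall : ∀ p ∈ I, IsV3 (h p)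
  · obtain ⟨O', hO', hc⟩ := exists_isCycle hIne fun p hp => ⟨hall p hp,
      ((hcut p (h p) (hI2 p hp) (hm.near_black (hIV hp) (hall p hp))).2 fun q hq he => by
        have : q = p := by
          rw [← hm.invol q (X.V1_subset_verts (hOV q hq)), he,
            hm.invol p (X.V2_subset_verts (hIV hp))]
        exact (hV1 q hq).not_isV2 (this ▸ hI2 p hp)).1 hp⟩
    exact ⟨O', hO'.trans hIV, hc, fun x hx => hlow x (hO' hx)⟩
  push Not at hall
  -- As in the other descent step, with the colours exchanged: the blocks flowing into the partner
  -- of `r` have a boundary matched with black vertices.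
  obtain ⟨r, hr, h3⟩ := hall
  have hrV := hIV hr
  have hhr : h (h r) = r := hm.invol r (X.V2_subset_verts hrV)
  obtain ⟨hwV, hwadj⟩ : h r ∈ X.V1 ∧ X.graph.Adj (h r) r := by
    rcases hm.black hrV with h' | h'
    · exact h'
    · exact absurd (X.isV3_of_mem h'.1) h3
  have hsw : Side (h r) r :=
    (radial_adj_side (Or.inl (X.isV1_of_mem hwV)) (Or.inr (hI2 r hr))).1 hwadj.1
  set w := h r with hwdef
  have hwB : w ∈ X.blocks := hIB r hr w hsw.symm
  have hgood : ∀ u, Relation.ReflTransGen (Step h X.blocks) u w →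
      u ∈ X.blocks ∧ u ∉ O ∧ ∀ p, Side u p → p ∈ I := by
    intro u hu
    induction hu using Relation.ReflTransGen.head_induction_on with
    | refl =>
      have hwO : w ∉ O := fun hwO => by
        have := (hstep w hwO).1
        rw [hhr] at this
        exact (hI2 r hr).not_isV3 this
      exact ⟨hwB, hwO, fun p hp => haround w (X.blocks_white w hwB) hwO r p hsw hp hr⟩
    | head huv hvr ih =>
      rename_i u v
      obtain ⟨huB, hu3, rfl⟩ := huv
      have hn := hm.near_white (X.blocks_subset_V1 huB) hu3
      have huO : u ∉ O := fun huO => ih.2.1 (hstep u huO).2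
      refine ⟨huB, huO, fun p hp => ?_⟩
      obtain ⟨p', h1, h2, h3⟩ := hn.exists_side
      exact haround u (X.blocks_white u huB) huO p' p h1 hp (ih.2.2 p' h3)
  set c := X.blocks.filter fun u => Relation.ReflTransGen (Step h X.blocks) u w with hc
  obtain ⟨O', hO', hc', hside⟩ := hm.exists_black_cycle (c := c) (Finset.filter_subset _ _)
    ⟨w, Finset.mem_filter.2 ⟨hwB, Relation.ReflTransGen.refl⟩⟩ (by
      rintro z ⟨u, hu, huz, huo⟩
      obtain ⟨huB, huw⟩ := Finset.mem_filter.1 hu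
      have hu1 := X.blocks_white u huB
      have hz : z ∈ X.V3 := X.mem_V3.2 ⟨u, huB, huz⟩
      have hhz := hm.invol z (X.V3_subset_verts hz)
      have hoB : opp z u ∈ X.blocks := by
        obtain ⟨p, h1, h2, h3⟩ := huz.exists_side
        exact hIB p ((hgood u huw).2.2 p h1) _ h3.symm
      rcases hm.mid hz with h' | h'
      swap
      · exact h'.1
      exfalso
      rcases eq_or_eq_opp_of_isV1 huz h'.2.near hu1 (X.isV1_of_mem h'.1) with he | he
      · rw [he] at hhz
        rcases Relation.ReflTransGen.cases_head huw with heq | ⟨v, ⟨_, _, hv⟩, hvr⟩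
        · rw [heq, hhr] at hhz
          exact (hI2 r hr).not_isV3 (hhz ▸ X.isV3_of_mem hz)
        · rw [hhz] at hv
          subst hv
          exact huo (Finset.mem_filter.2 ⟨hoB, hvr⟩)
      · rw [he] at hhz
        refine huo (Finset.mem_filter.2 ⟨hoB, Relation.ReflTransGen.head ⟨hoB, ?_, ?_⟩ huw⟩)
        · rw [hhz]; exact X.isV3_of_mem hz
        · rw [hhz, opp_opp])
  refine ⟨O', hO', hc', fun p hp => hlow p ?_⟩
  obtain ⟨u, hu, hup⟩ := hside p hp
  exact (hgood u (Finset.mem_filter.1 hu).2).2.2 p hup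

/-- Among all cycles of both colours, one whose maximum of `x + y` is least contradicts the descent.
-/
lemma not_isCycle (hk : 1 ≤ k) (hX : X.IsImpurityDomain) {O : Finset Pt}
    (hO : O ⊆ X.blocks ∨ O ⊆ X.V2) : ¬ IsCycle h O := by
  classical
  intro hcyc
  set f : Finset Pt → WithBot ℤ := fun O => O.sup fun p => ((p.1 + p.2 : ℤ) : WithBot ℤ) with hf
  have hlt : ∀ O O' : Finset Pt, O.Nonempty → Lower O' O → f O' < f O := by
    rintro O O' ⟨p, hp⟩ hlow
    rw [hf, Finset.sup_lt_iff]
    · intro x hx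
      obtain ⟨y, hy, hxy⟩ := hlow x hx
      exact lt_of_lt_of_le (WithBot.coe_lt_coe.2 hxy)
        (Finset.le_sup (f := fun p : Pt => ((p.1 + p.2 : ℤ) : WithBot ℤ)) hy)
    · exact lt_of_lt_of_le (WithBot.bot_lt_coe _)
        (Finset.le_sup (f := fun p : Pt => ((p.1 + p.2 : ℤ) : WithBot ℤ)) hp)
  set 𝒞 := (X.blocks.powerset ∪ X.V2.powerset).filter (IsCycle h) with h𝒞
  have hmem : ∀ O, O ∈ 𝒞 ↔ (O ⊆ X.blocks ∨ O ⊆ X.V2) ∧ IsCycle h O := by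
    intro O
    rw [h𝒞, Finset.mem_filter, Finset.mem_union, Finset.mem_powerset, Finset.mem_powerset]
  obtain ⟨M, hM, hmin⟩ := 𝒞.exists_min_image f ⟨O, (hmem O).2 ⟨hO, hcyc⟩⟩
  obtain ⟨hM1, hM2⟩ := (hmem M).1 hM
  rcases hM1 with hM1 | hM1
  · obtain ⟨O', h1, h2, h3⟩ := hm.exists_lower_black_cycle hk hX hM1 hM2
    exact absurd (hlt M O' hM2.1 h3) (not_lt.2 (hmin O' ((hmem O').2 ⟨Or.inr h1, h2⟩)))
  · obtain ⟨O', h1, h2, h3⟩ := hm.exists_lower_white_cycle hk hX hM1 hM2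
    exact absurd (hlt M O' hM2.1 h3) (not_lt.2 (hmin O' ((hmem O').2 ⟨Or.inl h1, h2⟩)))

/-- A nonempty set of blocks is not bounded by middle vertices matched with black vertices. -/
lemma exists_bd_white (hk : 1 ≤ k) (hX : X.IsImpurityDomain) {c : Finset Pt} (hc : c ⊆ X.blocks)
    (hne : c.Nonempty) : ∃ z, Bd c z ∧ h z ∉ X.V2 := by
  by_contra! hcon
  obtain ⟨O, hO, hcyc, -⟩ := hm.exists_black_cycle hc hne hcon
  exact hm.not_isCycle hk hX (Or.inr hO) hcyc

end IsMate

end BlockDomain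

/-! ### The multigraph on the white vertices and the root -/

namespace BlockDomain

variable {k : ℕ} (X : BlockDomain k)

lemma inc_mid_some {z : X.V3} {w : X.V1} : X.Inc (Sum.inl z) (some w) ↔ X.Sees w z := by
  change X.graph.Adj z w ↔ _
  rw [X.graph.adj_comm, X.adj_white_mid (X.isV1_of_mem w.2) (X.isV3_of_mem z.2)]

lemma inc_mid_none {z : X.V3} : X.Inc (Sum.inl z) none ↔ X.IsBoundary z := by
  change X.AdjRoot z ↔ _
  unfold AdjRoot
  refine or_iff_right ?_
  rintro ⟨i, hi⟩
  exact (X.terminal_white i).not_isV3 (hi ▸ X.isV3_of_mem z.2)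

lemma inc_terminal_some {i : Fin (2 * k - 1)} {w : X.V1} :
    X.Inc (Sum.inr i) (some w) ↔ (w : Pt) = X.terminal i := by
  change (some w = none ∨ some (w : Pt) = some (X.terminal i)) ↔ _
  simp

lemma inc_terminal_none {i : Fin (2 * k - 1)} : X.Inc (Sum.inr i) none := Or.inl rfl

/-- Black neighbours are never missing, so only the white vertex opposite to the block can be. -/
lemma isBoundary_iff {z b : Pt} (hb : b ∈ X.blocks) (hn : Near b z) :
    X.IsBoundary z ↔ ¬ X.Sees (opp z b) z := by
  have hb1 := X.blocks_white b hb
  have hz : z ∈ X.V3 := X.mem_V3.2 ⟨b, hb, hn⟩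
  have hz3 := X.isV3_of_mem hz
  constructor
  · rintro ⟨-, v, hv, hnv⟩ hs
    rw [radial.adj_comm, radial_adj_mid hz3] at hv
    rw [X.graph.adj_comm] at hnv
    rcases hv with ⟨h1 | h1, h2⟩
    · rw [X.adj_white_mid h1 hz3] at hnv
      rcases eq_or_eq_opp_of_isV1 hn h2 hb1 h1 with rfl | rfl
      · exact hnv (Or.inl ⟨hb, hn⟩)
      · exact hnv hs
    · exact hnv ((X.adj_black_mid h1 hz).2 h2)
  · intro hs
    refine ⟨hz, opp z b, ?_, ?_⟩
    · rw [radial.adj_comm, radial_adj_mid hz3]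
      exact ⟨Or.inl (hn.isV1_opp hb1), hn.opp⟩
    · rwa [X.graph.adj_comm, X.adj_white_mid (hn.isV1_opp hb1) hz3]

lemma sees_iff {z b w : Pt} (hb : b ∈ X.blocks) (hn : Near b z) :
    X.Sees w z ↔ w = b ∨ (w = opp z b ∧ X.Sees (opp z b) z) := by
  constructor
  · intro h
    rcases eq_or_eq_opp_of_isV1 hn h.near (X.blocks_white b hb) (X.isV1_of_mem h.mem_V1) with
      rfl | rfl
    · exact Or.inl rfl
    · exact Or.inr ⟨rfl, h⟩
  · rintro (rfl | ⟨rfl, h⟩)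
    · exact Or.inl ⟨hb, hn⟩
    · exact h

/-- A middle vertex which is not on the boundary is seen from both sides. -/
lemma sees_opp {z w : Pt} (h : X.Sees w z) (hz : ¬ X.IsBoundary z) : X.Sees (opp z w) z := by
  obtain ⟨b, hb, hn⟩ := X.mem_V3.1 h.mem_V3
  rw [X.isBoundary_iff hb hn, not_not] at hz
  rcases (X.sees_iff hb hn).1 h with rfl | ⟨rfl, _⟩
  · exact hz
  · rw [opp_opp]; exact Or.inl ⟨hb, hn⟩

lemma not_isBoundary_of_sees {z w w' : Pt} (h : X.Sees w z) (h' : X.Sees w' z) (hne : w ≠ w') :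
    ¬ X.IsBoundary z := by
  obtain ⟨b, hb, hn⟩ := X.mem_V3.1 h.mem_V3
  rw [X.isBoundary_iff hb hn, not_not]
  rcases (X.sees_iff hb hn).1 h with rfl | ⟨rfl, h1⟩
  · rcases (X.sees_iff hb hn).1 h' with rfl | ⟨rfl, h1⟩
    · exact absurd rfl hne
    · exact h1
  · exact h1

/-- A middle vertex has a block centre on one side. Its other end is the white vertex across if that
one sees it, and the root otherwise. -/
lemma exists_oth : ∃ oth : X.RootedEdge → X.RootedV1 → X.RootedV1, TwoEnded X.Inc oth := by
  refine exists_twoEnded ?_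
  rintro (z | i)
  · obtain ⟨b, hb, hn⟩ := X.mem_V3.1 z.2
    by_cases hs : X.Sees (opp (z : Pt) b) z
    · refine ⟨some ⟨b, X.blocks_subset_V1 hb⟩, some ⟨_, hs.mem_V1⟩, ?_, ?_⟩
      · intro h
        exact hn.opp_ne (congrArg Subtype.val (Option.some.inj h)).symm
      · rintro (_ | w)
        · rw [inc_mid_none, X.isBoundary_iff hb hn]
          simp [hs]
        · rw [inc_mid_some, X.sees_iff hb hn]
          simp [hs, Subtype.ext_iff]
    · refine ⟨some ⟨b, X.blocks_subset_V1 hb⟩, none, by simp, ?_⟩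
      rintro (_ | w)
      · rw [inc_mid_none, X.isBoundary_iff hb hn]
        simp [hs]
      · rw [inc_mid_some, X.sees_iff hb hn]
        simp [hs, Subtype.ext_iff]
  · refine ⟨none, some ⟨_, X.terminal_mem_V1 i⟩, by simp, ?_⟩
    rintro (_ | w)
    · simp [inc_terminal_none]
    · rw [inc_terminal_some]
      simp [Subtype.ext_iff]

/-- The end of an edge of `Ḡ₁` other than the given one. -/
noncomputable def oth : X.RootedEdge → X.RootedV1 → X.RootedV1 := X.exists_oth.choose

lemma twoEnded : TwoEnded X.Inc X.oth := X.exists_oth.choose_spec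

/-- The incidence relation of the graph on the black vertices. -/
def BlackInc (z : X.V3) (p : X.V2) : Prop := X.graph.Adj p z

lemma blackInc_iff {z : X.V3} {p : X.V2} : X.BlackInc z p ↔ Near p z :=
  X.adj_black_mid (X.isV2_of_mem p.2) z.2

lemma exists_blackOth : ∃ oth : X.V3 → X.V2 → X.V2, TwoEnded X.BlackInc oth := by
  refine exists_twoEnded fun z => ?_
  obtain ⟨p, hp, hn⟩ := exists_isV2_near (X.isV3_of_mem z.2)
  refine ⟨⟨p, X.mem_V2_of_near z.2 hp hn⟩,
    ⟨_, X.mem_V2_of_near z.2 (hn.isV2_opp hp) hn.opp⟩, ?_, fun q => ?_⟩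
  · intro h
    exact hn.opp_ne (congrArg Subtype.val h).symm
  · rw [blackInc_iff, Subtype.ext_iff, Subtype.ext_iff]
    constructor
    · intro h
      exact eq_or_eq_opp_of_isV2 hn h hp (X.isV2_of_mem q.2)
    · rintro (h | h)
      · rw [h]; exact hn
      · rw [h]; exact hn.opp

/-- The end of an edge of `G₂` other than the given one. -/
noncomputable def blackOth : X.V3 → X.V2 → X.V2 := X.exists_blackOth.choose

lemma blackTwoEnded : TwoEnded X.BlackInc X.blackOth := X.exists_blackOth.choose_spec

lemma forestGraph_eq (S : Finset X.V3) : X.forestGraph S = edgeGraph X.BlackInc S := by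
  ext x y
  change (x ≠ y ∧ ∃ z ∈ S, X.graph.Adj x z ∧ X.graph.Adj z y) ↔
    (x ≠ y ∧ ∃ z ∈ S, X.graph.Adj x z ∧ X.graph.Adj y z)
  simp only [X.graph.adj_comm y]

lemma mid_unique {z z' : Pt} {v u : Pt} (hvu : v ≠ u) (h1 : X.Sees v z) (h2 : X.Sees u z)
    (h3 : X.Sees v z') (h4 : X.Sees u z') : z = z' := by
  have e1 := (eq_or_eq_opp_of_isV1 h1.near h2.near (X.isV1_of_mem h1.mem_V1)
    (X.isV1_of_mem h2.mem_V1)).resolve_left (Ne.symm hvu)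
  have e2 := (eq_or_eq_opp_of_isV1 h3.near h4.near (X.isV1_of_mem h1.mem_V1)
    (X.isV1_of_mem h2.mem_V1)).resolve_left (Ne.symm hvu)
  rw [e1, pt_ext_iff] at e2
  rw [pt_ext_iff]
  simp only [opp] at e2
  omega

/-- Distinct white vertices are joined by at most one edge. -/
lemma inc_unique {v u : X.V1} (hvu : v ≠ u) {e e' : X.RootedEdge} (h1 : X.Inc e (some v))
    (h2 : X.Inc e (some u)) (h3 : X.Inc e' (some v)) (h4 : X.Inc e' (some u)) : e = e' := by
  have hvu' : (v : Pt) ≠ u := fun h => hvu (Subtype.ext h)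
  rcases e with z | i
  · rcases e' with z' | i
    · rw [inc_mid_some] at *
      rw [Subtype.ext (X.mid_unique hvu' h1 h2 h3 h4)]
    · rw [inc_terminal_some] at h3 h4
      exact absurd (h3.trans h4.symm) hvu'
  · rw [inc_terminal_some] at h1 h2
    exact absurd (h1.trans h2.symm) hvu'

lemma oth_terminal {i : Fin (2 * k - 1)} {v : X.V1} (h : X.Inc (Sum.inr i) (some v)) :
    X.oth (Sum.inr i) (some v) = none :=
  X.twoEnded.oth_eq h X.inc_terminal_none (by simp)

open Classical in
lemma deg_eq (v : X.V1) : X.deg (some v) = (edgesAt X.Inc v).card := by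
  rw [deg, edgesAt, ← Set.ncard_coe_finset]
  simp

open Classical in
lemma mult_eq {v u : X.V1} (h : v ≠ u) : X.mult (some v) (some u) =
    ((edgesAt X.Inc v).filter fun e => X.oth e (some v) = some u).card := by
  rw [mult, ← Set.ncard_coe_finset]
  congr 1
  ext e
  simp only [edgesAt, Set.mem_ofPred_eq, Finset.coe_filter, Finset.mem_filter, Finset.mem_univ,
    true_and]
  constructor
  · rintro ⟨h1, h2, h3⟩
    exact ⟨h2, X.twoEnded.oth_eq h2 h3 h1⟩
  · rintro ⟨h1, h2⟩
    exact ⟨by simpa using h, h1, h2 ▸ X.twoEnded.inc_oth h1⟩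

-- Two white vertices are never joined by parallel edges, so the entries `-1` of the matrix are the
-- true negative multiplicities.
open Classical in
lemma mult_eq_ite {v u : X.V1} (h : v ≠ u) : (X.mult (some v) (some u) : ℝ) =
    if ∃ e, X.Inc e (some v) ∧ X.Inc e (some u) then 1 else 0 := by
  have hne : (some v : X.RootedV1) ≠ some u := by simpa using h
  rw [mult]
  split_ifs with he
  · obtain ⟨e, h1, h2⟩ := he
    have : {e | (some v : X.RootedV1) ≠ some u ∧ X.Inc e (some v) ∧ X.Inc e (some u)} = {e} := by
      ext e'
      constructor
      · rintro ⟨-, h3, h4⟩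
        exact X.inc_unique h h3 h4 h1 h2
      · rintro rfl
        exact ⟨hne, h1, h2⟩
    rw [this, Set.ncard_singleton, Nat.cast_one]
  · have : {e | (some v : X.RootedV1) ≠ some u ∧ X.Inc e (some v) ∧ X.Inc e (some u)} = ∅ := by
      ext e'
      simp only [Set.mem_ofPred_eq, Set.mem_empty_iff_false, iff_false]
      rintro ⟨-, h3, h4⟩
      exact he ⟨e', h3, h4⟩
    rw [this, Set.ncard_empty, Nat.cast_zero]

lemma laplacian_apply_self (v : X.V1) : X.laplacian v v = X.deg (some v) := by
  simp [laplacian, rootedLaplacian]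

lemma laplacian_apply_ne {v u : X.V1} (h : v ≠ u) :
    X.laplacian v u = - (X.mult (some v) (some u) : ℝ) := by
  rw [mult_eq_ite X h]
  simp only [laplacian, rootedLaplacian, Matrix.submatrix_apply, Matrix.of_apply,
    Option.some.injEq, h, if_false]
  split_ifs <;> simp

lemma laplacian_eq : X.laplacian =
    edgeLaplacian (edgesAt X.Inc) (fun v e => X.oth e (some v)) := by
  classical
  ext v u
  by_cases h : v = u
  · subst h
    rw [laplacian_apply_self, deg_eq]
    simp only [edgeLaplacian, Matrix.of_apply]
    rw [Finset.sum_congr rfl (g := fun _ => (1 : ℝ))]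
    · simp
    · intro e he
      have : X.oth e (some v) ≠ some v := X.twoEnded.ne _ _ (by simpa [edgesAt] using he)
      simp [this]
  · rw [X.laplacian_apply_ne h, X.mult_eq h]
    simp [edgeLaplacian, h, Finset.sum_boole]

/-- The spanning trees of `Ḡ₁`, oriented towards the root. -/
noncomputable abbrev arbs : Finset (X.V1 → X.RootedEdge) := rootedTrees X.Inc X.oth

lemma det_laplacian : X.laplacian.det = X.arbs.card := by
  rw [laplacian_eq, det_edgeLaplacian]
  rfl

/-- Go to the upper right from a block centre, and straight to the root from a terminal. The first
coordinate increases, so the root is reached; this makes the determinant nonzero. -/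
lemma arbs_nonempty : X.arbs.Nonempty := by
  classical
  have hf : ∀ v : X.V1, ∃ e, X.Inc e (some v) ∧
      ∀ u : X.V1, X.oth e (some v) = some u → (v : Pt).1 < (u : Pt).1 := by
    intro v
    rcases X.mem_V1.1 v.2 with hv | ⟨i, hi⟩
    · have hn := (near_corner v).1
      have hinc : X.Inc (Sum.inl ⟨_, X.mem_V3.2 ⟨v, hv, hn⟩⟩) (some v) :=
        X.inc_mid_some.2 (Or.inl ⟨hv, hn⟩)
      refine ⟨_, hinc, fun u hu => ?_⟩
      have h2 := X.twoEnded.inc_oth hinc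
      rw [hu, inc_mid_some] at h2
      have h3 : (v : Pt) ≠ u := fun h => X.twoEnded.ne _ _ hinc (by rw [hu, Subtype.ext h])
      have h4 := (eq_or_eq_opp_of_isV1 hn h2.near (X.isV1_of_mem v.2)
        (X.isV1_of_mem u.2)).resolve_left (Ne.symm h3)
      rw [h4]
      simp only [opp]
      omega
    · have hinc : X.Inc (Sum.inr i) (some v) := X.inc_terminal_some.2 hi.symm
      refine ⟨_, hinc, fun u hu => ?_⟩
      rw [X.oth_terminal hinc] at hu
      simp at hu
  choose f hf1 hf2 using hf
  refine ⟨f, mem_rootedTrees.2 ⟨hf1, drains_of_no_cycle fun O hO hp => ?_⟩⟩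
  obtain ⟨p, hpO, hmin⟩ := O.exists_min_image (fun v : X.V1 => (v : Pt).1) hO
  obtain ⟨q, hq, hqp⟩ := hp p hpO
  exact absurd (hf2 q p hqp) (not_lt.2 (hmin q hq))

lemma det_laplacian_pos : 0 < X.laplacian.det := by
  rw [det_laplacian]
  exact_mod_cast X.arbs_nonempty.card_pos

/-- The path from `v` in an oriented tree reaches the root by an edge from a terminal. -/
def ExitsAtTerminal (f : X.V1 → X.RootedEdge) (v : X.V1) : Prop :=
  ∃ u i, Relation.ReflTransGen (fun a b => X.oth (f a) (some a) = some b) v u ∧ f u = Sum.inr i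

-- Cramer's rule with reward one for each terminal edge. The path from `j` in an oriented tree uses
-- at most one such edge, necessarily its last, so the reward is the indicator of `ExitsAtTerminal`.
open Classical in
lemma card_mul_p (j : X.V1) :
    (X.arbs.card : ℝ) * X.p j = (X.arbs.filter fun f => X.ExitsAtTerminal f j).card := by
  have hdet : IsUnit X.laplacian.det := (X.det_laplacian_pos).ne'.isUnit
  have hAp : Matrix.mulVec X.laplacian X.p = X.terminalVec := by
    rw [p, Matrix.mulVec_mulVec, Matrix.mul_nonsing_inv _ hdet, Matrix.one_mulVec]
  have hb : X.terminalVec = fun v => ∑ e ∈ edgesAt X.Inc v,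
      (if ∃ i, e = Sum.inr i then (1 : ℝ) else 0) := by
    funext v
    rw [Finset.sum_boole, terminalVec]
    split_ifs with h
    · obtain ⟨i, hi⟩ := h
      have : (edgesAt X.Inc v).filter (fun e => ∃ i, e = Sum.inr i) = {Sum.inr i} := by
        ext e
        simp only [edgesAt, Finset.mem_filter, Finset.mem_univ, true_and, Finset.mem_singleton]
        constructor
        · rintro ⟨h1, j, rfl⟩
          rw [inc_terminal_some, ← hi] at h1
          rw [X.terminal_injective h1]
        · rintro rfl
          exact ⟨X.inc_terminal_some.2 hi.symm, i, rfl⟩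
      rw [this]
      simp
    · have : (edgesAt X.Inc v).filter (fun e => ∃ i, e = Sum.inr i) = ∅ := by
        ext e
        simp only [edgesAt, Finset.mem_filter, Finset.mem_univ, true_and, Finset.notMem_empty,
          iff_false]
        rintro ⟨h1, j, rfl⟩
        exact h ⟨j, (X.inc_terminal_some.1 h1).symm⟩
      rw [this]
      simp
  have hcr : Matrix.cramer X.laplacian X.terminalVec j = X.laplacian.det * X.p j := by
    rw [← hAp, Matrix.cramer_eq_adjugate_mulVec, Matrix.mulVec_mulVec, Matrix.adjugate_mul,
      Matrix.smul_mulVec, Matrix.one_mulVec]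
    rfl
  rw [← det_laplacian, ← hcr, laplacian_eq, hb, cramer_edgeLaplacian _ _
    (fun _ e => if ∃ i, e = Sum.inr i then (1 : ℝ) else 0)
    (fun f v => if X.ExitsAtTerminal f v then 1 else 0), Finset.sum_boole]
  · rfl
  intro f hf v
  have hinc : ∀ v, X.Inc (f v) (some v) := by
    intro v
    simpa [edgesAt] using Fintype.mem_piFinset.1 hf v
  rcases hs : X.oth (f v) (some v) with _ | u
  · simp only [Option.elim_none, add_zero]
    congr 1
    refine propext ⟨?_, ?_⟩
    · rintro ⟨u, i, h1, h2⟩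
      rcases Relation.ReflTransGen.cases_head h1 with rfl | ⟨w, h3, _⟩
      · exact ⟨i, h2⟩
      · rw [hs] at h3; simp at h3
    · rintro ⟨i, hi⟩
      exact ⟨v, i, Relation.ReflTransGen.refl, hi⟩
  · have hni : ¬ ∃ i, f v = Sum.inr i := by
      rintro ⟨i, hi⟩
      have := hinc v
      rw [hi] at hs this
      rw [X.oth_terminal this] at hs
      simp at hs
    have hiff : X.ExitsAtTerminal f v ↔ X.ExitsAtTerminal f u := by
      constructor
      · rintro ⟨w, i, h1, h2⟩
        rcases Relation.ReflTransGen.cases_head h1 with rfl | ⟨w', h3, h4⟩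
        · exact absurd ⟨i, h2⟩ hni
        · rw [hs] at h3
          cases h3
          exact ⟨w, i, h4, h2⟩
      · rintro ⟨w, i, h1, h2⟩
        exact ⟨w, i, Relation.ReflTransGen.head hs h1, h2⟩
    simp [hni, hiff]

lemma deg_pos (v : X.V1) : 0 < X.deg (some v) := by
  rw [deg_eq, Finset.card_pos]
  obtain ⟨f, hf⟩ := X.arbs_nonempty
  exact ⟨f v, by simpa [edgesAt] using (mem_rootedTrees.1 hf).1 v⟩

/-- The only middle vertex seen by a terminal is its port, and behind the port lies a block. That
edge does not lead to the root, which leaves the terminal edge alone. -/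
lemma mult_terminal (i : Fin (2 * k - 1)) :
    X.mult (some ⟨X.terminal i, X.terminal_mem_V1 i⟩) none = 1 := by
  rw [mult, Set.ncard_eq_one]
  refine ⟨Sum.inr i, ?_⟩
  ext e
  simp only [Set.mem_ofPred_eq, Set.mem_singleton_iff]
  constructor
  · rintro ⟨-, h1, h2⟩
    rcases e with z | j
    · rw [inc_mid_none] at h2
      rw [inc_mid_some] at h1
      exfalso
      rcases id h1 with ⟨h3, _⟩ | ⟨j, h3, h4⟩
      · exact X.terminal_notMem i h3
      · have h5 := X.opp_port_mem_blocks j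
        rw [h3, h4] at h5
        exact X.not_isBoundary_of_sees h1 (Or.inl ⟨h5, h1.near.opp⟩) h1.near.opp_ne.symm h2
    · rw [inc_terminal_some] at h1
      rw [X.terminal_injective h1]
  · rintro rfl
    exact ⟨by simp, X.inc_terminal_some.2 rfl, X.inc_terminal_none⟩

lemma hasSum_hitProb (j : X.V1) : HasSum (fun n : ℕ => X.hitProb n j) (X.p j) := by
  classical
  have hdeg : ∀ v, (X.deg (some v) : ℝ) ≠ 0 := fun v => by exact_mod_cast (X.deg_pos v).ne'
  -- The walk inherits invertibility of `1 - P` from the Laplacian, whose rows are divided by the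
  -- degrees.
  have h1P : 1 - X.walkMatrix =
      Matrix.diagonal (fun v => (X.deg (some v) : ℝ)⁻¹) * X.laplacian := by
    ext v u
    rw [Matrix.diagonal_mul, Matrix.sub_apply]
    by_cases h : v = u
    · subst h
      rw [laplacian_apply_self, Matrix.one_apply_eq, inv_mul_cancel₀ (hdeg v)]
      simp [walkMatrix, mult]
    · rw [laplacian_apply_ne X h, Matrix.one_apply_ne h]
      simp only [walkMatrix, Matrix.of_apply]
      field_simp
      ring
  have hdet : IsUnit X.laplacian.det := (X.det_laplacian_pos).ne'.isUnit
  refine hasSum_killed_walk X.walkMatrix ?_ ?_ ?_ X.exitVec X.p ?_ ?_ j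
  · intro x y
    simp only [walkMatrix, Matrix.of_apply]
    positivity
  · intro x
    simp only [walkMatrix, Matrix.of_apply]
    rw [← Finset.sum_div, div_le_one (by exact_mod_cast X.deg_pos x), deg_eq]
    have h1 : ∀ y, (X.mult (some x) (some y) : ℝ) ≤
        ∑ e ∈ edgesAt X.Inc x, if X.oth e (some x) = some y then 1 else 0 := by
      intro y
      by_cases h : x = y
      · subst h
        have : X.mult (some x) (some x) = 0 := by simp [mult]
        rw [this, Nat.cast_zero]
        exact Finset.sum_nonneg fun e _ => by split_ifs <;> norm_num
      · rw [mult_eq X h, Finset.sum_boole]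
    calc ∑ y, (X.mult (some x) (some y) : ℝ)
        ≤ ∑ y, ∑ e ∈ edgesAt X.Inc x, (if X.oth e (some x) = some y then (1 : ℝ) else 0) :=
          Finset.sum_le_sum fun y _ => h1 y
      _ = ∑ e ∈ edgesAt X.Inc x, ∑ y, (if X.oth e (some x) = some y then (1 : ℝ) else 0) :=
          Finset.sum_comm
      _ ≤ ∑ e ∈ edgesAt X.Inc x, 1 := by
          refine Finset.sum_le_sum fun e _ => ?_
          rcases X.oth e (some x) with _ | u
          · simp
          · simp [Finset.sum_ite_eq]
      _ = ((edgesAt X.Inc x).card : ℝ) := by simp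
  · rw [h1P, Matrix.det_mul, Matrix.det_diagonal]
    exact mul_ne_zero (Finset.prod_ne_zero_iff.2 fun v _ => inv_ne_zero (hdeg v))
      X.det_laplacian_pos.ne'
  · intro x
    unfold exitVec
    split_ifs <;> positivity
  · rw [h1P, ← Matrix.mulVec_mulVec, p, Matrix.mulVec_mulVec X.terminalVec,
      Matrix.mul_nonsing_inv _ hdet, Matrix.one_mulVec]
    funext x
    rw [Matrix.mulVec_diagonal]
    unfold terminalVec exitVec
    split_ifs with h
    · obtain ⟨i, hi⟩ := h
      have hx : x = ⟨X.terminal i, X.terminal_mem_V1 i⟩ := Subtype.ext hi.symm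
      rw [hx, mult_terminal, Nat.cast_one, mul_one, one_div]
    · simp

end BlockDomain

/-! ### Dimer coverings and the flows which they define -/

namespace BlockDomain

variable {k : ℕ} {X : BlockDomain k} {h : Pt → Pt}

lemma exists_isMate {M : Finset (Sym2 Pt)} (hM : M ∈ X.dimerCoverings) :
    ∃ h, X.IsMate h ∧ ∀ e, e ∈ M ↔ ∃ v ∈ X.verts, e = s(v, h v) := by
  obtain ⟨hsub, huniq⟩ := hM
  have hmem : ∀ {u v}, s(u, v) ∈ M → X.graph.Adj u v := fun {u v} huv => by
    have := hsub huv
    rwa [SimpleGraph.Subgraph.mem_edgeSet] at this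
  have hex : ∀ v, ∃ w, v ∈ X.verts → s(v, w) ∈ M ∧ ∀ w', s(v, w') ∈ M → w' = w := by
    intro v
    by_cases hv : v ∈ X.verts
    · obtain ⟨e, ⟨he, hve⟩, hu⟩ := huniq v hv
      obtain ⟨w, rfl⟩ := Sym2.mem_iff_exists.1 hve
      refine ⟨w, fun _ => ⟨he, fun w' hw' => ?_⟩⟩
      have := hu _ ⟨hw', Sym2.mem_mk_left _ _⟩
      exact Sym2.congr_right.1 this
    · exact ⟨v, fun h' => absurd h' hv⟩
  choose h hh using hex
  refine ⟨h, ⟨fun v hv => ?_, fun v hv => hmem (hh v hv).1⟩, fun e => ⟨fun he => ?_, ?_⟩⟩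
  · have hv' := (X.graph_adj_mem_verts (hmem (hh v hv).1)).2
    exact ((hh _ hv').2 v (by rw [Sym2.eq_swap]; exact (hh v hv).1)).symm
  · induction e with
    | _ a b =>
      have ha := (X.graph_adj_mem_verts (hmem he)).1
      exact ⟨a, ha, by rw [(hh a ha).2 b he]⟩
  · rintro ⟨v, hv, rfl⟩
    exact (hh v hv).1

lemma IsMate.mem_dimerCoverings (hm : X.IsMate h) :
    X.verts.image (fun v => s(v, h v)) ∈ X.dimerCoverings := by
  constructor
  · intro e he
    obtain ⟨v, hv, rfl⟩ := Finset.mem_image.1 (Finset.mem_coe.1 he)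
    exact hm.adj v hv
  · intro v hv
    refine ⟨s(v, h v), ⟨Finset.mem_image_of_mem _ hv, Sym2.mem_mk_left _ _⟩, ?_⟩
    rintro e ⟨he, hve⟩
    obtain ⟨u, hu, rfl⟩ := Finset.mem_image.1 he
    rcases Sym2.mem_iff.1 hve with rfl | rfl
    · rfl
    · rw [hm.invol u hu, Sym2.eq_swap]

namespace IsMate

lemma mem_verts (hm : X.IsMate h) {v : Pt} (hv : v ∈ X.verts) : h v ∈ X.verts :=
  (X.graph_adj_mem_verts (hm.adj v hv)).2

lemma card_filter_comm (hm : X.IsMate h) {A B : Finset Pt} (hA : A ⊆ X.verts) (hB : B ⊆ X.verts) :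
    (A.filter fun v => h v ∈ B).card = (B.filter fun v => h v ∈ A).card := by
  refine Finset.card_bij (fun v _ => h v) ?_ ?_ ?_
  · intro v hv
    rw [Finset.mem_filter] at hv ⊢
    rw [hm.invol v (hA hv.1)]
    exact ⟨hv.2, hv.1⟩
  · intro v hv u hu huv
    rw [Finset.mem_filter] at hv hu
    rw [← hm.invol v (hA hv.1), huv, hm.invol u (hA hu.1)]
  · intro v hv
    rw [Finset.mem_filter] at hv
    exact ⟨h v, Finset.mem_filter.2 ⟨hv.2, by rw [hm.invol v (hB hv.1)]; exact hv.1⟩,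
      hm.invol v (hB hv.1)⟩

lemma card_split {A B C : Finset Pt} (hBC : Disjoint B C) (hA : ∀ v ∈ A, h v ∈ B ∨ h v ∈ C) :
    A.card = (A.filter fun v => h v ∈ B).card + (A.filter fun v => h v ∈ C).card := by
  rw [← Finset.card_union_of_disjoint]
  · congr 1
    ext v
    simp only [Finset.mem_union, Finset.mem_filter]
    constructor
    · intro hv
      rcases hA v hv with h' | h'
      · exact Or.inl ⟨hv, h'⟩
      · exact Or.inr ⟨hv, h'⟩
    · rintro (h' | h') <;> exact h'.1
  · refine Finset.disjoint_left.2 fun v h1 h2 => ?_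
    exact Finset.disjoint_left.1 hBC (Finset.mem_filter.1 h1).2 (Finset.mem_filter.1 h2).2

lemma _root_.BlockDomain.disjoint_V2_V3 (X : BlockDomain k) : Disjoint X.V2 X.V3 :=
  Finset.disjoint_left.2 fun _ h1 h2 => (X.isV2_of_mem h1).not_isV3 (X.isV3_of_mem h2)

lemma _root_.BlockDomain.disjoint_V1_V3 (X : BlockDomain k) : Disjoint X.V1 X.V3 :=
  Finset.disjoint_left.2 fun _ h1 h2 => (X.isV1_of_mem h1).not_isV3 (X.isV3_of_mem h2)

lemma _root_.BlockDomain.disjoint_V1_V2 (X : BlockDomain k) : Disjoint X.V1 X.V2 :=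
  Finset.disjoint_left.2 fun _ h1 h2 => (X.isV1_of_mem h1).not_isV2 (X.isV2_of_mem h2)

/-- A dimer covering has exactly `k` impurities. -/
lemma card_impurities (hm : X.IsMate h) (hX : X.IsImpurityDomain) :
    (X.V1.filter fun w => h w ∈ X.V2).card = k := by
  -- With `a`, `b`, `c` the numbers of white-black, white-middle and black-middle pairs, the three
  -- colour classes have sizes `a + b`, `a + c` and `b + c`.
  have h1 := card_split (h := h) X.disjoint_V2_V3 fun w (hw : w ∈ X.V1) =>
    (hm.white hw).imp id And.left
  have h2 := card_split (h := h) X.disjoint_V1_V3 fun p (hp : p ∈ X.V2) =>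
    (hm.black hp).imp And.left And.left
  have h3 := card_split (h := h) X.disjoint_V1_V2 fun z (hz : z ∈ X.V3) =>
    (hm.mid hz).imp And.left And.left
  have h4 := hX.impurity_count
  have h5 := hm.card_filter_comm X.V1_subset_verts X.V2_subset_verts
  have h6 := hm.card_filter_comm X.V1_subset_verts X.V3_subset_verts
  have h7 := hm.card_filter_comm X.V2_subset_verts X.V3_subset_verts
  omega

end IsMate

lemma ncard_subtype (F : Finset Pt) (P : Pt → Prop) [DecidablePred P] :
    {v : F | P v}.ncard = (F.filter P).card := by
  rw [← Set.ncard_image_of_injective _ Subtype.val_injective, ← Set.ncard_coe_finset]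
  congr 1
  ext v
  simp only [Set.mem_image, Set.mem_ofPred_eq, Finset.coe_filter]
  constructor
  · rintro ⟨u, hu, rfl⟩
    exact ⟨u.2, hu⟩
  · rintro ⟨h1, h2⟩
    exact ⟨⟨v, h1⟩, h2, rfl⟩

/-- The next white vertex after `w`, if `w` is matched with a middle vertex and does not lead to
the root. -/
noncomputable def whiteStep (X : BlockDomain k) (h : Pt → Pt) (w : X.V1) : Option X.V1 :=
  if hz : h w ∈ X.V3 then X.oth (Sum.inl ⟨h w, hz⟩) (some w) else none

/-- The next black vertex after `p`, if `p` is matched with a middle vertex. -/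
noncomputable def blackStep (X : BlockDomain k) (h : Pt → Pt) (p : X.V2) : Option X.V2 :=
  if hz : h p ∈ X.V3 then some (X.blackOth ⟨h p, hz⟩ p) else none

lemma terminal_sees {i : Fin (2 * k - 1)} {z : Pt} (hs : X.Sees (X.terminal i) z) :
    z = X.port i := by
  rcases hs with ⟨h1, _⟩ | ⟨j, hj, rfl⟩
  · exact absurd h1 (X.terminal_notMem i)
  · rw [X.terminal_injective hj]

namespace IsMate

variable (hm : X.IsMate h)
include hm

lemma inc_white {w : X.V1} (hz : h w ∈ X.V3) : X.Inc (Sum.inl ⟨h w, hz⟩) (some w) := by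
  rw [inc_mid_some]
  rcases hm.white w.2 with h' | h'
  · exact absurd (X.isV3_of_mem hz) (X.isV2_of_mem h').not_isV3
  · exact h'.2

lemma inc_black {p : X.V2} (hz : h p ∈ X.V3) : X.BlackInc ⟨h p, hz⟩ p := by
  rw [blackInc_iff]
  exact hm.near_black p.2 (X.isV3_of_mem hz)

lemma whiteStep_eq_some {w u : X.V1} : X.whiteStep h w = some u ↔
    h w ∈ X.V3 ∧ w ≠ u ∧ X.Sees u (h w) := by
  unfold whiteStep
  split_ifs with hz
  · have hinc := hm.inc_white hz
    constructor
    · intro he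
      have h1 := X.twoEnded.inc_oth hinc
      rw [he, inc_mid_some] at h1
      refine ⟨hz, ?_, h1⟩
      rintro rfl
      exact X.twoEnded.ne _ _ hinc he
    · rintro ⟨_, hne, hs⟩
      exact X.twoEnded.oth_eq hinc (X.inc_mid_some.2 hs) (by simpa using hne)
  · simp [hz]

lemma whiteStep_eq_none {w : X.V1} : X.whiteStep h w = none ↔
    h w ∈ X.V2 ∨ X.IsBoundary (h w) := by
  unfold whiteStep
  split_ifs with hz
  · have hinc := hm.inc_white hz
    have h2 : h w ∉ X.V2 := fun h' => Finset.disjoint_left.1 X.disjoint_V2_V3 h' hz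
    simp only [h2, false_or]
    rw [← X.inc_mid_none (z := ⟨h w, hz⟩), X.twoEnded.inc_iff _ _ hinc]
    simp [eq_comm]
  · rcases hm.white w.2 with h' | h'
    · simp [h']
    · exact absurd h'.1 hz

lemma blackStep_eq_some {p q : X.V2} : X.blackStep h p = some q ↔
    h p ∈ X.V3 ∧ p ≠ q ∧ Near q (h p) := by
  unfold blackStep
  split_ifs with hz
  · have hinc := hm.inc_black hz
    rw [Option.some.injEq]
    constructor
    · intro he
      have h1 := X.blackTwoEnded.inc_oth hinc
      rw [he, blackInc_iff] at h1
      refine ⟨hz, ?_, h1⟩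
      rintro rfl
      exact X.blackTwoEnded.ne _ _ hinc he
    · rintro ⟨_, hne, hs⟩
      exact X.blackTwoEnded.oth_eq hinc (X.blackInc_iff.2 hs) hne
  · simp [hz]

omit hm in
lemma blackStep_eq_none {p : X.V2} : X.blackStep h p = none ↔ h p ∉ X.V3 := by
  unfold blackStep
  split_ifs with hz <;> simp [hz]

/-- A terminal sees only its port, so a cycle through it would enter and leave by the same middle
vertex, matched with two white vertices. The remaining cycles, through block centres, are excluded
by `not_isCycle`. -/
lemma drains_whiteStep (hk : 1 ≤ k) (hX : X.IsImpurityDomain) : Drains (X.whiteStep h) := by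
  classical
  refine drains_of_no_cycle fun O hO hp => ?_
  have hstep := (cycle_bijective O (fun q => (X.whiteStep h q).getD q)
    (fun q => (X.whiteStep h q).isSome) (fun p hpO => by
      obtain ⟨q, hq, hqp⟩ := hp p hpO
      exact ⟨q, hq, by simp [hqp], by simp [hqp]⟩)).1
  have hB : ∀ p ∈ O, (p : Pt) ∈ X.blocks := by
    intro p hpO
    rcases X.mem_V1.1 p.2 with h' | ⟨i, hi⟩
    · exact h'
    exfalso
    obtain ⟨q, hq, hqp⟩ := hp p hpO
    obtain ⟨u, hu⟩ := Option.isSome_iff_exists.1 (hstep p hpO).1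
    obtain ⟨h1, h2, h3⟩ := hm.whiteStep_eq_some.1 hqp
    obtain ⟨h4, h5, h6⟩ := hm.whiteStep_eq_some.1 hu
    have h7 := X.inc_mid_some.1 (hm.inc_white h4)
    rw [← hi] at h3
    simp only [← hi] at h7
    have h8 : h q = h p := by
      rw [terminal_sees h3, ← hi, ← terminal_sees h7]
    refine h2 (Subtype.ext ?_)
    rw [← hm.invol q (X.V1_subset_verts q.2), h8, hm.invol p (X.V1_subset_verts p.2)]
  refine hm.not_isCycle hk hX (O := O.image Subtype.val) (Or.inl ?_) ⟨hO.image _, ?_⟩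
  · intro p hpO
    obtain ⟨p, hp', rfl⟩ := Finset.mem_image.1 hpO
    exact hB p hp'
  · intro p hpO
    obtain ⟨p, hp', rfl⟩ := Finset.mem_image.1 hpO
    obtain ⟨q, hq, hqp⟩ := hp p hp'
    obtain ⟨h1, h2, h3⟩ := hm.whiteStep_eq_some.1 hqp
    have h4 := hm.near_white q.2 (X.isV3_of_mem h1)
    refine ⟨q, Finset.mem_image_of_mem _ hq, X.isV3_of_mem h1, ?_⟩
    exact ((eq_or_eq_opp_of_isV1 h4 h3.near (X.isV1_of_mem q.2) (X.isV1_of_mem p.2)).resolve_left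
      fun h' => h2 (Subtype.ext h'.symm)).symm

lemma drains_blackStep (hk : 1 ≤ k) (hX : X.IsImpurityDomain) : Drains (X.blackStep h) := by
  classical
  refine drains_of_no_cycle fun O hO hp => ?_
  refine hm.not_isCycle hk hX (O := O.image Subtype.val) (Or.inr ?_) ⟨hO.image _, ?_⟩
  · intro p hpO
    obtain ⟨p, -, rfl⟩ := Finset.mem_image.1 hpO
    exact p.2
  · intro p hpO
    obtain ⟨p, hp', rfl⟩ := Finset.mem_image.1 hpO
    obtain ⟨q, hq, hqp⟩ := hp p hp'
    obtain ⟨h1, h2, h3⟩ := hm.blackStep_eq_some.1 hqp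
    have h4 := hm.near_black q.2 (X.isV3_of_mem h1)
    refine ⟨q, Finset.mem_image_of_mem _ hq, X.isV3_of_mem h1, ?_⟩
    exact ((eq_or_eq_opp_of_isV2 h4 h3 (X.isV2_of_mem q.2) (X.isV2_of_mem p.2)).resolve_left
      fun h' => h2 (Subtype.ext h'.symm)).symm

/-- A middle vertex in `S` is matched with one of its two black neighbours, and that one steps to
the other. -/
lemma isFlowGraph_black {S : Finset X.V3} (hS : ∀ z, z ∈ S ↔ h z ∈ X.V2) :
    IsFlowGraph (X.blackStep h) (X.forestGraph S) := by
  refine ⟨fun u v huv => ?_⟩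
  rw [forestGraph_eq]
  constructor
  · rintro ⟨-, z, hz, hzu, hzv⟩
    rw [hS] at hz
    rw [blackInc_iff] at hzu hzv
    rcases hm.mid z.2 with h' | ⟨-, hn⟩
    · exact absurd (X.isV2_of_mem hz) (X.isV1_of_mem h'.1).not_isV2
    have hhz := hm.invol z (X.V3_subset_verts z.2)
    have e1 := (eq_or_eq_opp_of_isV2 hzu hzv (X.isV2_of_mem u.2) (X.isV2_of_mem v.2)).resolve_left
      fun h' => huv (Subtype.ext h'.symm)
    rcases eq_or_eq_opp_of_isV2 hzu hn (X.isV2_of_mem u.2) (X.isV2_of_mem hz) with h' | h'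
    · rw [h'] at hhz
      exact Or.inl (hm.blackStep_eq_some.2 (by rw [hhz]; exact ⟨z.2, huv, hzv⟩))
    · rw [h', ← e1] at hhz
      exact Or.inr (hm.blackStep_eq_some.2 (by rw [hhz]; exact ⟨z.2, huv.symm, hzu⟩))
  · have key : ∀ {u v : X.V2}, X.blackStep h u = some v →
        ∃ z ∈ S, X.BlackInc z u ∧ X.BlackInc z v := by
      intro u v hs
      obtain ⟨h1, h2, h3⟩ := hm.blackStep_eq_some.1 hs
      refine ⟨⟨h u, h1⟩, ?_, hm.inc_black h1, X.blackInc_iff.2 h3⟩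
      rw [hS]
      simp only [hm.invol u (X.V2_subset_verts u.2)]
      exact u.2
    rintro (hs | hs)
    · exact ⟨huv, key hs⟩
    · obtain ⟨z, hz, h1, h2⟩ := key hs
      exact ⟨huv, z, hz, h2, h1⟩

lemma isFlowGraph_white {T : Finset X.RootedEdge} (hT : ∀ z, Sum.inl z ∈ T ↔ h z ∈ X.V1) :
    IsFlowGraph (X.whiteStep h) (X.cutGraph T) := by
  refine ⟨fun u v huv => ?_⟩
  constructor
  · rintro ⟨-, e, he, heu, hev⟩
    rcases e with z | i
    swap
    · rw [inc_terminal_some] at heu hev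
      exact absurd (Subtype.ext (heu.trans hev.symm)) huv
    rw [hT] at he
    rw [inc_mid_some] at heu hev
    rcases hm.mid z.2 with ⟨-, hn⟩ | h'
    swap
    · exact absurd (X.isV2_of_mem h'.1) (X.isV1_of_mem he).not_isV2
    have hhz := hm.invol z (X.V3_subset_verts z.2)
    have e1 := (eq_or_eq_opp_of_isV1 heu.near hev.near (X.isV1_of_mem u.2)
      (X.isV1_of_mem v.2)).resolve_left fun h' => huv (Subtype.ext h'.symm)
    rcases eq_or_eq_opp_of_isV1 heu.near hn.near (X.isV1_of_mem u.2) (X.isV1_of_mem he) with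
      h' | h'
    · rw [h'] at hhz
      exact Or.inl (hm.whiteStep_eq_some.2 (by rw [hhz]; exact ⟨z.2, huv, hev⟩))
    · rw [h', ← e1] at hhz
      exact Or.inr (hm.whiteStep_eq_some.2 (by rw [hhz]; exact ⟨z.2, huv.symm, heu⟩))
  · have key : ∀ {u v : X.V1}, X.whiteStep h u = some v →
        ∃ e ∈ T, X.Inc e (some u) ∧ X.Inc e (some v) := by
      intro u v hs
      obtain ⟨h1, h2, h3⟩ := hm.whiteStep_eq_some.1 hs
      refine ⟨Sum.inl ⟨h u, h1⟩, ?_, hm.inc_white h1, X.inc_mid_some.2 h3⟩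
      rw [hT]
      simp only [hm.invol u (X.V1_subset_verts u.2)]
      exact u.2
    have hne : (some u : X.RootedV1) ≠ some v := by simpa using huv
    rintro (hs | hs)
    · exact ⟨hne, key hs⟩
    · obtain ⟨z, hz, h1, h2⟩ := key hs
      exact ⟨hne, z, hz, h2, h1⟩

/-- A subtree containing an impurity contains a terminal. -/
lemma exists_terminal_dest (hk : 1 ≤ k) (hX : X.IsImpurityDomain) {dest : X.V1 → X.V1}
    (h0 : ∀ v, X.whiteStep h v = none → dest v = v)
    (h1 : ∀ v u, X.whiteStep h v = some u → dest v = dest u) {d : X.V1} (hd : h d ∈ X.V2) :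
    ∃ i, dest ⟨X.terminal i, X.terminal_mem_V1 i⟩ = d := by
  classical
  -- Otherwise the component `c` of the impurity consists of block centres. A middle vertex on its
  -- boundary is not matched with a white vertex, for that vertex would step across and both sides
  -- would lie in the same component. This contradicts `exists_bd_white`.
  by_contra! hcon
  have hdd : dest d = d := h0 d (hm.whiteStep_eq_none.2 (Or.inl hd))
  set c : Finset Pt := (Finset.univ.filter fun w : X.V1 => dest w = d).image Subtype.val with hc
  have hmemc : ∀ w : X.V1, (w : Pt) ∈ c ↔ dest w = d := by
    intro w
    simp [hc]
  have hcB : c ⊆ X.blocks := by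
    intro w hw
    obtain ⟨w, hw', rfl⟩ := Finset.mem_image.1 hw
    rw [Finset.mem_filter] at hw'
    rcases X.mem_V1.1 w.2 with h' | ⟨i, hi⟩
    · exact h'
    · refine absurd ?_ (hcon i)
      rw [← hw'.2]
      congr 1
      exact Subtype.ext hi
  obtain ⟨z, ⟨w, hw, hn, ho⟩, hz2⟩ := hm.exists_bd_white hk hX hcB
    ⟨d, (hmemc d).2 hdd⟩
  have hwB := hcB hw
  obtain ⟨w, rfl⟩ : ∃ w' : X.V1, (w' : Pt) = w := ⟨⟨w, X.blocks_subset_V1 hwB⟩, rfl⟩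
  have hdw := (hmemc w).1 hw
  have hz : z ∈ X.V3 := X.mem_V3.2 ⟨w, hwB, hn⟩
  have hhz := hm.invol z (X.V3_subset_verts hz)
  have hws : X.Sees w z := Or.inl ⟨hwB, hn⟩
  rcases hm.mid hz with ⟨hV, hs⟩ | h'
  swap
  · exact hz2 h'.1
  rcases eq_or_eq_opp_of_isV1 hn hs.near (X.isV1_of_mem w.2) (X.isV1_of_mem hV) with h' | h'
  · rw [h'] at hhz
    rcases hu : X.whiteStep h w with _ | u
    · rw [h0 w hu] at hdw
      rw [hdw] at hhz
      rw [hhz] at hd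
      exact Finset.disjoint_left.1 X.disjoint_V2_V3 hd hz
    · obtain ⟨-, h3, h4⟩ := hm.whiteStep_eq_some.1 hu
      rw [hhz] at h4
      have h5 := (eq_or_eq_opp_of_isV1 hn h4.near (X.isV1_of_mem w.2)
        (X.isV1_of_mem u.2)).resolve_left fun h' => h3 (Subtype.ext h'.symm)
      rw [← h5, hmemc, ← h1 w u hu] at ho
      exact ho hdw
  · have hu : X.whiteStep h ⟨h z, hV⟩ = some w := by
      rw [hm.whiteStep_eq_some]
      simp only [hhz]
      refine ⟨hz, ?_, hws⟩
      rintro rfl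
      exact hn.opp_ne h'.symm
    rw [← h'] at ho
    refine ho ((hmemc ⟨h z, hV⟩).2 ?_)
    rw [h1 _ _ hu, hdw]

end IsMate

end BlockDomain

/-! ### The trees and forests of a dimer covering -/

namespace BlockDomain

variable {k : ℕ} {X : BlockDomain k} {h : Pt → Pt}

/-- The matching `h` consists of the edges in `J`, of an edge from a white vertex for each middle
vertex in `T`, and of an edge from a black vertex for each middle vertex in `S`. -/
structure Represents (X : BlockDomain k) (h : Pt → Pt) (T : Finset X.RootedEdge)
    (S : Finset X.V3) (J : Finset (X.V1 × X.V2)) : Prop where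
  mem_J : ∀ w p, (w, p) ∈ J ↔ h w = p
  mem_S : ∀ z, z ∈ S ↔ h z ∈ X.V2
  mem_T : ∀ z, Sum.inl z ∈ T ↔ h z ∈ X.V1

/-- The `i`-th terminal, as a white vertex. -/
def term (X : BlockDomain k) (i : Fin (2 * k - 1)) : X.V1 := ⟨X.terminal i, X.terminal_mem_V1 i⟩

lemma subtreeOfTerminal_eq (T : Finset X.RootedEdge) (i : Fin (2 * k - 1)) :
    X.subtreeOfTerminal T i = X.subtreeOf T (X.term i) := rfl

lemma treeGraph_reachable_of_cutGraph {T : Finset X.RootedEdge} {u v : X.V1}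
    (huv : (X.cutGraph T).Reachable u v) : (X.treeGraph T).Reachable (some u) (some v) :=
  huv.map ⟨some, fun hab => hab⟩

namespace IsMate

variable (hm : X.IsMate h)
include hm

omit hm in
lemma notMem_V3_of_mem_V2 {v : Pt} (hv : h v ∈ X.V2) : h v ∉ X.V3 :=
  fun h' => Finset.disjoint_left.1 X.disjoint_V2_V3 hv h'

lemma mem_V1_of_mem_V3 {w : Pt} (hw : w ∈ X.V1) : h (h w) ∈ X.V1 := by
  rwa [hm.invol w (X.V1_subset_verts hw)]

lemma mem_V3_or_mem_V1 {p : Pt} (hp : p ∈ X.V2) (hn : h p ∉ X.V3) : h p ∈ X.V1 :=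
  (hm.black hp).elim And.left fun h' => absurd h'.1 hn

section Flow

variable {T : Finset X.RootedEdge} {dest : X.V1 → X.V1} (hd : Drains (X.whiteStep h))
  (h0 : ∀ v, X.whiteStep h v = none → dest v = v)
  (h1 : ∀ v u, X.whiteStep h v = some u → dest v = dest u)
  (h2 : ∀ v, X.whiteStep h (dest v) = none)
  (hT : ∀ z, Sum.inl z ∈ T ↔ h z ∈ X.V1)

include hd h0 h1 hT in
lemma subtreeOf_eq_iff {u v : X.V1} : X.subtreeOf T u = X.subtreeOf T v ↔ dest u = dest v := by
  rw [← (hm.isFlowGraph_white hT).reachable_iff hd h0 h1]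
  exact SimpleGraph.ConnectedComponent.eq

include h0 in
lemma dest_eq_self {w : X.V1} (hw : h w ∈ X.V2) : dest w = w :=
  h0 w (hm.whiteStep_eq_none.2 (Or.inl hw))

-- A boundary vertex is seen by a single white vertex; if it is matched with a white vertex, that
-- one is its partner and the sink of its component.
include hd h0 h1 h2 hT in
lemma hasBoundary_iff {v : X.V1} :
    X.HasBoundary T (X.subtreeOf T v) ↔ X.IsBoundary (h (dest v)) := by
  constructor
  · rintro ⟨z, hz, hzT, u, huv, hadj⟩
    rw [hm.subtreeOf_eq_iff hd h0 h1 hT] at huv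
    rw [hT] at hzT
    rw [X.adj_white_mid (X.isV1_of_mem u.2) (X.isV3_of_mem z.2)] at hadj
    have hs : X.Sees (h z) z := (hm.mid z.2).elim And.right fun h' =>
      absurd (X.isV2_of_mem h'.1) (X.isV1_of_mem hzT).not_isV2
    have huz : (u : Pt) = h z := by
      by_contra hne
      exact X.not_isBoundary_of_sees hadj hs hne hz
    have hhu : h u = z := by rw [huz, hm.invol z (X.V3_subset_verts z.2)]
    rw [← huv, h0 u (hm.whiteStep_eq_none.2 (Or.inr (hhu ▸ hz))), hhu]
    exact hz
  · intro hb
    refine ⟨⟨h (dest v), hb.1⟩, hb, (hT _).2 ?_, dest v, ?_, hm.adj _ (X.V1_subset_verts (dest v).2)⟩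
    · exact hm.mem_V1_of_mem_V3 (dest v).2
    · rw [hm.subtreeOf_eq_iff hd h0 h1 hT, h0 _ (h2 v)]

-- A component drains either to an impurity or to a boundary vertex. In the first case it contains a
-- terminal, and `hT'` puts exactly the edge of the first one into `T`.
include hd h0 h1 h2 hT in
lemma isTITree_iff (hk : 1 ≤ k) (hX : X.IsImpurityDomain)
    (hT' : ∀ i, Sum.inr i ∈ T ↔ h (dest (X.term i)) ∈ X.V2 ∧
      ∀ j, dest (X.term j) = dest (X.term i) → i ≤ j) {v : X.V1} :
    X.IsTITree T (X.subtreeOf T v) ↔ h (dest v) ∈ X.V2 := by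
  classical
  constructor
  · rintro ⟨-, hb⟩
    rw [hm.hasBoundary_iff hd h0 h1 h2 hT] at hb
    exact (hm.whiteStep_eq_none.1 (h2 v)).resolve_right hb
  · intro hv
    refine ⟨?_, fun hb => ?_⟩
    · obtain ⟨i₀, hi₀⟩ := hm.exists_terminal_dest hk hX h0 h1 hv
      obtain ⟨i, hi, hmin⟩ := (Finset.univ.filter fun i => dest (X.term i) = dest v).exists_min_image
        id ⟨i₀, Finset.mem_filter.2 ⟨Finset.mem_univ _, hi₀⟩⟩
      replace hi : dest (X.term i) = dest v := by simpa using hi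
      replace hmin : ∀ j, dest (X.term j) = dest v → i ≤ j := fun j hj => hmin j (by simpa using hj)
      refine ⟨i, ?_, (hT' i).2 ⟨hi ▸ hv, fun j hj => hmin j (hj.trans hi)⟩, fun j hj => ?_⟩
      · rwa [subtreeOfTerminal_eq, hm.subtreeOf_eq_iff hd h0 h1 hT]
      · rw [subtreeOfTerminal_eq, hm.subtreeOf_eq_iff hd h0 h1 hT] at hj
        refine ⟨hmin j hj, fun hjT => le_antisymm ?_ (hmin j hj)⟩
        exact ((hT' j).1 hjT).2 i (hi.trans hj.symm)
    · rw [hm.hasBoundary_iff hd h0 h1 h2 hT] at hb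
      exact notMem_V3_of_mem_V2 hv hb.1

include hd h0 h1 h2 hT in
lemma mem_spanningTrees (hk : 1 ≤ k) (hX : X.IsImpurityDomain)
    (hT' : ∀ i, Sum.inr i ∈ T ↔ h (dest (X.term i)) ∈ X.V2 ∧
      ∀ j, dest (X.term j) = dest (X.term i) → i ≤ j) : T ∈ X.spanningTrees := by
  have hreach : ∀ v : X.V1, (X.treeGraph T).Reachable (some v) none := by
    intro v
    have hvd := treeGraph_reachable_of_cutGraph
      ((hm.isFlowGraph_white hT).reachable_dest hd h0 h1 v)
    rcases hm.whiteStep_eq_none.1 (h2 v) with hv | hv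
    · obtain ⟨⟨i, hi, hiT, -⟩, -⟩ := (hm.isTITree_iff hd h0 h1 h2 hT hk hX hT').2 hv
      have h3 : (X.cutGraph T).Reachable (X.term i) v := SimpleGraph.ConnectedComponent.exact hi
      refine (treeGraph_reachable_of_cutGraph h3).symm.trans (SimpleGraph.Adj.reachable ?_)
      exact ⟨by simp, _, hiT, X.inc_terminal_some.2 rfl, X.inc_terminal_none⟩
    · refine hvd.trans (SimpleGraph.Adj.reachable ?_)
      exact ⟨by simp, Sum.inl ⟨_, hv.1⟩, (hT _).2 (hm.mem_V1_of_mem_V3 (dest v).2),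
        hm.inc_white hv.1, X.inc_mid_none.2 hv⟩
  refine X.twoEnded.isTree_of_card_le ?_ ?_
  · rw [SimpleGraph.connected_iff_exists_forall_reachable]
    refine ⟨none, ?_⟩
    rintro (_ | v)
    · exact SimpleGraph.Reachable.rfl
    · exact (hreach v).symm
  · rw [Fintype.card_option, Fintype.card_coe, Nat.add_le_add_iff_right]
    -- Each edge of `T` is charged to a white vertex: a middle vertex to its partner, a terminal
    -- edge to the impurity of its subtree.
    refine Finset.card_le_card_of_injOn
      (Sum.elim (fun z => h z) fun i => (dest (X.term i) : Pt)) ?_ ?_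
    · rintro (z | i) he
      · exact (hT z).1 he
      · exact (dest (X.term i)).2
    · have key : ∀ z i, Sum.inl z ∈ T → Sum.inr i ∈ T → h z ≠ dest (X.term i) := by
        intro z i hz hi heq
        have h3 := ((hT' i).1 hi).1
        rw [← heq, hm.invol z (X.V3_subset_verts z.2)] at h3
        exact Finset.disjoint_left.1 X.disjoint_V2_V3 h3 z.2
      rintro (z | i) he (z' | i') he' heq
      · simp only [Sum.elim_inl] at heq
        rw [Sum.inl.injEq, Subtype.ext_iff, ← hm.invol z (X.V3_subset_verts z.2), heq,
          hm.invol z' (X.V3_subset_verts z'.2)]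
      · exact absurd heq (key z i' he he')
      · exact absurd heq.symm (key z' i he' he)
      · have h3 : dest (X.term i) = dest (X.term i') := Subtype.ext heq
        rw [le_antisymm (((hT' i).1 he).2 i' h3.symm) (((hT' i').1 he').2 i h3)]

end Flow

/-- The set of impurities of a dimer covering. -/
lemma ncard_white_impurities (hX : X.IsImpurityDomain) : {w : X.V1 | h w ∈ X.V2}.ncard = k := by
  rw [ncard_subtype X.V1 fun w => h w ∈ X.V2]
  exact hm.card_impurities hX

/-- Every dimer covering is represented by a spanning tree and a spanning forest with
condition (Q). -/
lemma exists_represents (hk : 1 ≤ k) (hX : X.IsImpurityDomain) :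
    ∃ T S J, X.Represents h T S J ∧ (T, S, J) ∈ X.forestTriples := by
  classical
  have hd := hm.drains_whiteStep hk hX
  have hdB := hm.drains_blackStep hk hX
  obtain ⟨dest, h0, h1, h2⟩ := hd.exists_dest
  obtain ⟨destB, hB0, hB1, hB2⟩ := hdB.exists_dest
  -- Besides the middle vertices matched with white ones, `T` contains the edge to the root from the
  -- first terminal of each subtree that drains to an impurity.
  set T : Finset X.RootedEdge := Finset.univ.filter (Sum.elim (fun z => h z ∈ X.V1) fun i =>
    h (dest (X.term i)) ∈ X.V2 ∧ ∀ j, dest (X.term j) = dest (X.term i) → i ≤ j) with hTdef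
  set S : Finset X.V3 := Finset.univ.filter fun z => h z ∈ X.V2 with hSdef
  set J : Finset (X.V1 × X.V2) := Finset.univ.filter fun e => h e.1 = e.2 with hJdef
  have hT : ∀ z, Sum.inl z ∈ T ↔ h z ∈ X.V1 := fun z => by simp [hTdef]
  have hT' : ∀ i, Sum.inr i ∈ T ↔ h (dest (X.term i)) ∈ X.V2 ∧
      ∀ j, dest (X.term j) = dest (X.term i) → i ≤ j := fun i => by simp [hTdef]
  have hS : ∀ z, z ∈ S ↔ h z ∈ X.V2 := fun z => by simp [hSdef]
  have hJ : ∀ w p, (w, p) ∈ J ↔ h w = p := fun w p => by simp [hJdef]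
  have hTI := fun {v} => hm.isTITree_iff hd h0 h1 h2 hT hk hX hT' (v := v)
  have hsub := fun {u v} => hm.subtreeOf_eq_iff hd h0 h1 hT (u := u) (v := v)
  have hHB := fun {v} => hm.hasBoundary_iff hd h0 h1 h2 hT (v := v)
  have hself := fun {w} => hm.dest_eq_self h0 (w := w)
  have hflowB := hm.isFlowGraph_black hS
  have hcompB : ∀ p q, (X.forestGraph S).connectedComponentMk p =
      (X.forestGraph S).connectedComponentMk q ↔ destB p = destB q := fun p q => by
    rw [← hflowB.reachable_iff hdB hB0 hB1]
    exact SimpleGraph.ConnectedComponent.eq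
  have htypes : ∀ c, X.IsTITree T c ∨ X.IsTOTree T c ∨ X.IsIOTree T c := by
    intro c
    induction c using SimpleGraph.ConnectedComponent.ind with
    | _ v =>
      change X.IsTITree T (X.subtreeOf T v) ∨ X.IsTOTree T (X.subtreeOf T v) ∨
        X.IsIOTree T (X.subtreeOf T v)
      rcases hm.whiteStep_eq_none.1 (h2 v) with hv | hv
      · exact Or.inl (hTI.2 hv)
      · right
        by_cases ht : ∃ i, X.subtreeOfTerminal T i = X.subtreeOf T v
        · refine Or.inl ⟨ht, fun i hi hiT => ?_, hHB.2 hv⟩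
          rw [subtreeOfTerminal_eq, hsub] at hi
          have h3 := ((hT' i).1 hiT).1
          rw [hi] at h3
          exact notMem_V3_of_mem_V2 h3 hv.1
        · push Not at ht
          exact Or.inr ⟨ht, hHB.2 hv⟩
  refine ⟨T, S, J, ⟨hJ, hS, hT⟩, hm.mem_spanningTrees hd h0 h1 h2 hT hk hX hT',
    hflowB.isAcyclic hdB, ?_⟩
  constructor
  · exact htypes
  · have : {c | X.IsTITree T c} = X.subtreeOf T '' {w : X.V1 | h w ∈ X.V2} := by
      ext c
      induction c using SimpleGraph.ConnectedComponent.ind with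
      | _ v =>
        constructor
        · intro hc
          exact ⟨dest v, hTI.1 hc, hsub.2 (h0 _ (h2 v))⟩
        · rintro ⟨w, hw, hwv⟩
          rw [← hwv]
          exact hTI.2 (by rw [hself hw]; exact hw)
    rw [this, Set.InjOn.ncard_image, hm.ncard_white_impurities hX]
    intro w hw w' hw' he
    rwa [hsub, hself hw, hself hw'] at he
  · have h3 : {i | X.IsTOTree T (X.subtreeOfTerminal T i) ∨
        (X.IsTITree T (X.subtreeOfTerminal T i) ∧ Sum.inr i ∉ T)} = {i | Sum.inr i ∈ T}ᶜ := by
      ext i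
      simp only [Set.mem_ofPred_eq, Set.mem_compl_iff]
      constructor
      · rintro (hc | hc)
        · exact hc.2.1 i rfl
        · exact hc.2
      · intro hi
        rcases htypes (X.subtreeOfTerminal T i) with hc | hc | hc
        · exact Or.inr ⟨hc, hi⟩
        · exact Or.inl hc
        · exact absurd rfl (hc.1 i)
    -- There is one terminal edge for each impurity. The other `2k - 1 - k = k - 1` terminals count
    -- as TO-trees.
    have h4 : {i | Sum.inr i ∈ T}.ncard = k := by
      refine Eq.trans ?_ (hm.ncard_white_impurities hX)
      have : (fun i => dest (X.term i)) '' {i | Sum.inr i ∈ T} = {w : X.V1 | h w ∈ X.V2} := by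
        ext w
        constructor
        · rintro ⟨i, hi, rfl⟩
          exact ((hT' i).1 hi).1
        · intro hw
          have hc : X.IsTITree T (X.subtreeOf T w) := hTI.2 (by rw [hself hw]; exact hw)
          obtain ⟨⟨i, hi, hiT, -⟩, -⟩ := hc
          rw [subtreeOfTerminal_eq, hsub, hself hw] at hi
          exact ⟨i, hiT, hi⟩
      rw [← this, Set.InjOn.ncard_image]
      intro i hi j hj hij
      exact le_antisymm (((hT' i).1 hi).2 j hij.symm) (((hT' j).1 hj).2 i hij)
    rw [numTO, h3, Set.ncard_compl, h4, Nat.card_eq_fintype_card, Fintype.card_fin]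
    omega
  · rw [hflowB.card_components hdB]
    simp only [blackStep_eq_none]
    rw [ncard_subtype X.V2 fun p => h p ∉ X.V3]
    refine Eq.trans ?_ (hm.card_impurities hX)
    rw [hm.card_filter_comm X.V1_subset_verts X.V2_subset_verts]
    congr 1
    refine Finset.filter_congr fun p hp => ⟨hm.mem_V3_or_mem_V1 hp, fun h3 h4 => ?_⟩
    exact Finset.disjoint_left.1 X.disjoint_V1_V3 h3 h4
  · intro z hz hzT
    exact Finset.disjoint_left.1 X.disjoint_V1_V2 ((hT z).1 hzT) ((hS z).1 hz)
  · refine Eq.trans ?_ (hm.ncard_white_impurities hX)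
    rw [← Set.ncard_coe_finset]
    have : Prod.fst '' (J : Set (X.V1 × X.V2)) = {w : X.V1 | h w ∈ X.V2} := by
      ext w
      constructor
      · rintro ⟨⟨w, p⟩, he, rfl⟩
        change h w ∈ X.V2
        rw [(hJ w p).1 he]
        exact p.2
      · intro hw
        exact ⟨(w, ⟨h w, hw⟩), (hJ _ _).2 rfl, rfl⟩
    rw [← this, Set.InjOn.ncard_image]
    rintro ⟨w, p⟩ he ⟨w', p'⟩ he' heq
    obtain rfl : w = w' := heq
    have h3 := (hJ _ _).1 he
    have h4 := (hJ _ _).1 he'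
    rw [h3] at h4
    rw [Subtype.ext h4]
  · rintro ⟨w, p⟩ he
    rw [hJ] at he
    simp only [← he]
    exact hm.adj _ (X.V1_subset_verts w.2)
  · rintro ⟨w, p⟩ he
    rw [hJ] at he
    have hw : h w ∈ X.V2 := he ▸ p.2
    exact hTI.2 (by rw [hself hw]; exact hw)
  · intro c hc
    induction c using SimpleGraph.ConnectedComponent.ind with
    | _ v =>
      have hv := hTI.1 hc
      refine ⟨(dest v, ⟨h (dest v), hv⟩), ⟨(hJ _ _).2 rfl, hsub.2 (h0 _ (h2 v))⟩, ?_⟩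
      rintro ⟨w, p⟩ ⟨he, hwv⟩
      rw [hJ] at he
      have hw : h w ∈ X.V2 := he ▸ p.2
      have hwd : w = dest v := by
        have := hsub.1 hwv
        rwa [hself hw] at this
      subst hwd
      exact Prod.ext rfl (Subtype.ext he.symm)
  · intro s
    induction s using SimpleGraph.ConnectedComponent.ind with
    | _ p =>
      have hd1 : h (destB p) ∈ X.V1 :=
        hm.mem_V3_or_mem_V1 (destB p).2 (blackStep_eq_none.1 (hB2 p))
      refine ⟨(⟨h (destB p), hd1⟩, destB p), ⟨(hJ _ _).2 ?_, ?_⟩, ?_⟩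
      · exact hm.invol _ (X.V2_subset_verts (destB p).2)
      · rw [hcompB, hB0 _ (hB2 p)]
      · rintro ⟨w, q⟩ ⟨he, hqp⟩
        rw [hJ] at he
        have hq : h q = w := by rw [← he, hm.invol _ (X.V1_subset_verts w.2)]
        have hqn : X.blackStep h q = none := by
          rw [blackStep_eq_none, hq]
          exact fun h' => Finset.disjoint_left.1 X.disjoint_V1_V3 w.2 h'
        rw [hcompB, hB0 q hqn] at hqp
        subst hqp
        exact Prod.ext (Subtype.ext hq.symm) rfl

/-- A dimer covering is determined by the middle vertices and impurities which it matches with white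
vertices. -/
lemma eqOn_white {h' : Pt → Pt} (hm' : X.IsMate h') (hk : 1 ≤ k) (hX : X.IsImpurityDomain)
    (hV3 : ∀ z ∈ X.V3, h' z ∈ X.V1 → h z ∈ X.V1)
    (hV2 : ∀ w ∈ X.V1, h' w ∈ X.V2 → h w = h' w) : ∀ w ∈ X.V1, h w = h' w := by
  classical
  by_contra! hcon
  obtain ⟨w₀, hw₀, hne₀⟩ := hcon
  obtain ⟨rank, hr⟩ := (hm.drains_whiteStep hk hX).exists_rank
  -- At a disagreement `w` of greatest rank, `h'` matches `w` with a middle vertex that `h` matches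
  -- with another white vertex. The latter steps to `w`, so its rank is greater and the maps agree
  -- there, which is impossible.
  obtain ⟨w, hw, hmax⟩ := (Finset.univ.filter fun w : X.V1 => h w ≠ h' w).exists_max_image rank
    ⟨⟨w₀, hw₀⟩, by simpa using hne₀⟩
  replace hw : h w ≠ h' w := by simpa using hw
  rcases hm'.white w.2 with h3 | ⟨h3, h4⟩
  · exact hw (hV2 w w.2 h3)
  have h5 := hm'.invol w (X.V1_subset_verts w.2)
  have h6 : h (h' w) ∈ X.V1 := hV3 _ h3 (by rw [h5]; exact w.2)
  have h7 := hm.invol _ (X.V3_subset_verts h3)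
  have hne : h (h' w) ≠ w := fun h8 => hw (by rw [h8] at h7; exact h7)
  have hs : X.whiteStep h ⟨h (h' w), h6⟩ = some w := by
    rw [hm.whiteStep_eq_some]
    simp only [h7]
    exact ⟨h3, fun h8 => hne (congrArg Subtype.val h8), h4⟩
  have h8 : h (h (h' w)) = h' (h (h' w)) := by
    by_contra h9
    exact absurd (hr _ _ hs) (not_lt.2 (hmax _ (by simpa using h9)))
  rw [h7] at h8
  refine hne ?_
  rw [← hm'.invol _ (X.V1_subset_verts h6), ← h8, h5]

lemma eqOn_black {h' : Pt → Pt} (hm' : X.IsMate h') (hk : 1 ≤ k) (hX : X.IsImpurityDomain)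
    (hV3 : ∀ z ∈ X.V3, h' z ∈ X.V2 → h z ∈ X.V2)
    (hV2 : ∀ p ∈ X.V2, h' p ∈ X.V1 → h p = h' p) : ∀ p ∈ X.V2, h p = h' p := by
  classical
  by_contra! hcon
  obtain ⟨w₀, hw₀, hne₀⟩ := hcon
  obtain ⟨rank, hr⟩ := (hm.drains_blackStep hk hX).exists_rank
  obtain ⟨w, hw, hmax⟩ := (Finset.univ.filter fun w : X.V2 => h w ≠ h' w).exists_max_image rank
    ⟨⟨w₀, hw₀⟩, by simpa using hne₀⟩
  replace hw : h w ≠ h' w := by simpa using hw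
  rcases hm'.black w.2 with h3 | ⟨h3, h4⟩
  · exact hw (hV2 w w.2 h3.1)
  have h5 := hm'.invol w (X.V2_subset_verts w.2)
  have h6 : h (h' w) ∈ X.V2 := hV3 _ h3 (by rw [h5]; exact w.2)
  have h7 := hm.invol _ (X.V3_subset_verts h3)
  have hne : h (h' w) ≠ w := fun h8 => hw (by rw [h8] at h7; exact h7)
  have hs : X.blackStep h ⟨h (h' w), h6⟩ = some w := by
    rw [hm.blackStep_eq_some]
    simp only [h7]
    exact ⟨h3, fun h8 => hne (congrArg Subtype.val h8), h4⟩
  have h8 : h (h (h' w)) = h' (h (h' w)) := by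
    by_contra h9
    exact absurd (hr _ _ hs) (not_lt.2 (hmax _ (by simpa using h9)))
  rw [h7] at h8
  refine hne ?_
  rw [← hm'.invol _ (X.V2_subset_verts h6), ← h8, h5]

lemma mem_V2_iff_of_mem_V3 {z : Pt} (hz : z ∈ X.V3) : h z ∈ X.V2 ↔ h z ∉ X.V1 := by
  constructor
  · exact fun h1 h2 => Finset.disjoint_left.1 X.disjoint_V1_V2 h2 h1
  · exact fun h1 => ((hm.mid hz).resolve_left fun h' => h1 h'.1).1

/-- A dimer covering is determined by its tree and its impurities. -/
lemma eqOn_of_represents {h' : Pt → Pt} (hm' : X.IsMate h') (hk : 1 ≤ k) (hX : X.IsImpurityDomain)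
    {T : Finset X.RootedEdge} {S S' : Finset X.V3} {J : Finset (X.V1 × X.V2)}
    (hr : X.Represents h T S J) (hr' : X.Represents h' T S' J) : ∀ v ∈ X.verts, h v = h' v := by
  have hV3 : ∀ z ∈ X.V3, h' z ∈ X.V1 ↔ h z ∈ X.V1 := fun z hz =>
    (hr'.mem_T ⟨z, hz⟩).symm.trans (hr.mem_T ⟨z, hz⟩)
  have hw := hm.eqOn_white hm' hk hX (fun z hz => (hV3 z hz).1) fun w hw hp =>
    (hr.mem_J ⟨w, hw⟩ ⟨h' w, hp⟩).1 ((hr'.mem_J ⟨w, hw⟩ ⟨h' w, hp⟩).2 rfl)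
  have hb := hm.eqOn_black hm' hk hX
    (fun z hz => by rw [hm.mem_V2_iff_of_mem_V3 hz, hm'.mem_V2_iff_of_mem_V3 hz, hV3 z hz]; exact id)
    fun p hp h1 => by
      have h2 := hw _ h1
      rw [hm'.invol p (X.V2_subset_verts hp)] at h2
      rw [← h2, hm.invol _ (X.V1_subset_verts h1), h2]
  intro v hv
  rcases X.verts_cases hv with h1 | h1 | h1
  · exact hw v h1
  · exact hb v h1
  · have h3 : h (h v) = h' (h v) := by
      rcases hm.mid h1 with h2 | h2
      · exact hw _ h2.1
      · exact hb _ h2.1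
    rw [hm.invol v hv] at h3
    have h4 : h v ∈ X.verts := hm.mem_verts hv
    rw [← hm'.invol _ h4, ← h3]

end IsMate

end BlockDomain

/-! ### The dimer covering of a tree and a forest -/

namespace BlockDomain

variable {k : ℕ} {X : BlockDomain k} {h : Pt → Pt}

/-- A matching of `G` is obtained from impurities and from matchings of the other white and black
vertices with the middle vertices. -/
lemma exists_isMate_of_maps {J : Finset (X.V1 × X.V2)} {F : X.V1 → X.V3} {H : X.V2 → X.V3}
    (hadj : ∀ e ∈ J, X.graph.Adj e.1 e.2)
    (hJ1 : ∀ w p p', (w, p) ∈ J → (w, p') ∈ J → p = p')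
    (hJ2 : ∀ w w' p, (w, p) ∈ J → (w', p) ∈ J → w = w')
    (hF : ∀ w, (∀ p, (w, p) ∉ J) → X.Sees w (F w))
    (hH : ∀ p, (∀ w, (w, p) ∉ J) → Near p (H p))
    (hF' : ∀ w w', (∀ p, (w, p) ∉ J) → (∀ p, (w', p) ∉ J) → F w = F w' → w = w')
    (hH' : ∀ p p', (∀ w, (w, p) ∉ J) → (∀ w, (w, p') ∉ J) → H p = H p' → p = p')
    (hFH : ∀ w p, (∀ p, (w, p) ∉ J) → (∀ w, (w, p) ∉ J) → F w ≠ H p)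
    (hsurj : ∀ z, (∃ w, (∀ p, (w, p) ∉ J) ∧ F w = z) ∨ ∃ p, (∀ w, (w, p) ∉ J) ∧ H p = z) :
    ∃ h, X.IsMate h ∧ (∀ w p, (w, p) ∈ J ↔ h w = p) ∧
      ∀ z : X.V3, (∃ w : X.V1, (∀ p, (w, p) ∉ J) ∧ F w = z ∧ h z = w) ∨
        ∃ p : X.V2, (∀ w, (w, p) ∉ J) ∧ H p = z ∧ h z = p := by
  classical
  have ha : ∀ w : X.V1, ∃ v : Pt, (∃ p : X.V2, (w, p) ∈ J ∧ v = p) ∨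
      ((∀ p, (w, p) ∉ J) ∧ v = F w) := by
    intro w
    by_cases hw : ∃ p, (w, p) ∈ J
    · obtain ⟨p, hp⟩ := hw
      exact ⟨p, Or.inl ⟨p, hp, rfl⟩⟩
    · push Not at hw
      exact ⟨F w, Or.inr ⟨hw, rfl⟩⟩
  have hb : ∀ p : X.V2, ∃ v : Pt, (∃ w : X.V1, (w, p) ∈ J ∧ v = w) ∨
      ((∀ w, (w, p) ∉ J) ∧ v = H p) := by
    intro p
    by_cases hp : ∃ w, (w, p) ∈ J
    · obtain ⟨w, hw⟩ := hp
      exact ⟨w, Or.inl ⟨w, hw, rfl⟩⟩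
    · push Not at hp
      exact ⟨H p, Or.inr ⟨hp, rfl⟩⟩
  have hc : ∀ z : X.V3, ∃ v : Pt, (∃ w : X.V1, (∀ p, (w, p) ∉ J) ∧ F w = z ∧ v = w) ∨
      ∃ p : X.V2, (∀ w, (w, p) ∉ J) ∧ H p = z ∧ v = p := by
    intro z
    rcases hsurj z with ⟨w, h1, h2⟩ | ⟨p, h1, h2⟩
    · exact ⟨w, Or.inl ⟨w, h1, h2, rfl⟩⟩
    · exact ⟨p, Or.inr ⟨p, h1, h2, rfl⟩⟩
  choose a ha using ha
  choose b hb using hb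
  choose c hc using hc
  set h : Pt → Pt := fun v => if h1 : v ∈ X.V1 then a ⟨v, h1⟩ else
    if h2 : v ∈ X.V2 then b ⟨v, h2⟩ else if h3 : v ∈ X.V3 then c ⟨v, h3⟩ else v with hh
  have hw : ∀ w : X.V1, h w = a w := fun w => by simp [hh]
  have hp : ∀ p : X.V2, h p = b p := fun p => by
    have h1 : (p : Pt) ∉ X.V1 := fun h' => Finset.disjoint_left.1 X.disjoint_V1_V2 h' p.2
    simp [hh, h1]
  have hz : ∀ z : X.V3, h z = c z := fun z => by
    have h1 : (z : Pt) ∉ X.V1 := fun h' => Finset.disjoint_left.1 X.disjoint_V1_V3 h' z.2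
    have h2 : (z : Pt) ∉ X.V2 := fun h' => Finset.disjoint_left.1 X.disjoint_V2_V3 h' z.2
    simp [hh, h1, h2]
  have haJ : ∀ w p, (w, p) ∈ J → a w = p := by
    intro w p hwp
    rcases ha w with ⟨q, h1, h2⟩ | ⟨h1, -⟩
    · rw [h2, hJ1 w q p h1 hwp]
    · exact absurd hwp (h1 p)
  have hbJ : ∀ w p, (w, p) ∈ J → b p = w := by
    intro w p hwp
    rcases hb p with ⟨q, h1, h2⟩ | ⟨h1, -⟩
    · rw [h2, hJ2 q w p h1 hwp]
    · exact absurd hwp (h1 w)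
  have haF : ∀ w, (∀ p, (w, p) ∉ J) → a w = F w := by
    intro w hwJ
    rcases ha w with ⟨q, h1, -⟩ | ⟨-, h2⟩
    · exact absurd h1 (hwJ q)
    · exact h2
  have hbH : ∀ p, (∀ w, (w, p) ∉ J) → b p = H p := by
    intro p hpJ
    rcases hb p with ⟨q, h1, -⟩ | ⟨-, h2⟩
    · exact absurd h1 (hpJ q)
    · exact h2
  have hcF : ∀ w, (∀ p, (w, p) ∉ J) → c (F w) = w := by
    intro w hwJ
    rcases hc (F w) with ⟨u, h1, h2, h3⟩ | ⟨p, h1, h2, -⟩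
    · rw [h3, hF' u w h1 hwJ h2]
    · exact absurd h2.symm (hFH w p hwJ h1)
  have hcH : ∀ p, (∀ w, (w, p) ∉ J) → c (H p) = p := by
    intro p hpJ
    rcases hc (H p) with ⟨u, h1, h2, -⟩ | ⟨q, h1, h2, h3⟩
    · exact absurd h2 (hFH u p h1 hpJ)
    · rw [h3, hH' q p h1 hpJ h2]
  have hadjF : ∀ w, (∀ p, (w, p) ∉ J) → X.graph.Adj w (F w) := fun w hwJ =>
    (X.adj_white_mid (X.isV1_of_mem w.2) (X.isV3_of_mem (F w).2)).2 (hF w hwJ)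
  have hadjH : ∀ p, (∀ w, (w, p) ∉ J) → X.graph.Adj p (H p) := fun p hpJ =>
    (X.adj_black_mid (X.isV2_of_mem p.2) (H p).2).2 (hH p hpJ)
  have key : ∀ v ∈ X.verts, h (h v) = v ∧ X.graph.Adj v (h v) := by
    intro v hv
    rcases X.verts_cases hv with h1 | h1 | h1
    · obtain ⟨w, rfl⟩ : ∃ w : X.V1, (w : Pt) = v := ⟨⟨v, h1⟩, rfl⟩
      rw [hw]
      rcases ha w with ⟨p, h2, h3⟩ | ⟨h2, h3⟩
      · rw [h3, hp, hbJ w p h2]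
        exact ⟨rfl, hadj _ h2⟩
      · rw [h3, hz, hcF w h2]
        exact ⟨rfl, hadjF w h2⟩
    · obtain ⟨p, rfl⟩ : ∃ p : X.V2, (p : Pt) = v := ⟨⟨v, h1⟩, rfl⟩
      rw [hp]
      rcases hb p with ⟨w, h2, h3⟩ | ⟨h2, h3⟩
      · rw [h3, hw, haJ w p h2]
        exact ⟨rfl, (hadj _ h2).symm⟩
      · rw [h3, hz, hcH p h2]
        exact ⟨rfl, hadjH p h2⟩
    · obtain ⟨z, rfl⟩ : ∃ z : X.V3, (z : Pt) = v := ⟨⟨v, h1⟩, rfl⟩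
      rw [hz]
      rcases hc z with ⟨w, h2, h3, h4⟩ | ⟨p, h2, h3, h4⟩
      · rw [h4, hw, haF w h2, h3]
        exact ⟨rfl, h3 ▸ (hadjF w h2).symm⟩
      · rw [h4, hp, hbH p h2, h3]
        exact ⟨rfl, h3 ▸ (hadjH p h2).symm⟩
  refine ⟨h, ⟨fun v hv => (key v hv).1, fun v hv => (key v hv).2⟩, fun w p => ?_, fun z => ?_⟩
  · rw [hw]
    refine ⟨haJ w p, fun he => ?_⟩
    rcases ha w with ⟨q, h1, h2⟩ | ⟨-, h2⟩
    · rwa [← show q = p from Subtype.ext (h2.symm.trans he)]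
    · have h3 : (F w : Pt) ∈ X.V2 := by rw [← h2, he]; exact p.2
      exact absurd (F w).2 (Finset.disjoint_left.1 X.disjoint_V2_V3 h3)
  · rw [hz]
    exact hc z

lemma CondQ.white_unique {T : Finset X.RootedEdge} {S : Finset X.V3} {J : Finset (X.V1 × X.V2)}
    (hq : X.CondQ T S J) {e e' : X.V1 × X.V2} (he : e ∈ J) (he' : e' ∈ J)
    (h1 : X.subtreeOf T e.1 = X.subtreeOf T e'.1) : e = e' :=
  (hq.pair_TI _ (hq.mem_TI e' he')).unique ⟨he, h1⟩ ⟨he', rfl⟩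

lemma CondQ.black_unique {T : Finset X.RootedEdge} {S : Finset X.V3} {J : Finset (X.V1 × X.V2)}
    (hq : X.CondQ T S J) {e e' : X.V1 × X.V2} (he : e ∈ J) (he' : e' ∈ J)
    (h1 : (X.forestGraph S).connectedComponentMk e.2 = (X.forestGraph S).connectedComponentMk e'.2) :
    e = e' :=
  (hq.pair_forest _).unique ⟨he, h1⟩ ⟨he', rfl⟩

/-- Every tree and forest with condition (Q) represent a dimer covering. -/
lemma exists_isMate_of_condQ (hX : X.IsImpurityDomain) {T : Finset X.RootedEdge} {S : Finset X.V3}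
    {J : Finset (X.V1 × X.V2)} (hq : X.CondQ T S J) : ∃ h, X.IsMate h ∧ X.Represents h T S J := by
  classical
  have hJ1 : ∀ w p p', (w, p) ∈ J → (w, p') ∈ J → p = p' := fun w p p' h1 h2 =>
    congrArg Prod.snd (hq.white_unique h1 h2 rfl)
  have hJ2 : ∀ w w' p, (w, p) ∈ J → (w', p) ∈ J → w = w' := fun w w' p h1 h2 =>
    congrArg Prod.fst (hq.black_unique h1 h2 rfl)
  -- Terminal edges are dropped: each white vertex is to flow through middle vertices, either to the
  -- root or to the impurity of its TI-tree.
  set T' : Finset X.RootedEdge := T.filter fun e => e.isLeft with hT'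
  have hcut : ∀ {u v : X.V1}, X.subtreeOf T u = X.subtreeOf T v →
      (edgeGraph X.Inc T').Reachable (some u) (some v) := by
    intro u v huv
    refine (SimpleGraph.ConnectedComponent.exact huv).map ⟨some, fun {a b} hab => ?_⟩
    obtain ⟨hne, e, he, h1, h2⟩ := hab
    refine ⟨hne, e, ?_, h1, h2⟩
    rcases e with z | i
    · exact Finset.mem_filter.2 ⟨he, rfl⟩
    · rw [inc_terminal_some] at h1 h2
      exact absurd (congrArg some (Subtype.ext (h1.trans h2.symm))) hne
  obtain ⟨f, d, hf⟩ := X.twoEnded.exists_descent T'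
    (fun x => x = none ∨ ∃ w p, x = some w ∧ (w, p) ∈ J) (by
      rintro (_ | v)
      · exact ⟨none, Or.inl rfl, SimpleGraph.Reachable.rfl⟩
      have hb : X.HasBoundary T (X.subtreeOf T v) → ∃ r, (r = none ∨
          ∃ w p, r = some w ∧ (w, p) ∈ J) ∧ (edgeGraph X.Inc T').Reachable (some v) r := by
        rintro ⟨z, hz, hzT, u, hu, hadj⟩
        refine ⟨none, Or.inl rfl, (hcut hu.symm).trans (SimpleGraph.Adj.reachable ?_)⟩
        rw [X.adj_white_mid (X.isV1_of_mem u.2) (X.isV3_of_mem z.2)] at hadj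
        exact ⟨by simp, Sum.inl z, Finset.mem_filter.2 ⟨hzT, rfl⟩, X.inc_mid_some.2 hadj,
          X.inc_mid_none.2 hz⟩
      rcases hq.types (X.subtreeOf T v) with hc | hc | hc
      · obtain ⟨⟨w, p⟩, ⟨he, hev⟩, -⟩ := hq.pair_TI _ hc
        exact ⟨some w, Or.inr ⟨w, p, rfl, he⟩, hcut hev.symm⟩
      · exact hb hc.2.2
      · exact hb hc.2)
  obtain ⟨g, d', hg⟩ := X.blackTwoEnded.exists_descent S (fun p => ∃ w, (w, p) ∈ J) (by
    intro p
    obtain ⟨⟨w, q⟩, ⟨he, heq⟩, -⟩ := hq.pair_forest ((X.forestGraph S).connectedComponentMk p)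
    refine ⟨q, ⟨w, he⟩, ?_⟩
    rw [← forestGraph_eq]
    exact SimpleGraph.ConnectedComponent.exact heq.symm)
  have hF : ∀ w : X.V1, ∃ z : X.V3, (∀ p, (w, p) ∉ J) → Sum.inl z ∈ T ∧ X.Sees w z ∧
      d (X.oth (Sum.inl z) (some w)) < d (some w) := by
    intro w
    by_cases hw : ∀ p, (w, p) ∉ J
    · obtain ⟨h1, h2, h3⟩ := hf ⟨some w, by
        rintro (h' | ⟨w', p, h', hp⟩)
        · simp at h'
        · exact hw p (Option.some.inj h' ▸ hp)⟩
      rcases hfe : f ⟨some w, _⟩ with z | i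
      · rw [hfe] at h1 h2 h3
        exact ⟨z, fun _ => ⟨(Finset.mem_filter.1 h1).1, X.inc_mid_some.1 h2, h3⟩⟩
      · rw [hfe] at h1
        exact absurd (Finset.mem_filter.1 h1).2 (by simp)
    · push Not at hw
      obtain ⟨p, hp⟩ := hw
      have ⟨z, hz, _⟩ := (X.adj_white_black (X.isV1_of_mem w.2) (X.isV2_of_mem p.2)).1
        (hq.adj _ hp)
      exact ⟨⟨z, hz.mem_V3⟩, fun h' => absurd hp (h' p)⟩
  have hH : ∀ p : X.V2, ∃ z : X.V3, (∀ w, (w, p) ∉ J) → z ∈ S ∧ X.BlackInc z p ∧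
      d' (X.blackOth z p) < d' p := by
    intro p
    by_cases hp : ∀ w, (w, p) ∉ J
    · exact ⟨g ⟨p, by push Not; exact hp⟩, fun _ => hg _⟩
    · push Not at hp
      obtain ⟨w, hw⟩ := hp
      have ⟨z, hz, _⟩ := (X.adj_white_black (X.isV1_of_mem w.2) (X.isV2_of_mem p.2)).1
        (hq.adj _ hw)
      exact ⟨⟨z, hz.mem_V3⟩, fun h' => absurd hw (h' w)⟩
  choose F hF using hF
  choose H hH using hH
  have hF' : ∀ w w', (∀ p, (w, p) ∉ J) → (∀ p, (w', p) ∉ J) → F w = F w' → w = w' := by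
    intro w w' hw hw' he
    obtain ⟨-, h1, h2⟩ := hF w hw
    obtain ⟨-, h3, h4⟩ := hF w' hw'
    rw [← he] at h3 h4
    exact Option.some.inj
      (X.twoEnded.eq_of_descent (X.inc_mid_some.2 h1) h2 (X.inc_mid_some.2 h3) h4)
  have hH' : ∀ p p', (∀ w, (w, p) ∉ J) → (∀ w, (w, p') ∉ J) → H p = H p' → p = p' := by
    intro p p' hp hp' he
    obtain ⟨-, h1, h2⟩ := hH p hp
    obtain ⟨-, h3, h4⟩ := hH p' hp'
    rw [← he] at h3 h4
    exact X.blackTwoEnded.eq_of_descent h1 h2 h3 h4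
  have hFH : ∀ w p, (∀ p, (w, p) ∉ J) → (∀ w, (w, p) ∉ J) → F w ≠ H p := by
    intro w p hw hp he
    exact hq.disjoint _ (hH p hp).1 (he ▸ (hF w hw).1)
  -- Injectivity suffices by counting: the white and black vertices without impurities number `|V1|
  -- - k + |V2| - k = |V3|`.
  have hsurj : ∀ z, (∃ w, (∀ p, (w, p) ∉ J) ∧ F w = z) ∨
      ∃ p, (∀ w, (w, p) ∉ J) ∧ H p = z := by
    set A : Finset X.V1 := J.image Prod.fst with hA
    set B : Finset X.V2 := J.image Prod.snd with hB
    have hAmem : ∀ w, w ∈ Aᶜ ↔ ∀ p, (w, p) ∉ J := fun w => by simp [hA]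
    have hBmem : ∀ p, p ∈ Bᶜ ↔ ∀ w, (w, p) ∉ J := fun p => by simp [hB]
    have hAc : A.card = k := by
      rw [hA, Finset.card_image_of_injOn, hq.card_impurities]
      rintro ⟨w, p⟩ h1 ⟨w', p'⟩ h2 h3
      obtain rfl : w = w' := h3
      rw [hJ1 w p p' h1 h2]
    have hBc : B.card = k := by
      rw [hB, Finset.card_image_of_injOn, hq.card_impurities]
      rintro ⟨w, p⟩ h1 ⟨w', p'⟩ h2 h3
      obtain rfl : p = p' := h3
      rw [hJ2 w w' p h1 h2]
    have hcard : (Aᶜ.image F ∪ Bᶜ.image H).card = Fintype.card X.V3 := by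
      rw [Finset.card_union_of_disjoint, Finset.card_image_of_injOn, Finset.card_image_of_injOn,
        Finset.card_compl, Finset.card_compl, Fintype.card_coe, Fintype.card_coe, Fintype.card_coe]
      · have h1 : A.card ≤ X.V1.card := by simpa using A.card_le_univ
        have h2 : B.card ≤ X.V2.card := by simpa using B.card_le_univ
        have := hX.impurity_count
        omega
      · exact fun p hp p' hp' => hH' p p' ((hBmem p).1 hp) ((hBmem p').1 hp')
      · exact fun w hw w' hw' => hF' w w' ((hAmem w).1 hw) ((hAmem w').1 hw')
      · rw [Finset.disjoint_left]
        intro z hz hz'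
        obtain ⟨w, hw, rfl⟩ := Finset.mem_image.1 hz
        obtain ⟨p, hp, he⟩ := Finset.mem_image.1 hz'
        exact hFH w p ((hAmem w).1 hw) ((hBmem p).1 hp) he.symm
    have huniv := (Finset.card_eq_iff_eq_univ _).1 hcard
    intro z
    have hz := Finset.mem_univ z
    rw [← huniv, Finset.mem_union, Finset.mem_image, Finset.mem_image] at hz
    refine hz.imp ?_ ?_
    · rintro ⟨w, hw, h1⟩
      exact ⟨w, (hAmem w).1 hw, h1⟩
    · rintro ⟨p, hp, h1⟩
      exact ⟨p, (hBmem p).1 hp, h1⟩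
  obtain ⟨h, hm, hJ, hz⟩ := exists_isMate_of_maps hq.adj hJ1 hJ2 (fun w hw => (hF w hw).2.1)
    (fun p hp => X.blackInc_iff.1 (hH p hp).2.1) hF' hH' hFH hsurj
  refine ⟨h, hm, hJ, fun z => ?_, fun z => ?_⟩
  · rcases hz z with ⟨w, h1, h2, h3⟩ | ⟨p, h1, h2, h3⟩
    · refine iff_of_false (fun hzS => hq.disjoint z hzS (h2 ▸ (hF w h1).1)) ?_
      rw [h3]
      exact fun h' => Finset.disjoint_left.1 X.disjoint_V1_V2 w.2 h'
    · exact iff_of_true (h2 ▸ (hH p h1).1) (by rw [h3]; exact p.2)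
  · rcases hz z with ⟨w, h1, h2, h3⟩ | ⟨p, h1, h2, h3⟩
    · exact iff_of_true (h2 ▸ (hF w h1).1) (by rw [h3]; exact w.2)
    · refine iff_of_false (fun hzT => hq.disjoint z (h2 ▸ (hH p h1).1) hzT) ?_
      rw [h3]
      exact fun h' => Finset.disjoint_left.1 X.disjoint_V1_V2 h' p.2

/-- The terminal edges of `T` can be recovered from the subtrees and the impurities, so nothing is
lost when a covering forgets them. -/
lemma CondQ.mem_terminal_iff {T : Finset X.RootedEdge} {S : Finset X.V3}
    {J : Finset (X.V1 × X.V2)} (hq : X.CondQ T S J) (i : Fin (2 * k - 1)) :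
    Sum.inr i ∈ T ↔ (∃ e ∈ J, X.subtreeOf T e.1 = X.subtreeOf T (X.term i)) ∧
      ∀ j, X.subtreeOf T (X.term j) = X.subtreeOf T (X.term i) → i ≤ j := by
  have hTI : (∃ e ∈ J, X.subtreeOf T e.1 = X.subtreeOf T (X.term i)) ↔
      X.IsTITree T (X.subtreeOfTerminal T i) := by
    constructor
    · rintro ⟨e, he, h1⟩
      rw [subtreeOfTerminal_eq, ← h1]
      exact hq.mem_TI e he
    · intro hc
      obtain ⟨e, ⟨he, h1⟩, -⟩ := hq.pair_TI _ hc
      exact ⟨e, he, h1⟩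
  rw [hTI]
  constructor
  · intro hi
    have hc : X.IsTITree T (X.subtreeOfTerminal T i) := by
      rcases hq.types (X.subtreeOfTerminal T i) with hc | hc | hc
      · exact hc
      · exact absurd hi (hc.2.1 i rfl)
      · exact absurd rfl (hc.1 i)
    refine ⟨hc, fun j hj => ?_⟩
    obtain ⟨⟨i', -, -, h3⟩, -⟩ := hc
    rw [(h3 i rfl).2 hi]
    exact (h3 j hj).1
  · rintro ⟨⟨⟨i', h1, h2, h3⟩, -⟩, h4⟩
    rwa [le_antisymm (h4 i' h1) (h3 i rfl).1]

lemma cutGraph_congr {T T' : Finset X.RootedEdge} (hT : ∀ z, Sum.inl z ∈ T ↔ Sum.inl z ∈ T') :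
    X.cutGraph T = X.cutGraph T' := by
  have key : ∀ {T T' : Finset X.RootedEdge}, (∀ z, Sum.inl z ∈ T ↔ Sum.inl z ∈ T') →
      X.cutGraph T ≤ X.cutGraph T' := by
    rintro T T' hT u v ⟨hne, e, he, h1, h2⟩
    refine ⟨hne, e, ?_, h1, h2⟩
    rcases e with z | i
    · exact (hT z).1 he
    · rw [inc_terminal_some] at h1 h2
      exact absurd (congrArg some (Subtype.ext (h1.trans h2.symm))) hne
  exact le_antisymm (key hT) (key fun z => (hT z).symm)

/-- The tree, forest and impurities are determined by the dimer covering. -/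
lemma Represents.unique {T T' : Finset X.RootedEdge} {S S' : Finset X.V3}
    {J J' : Finset (X.V1 × X.V2)} (hr : X.Represents h T S J) (hr' : X.Represents h T' S' J')
    (hq : X.CondQ T S J) (hq' : X.CondQ T' S' J') : T = T' ∧ S = S' ∧ J = J' := by
  have hJ : J = J' := by
    ext ⟨w, p⟩
    rw [hr.mem_J, hr'.mem_J]
  have hS : S = S' := by
    ext z
    rw [hr.mem_S, hr'.mem_S]
  have hT : ∀ z, Sum.inl z ∈ T ↔ Sum.inl z ∈ T' := fun z => by rw [hr.mem_T, hr'.mem_T]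
  have hsub : ∀ u v, X.subtreeOf T u = X.subtreeOf T v ↔ X.subtreeOf T' u = X.subtreeOf T' v := by
    intro u v
    unfold subtreeOf
    rw [SimpleGraph.ConnectedComponent.eq, SimpleGraph.ConnectedComponent.eq, cutGraph_congr hT]
  refine ⟨?_, hS, hJ⟩
  ext e
  rcases e with z | i
  · exact hT z
  · rw [hq.mem_terminal_iff, hq'.mem_terminal_iff]
    simp only [hsub, hJ]

lemma Represents.congr {h' : Pt → Pt} {T : Finset X.RootedEdge} {S : Finset X.V3}
    {J : Finset (X.V1 × X.V2)} (hr : X.Represents h T S J) (hh : ∀ v ∈ X.verts, h v = h' v) :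
    X.Represents h' T S J := by
  refine ⟨fun w p => ?_, fun z => ?_, fun z => ?_⟩
  · rw [hr.mem_J, hh w (X.V1_subset_verts w.2)]
  · rw [hr.mem_S, hh z (X.V3_subset_verts z.2)]
  · rw [hr.mem_T, hh z (X.V3_subset_verts z.2)]

lemma finite_dimerCoverings (X : BlockDomain k) : X.dimerCoverings.Finite := by
  refine (X.verts.sym2.powerset.finite_toSet).subset fun M hM => ?_
  rw [Finset.mem_coe, Finset.mem_powerset]
  intro e he
  have := hM.1 he
  induction e with
  | _ u v =>
    rw [SimpleGraph.Subgraph.mem_edgeSet] at this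
    exact Finset.mk_mem_sym2_iff.2 (X.graph_adj_mem_verts this)

lemma IsMate.eqOn_of_mem_iff {h' : Pt → Pt} (hm' : X.IsMate h') {M : Finset (Sym2 Pt)}
    (hM : ∀ e, e ∈ M ↔ ∃ v ∈ X.verts, e = s(v, h v))
    (hM' : ∀ e, e ∈ M ↔ ∃ v ∈ X.verts, e = s(v, h' v)) : ∀ v ∈ X.verts, h v = h' v := by
  intro v hv
  obtain ⟨u, hu, he⟩ := (hM' _).1 ((hM _).2 ⟨v, hv, rfl⟩)
  rcases Sym2.eq_iff.1 he with ⟨rfl, h1⟩ | ⟨h1, h2⟩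
  · exact h1
  · rw [h1, hm'.invol u hu, ← h1, h2]

/-- There are at most as many trees and forests with condition (Q) as dimer coverings. -/
lemma ncard_forestTriples_le (hX : X.IsImpurityDomain) :
    X.forestTriples.ncard ≤ X.dimerCoverings.ncard := by
  classical
  have hex : ∀ t : Finset X.RootedEdge × Finset X.V3 × Finset (X.V1 × X.V2), ∃ h : Pt → Pt,
      t ∈ X.forestTriples → X.IsMate h ∧ X.Represents h t.1 t.2.1 t.2.2 := by
    intro t
    by_cases ht : t ∈ X.forestTriples
    · obtain ⟨h, hh⟩ := exists_isMate_of_condQ hX ht.2.2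
      exact ⟨h, fun _ => hh⟩
    · exact ⟨id, fun h' => absurd h' ht⟩
  choose m hm using hex
  refine Set.ncard_le_ncard_of_injOn (fun t => X.verts.image fun v => s(v, m t v)) ?_ ?_
    X.finite_dimerCoverings
  · exact fun t ht => (hm t ht).1.mem_dimerCoverings
  · rintro ⟨T, S, J⟩ ht ⟨T', S', J'⟩ ht' he
    have he' : (X.verts.image fun v => s(v, m (T, S, J) v)) =
        X.verts.image fun v => s(v, m (T', S', J') v) := he
    have hh : ∀ v ∈ X.verts, m (T, S, J) v = m (T', S', J') v :=
      (hm _ ht').1.eqOn_of_mem_iff (M := X.verts.image fun v => s(v, m (T, S, J) v))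
        (fun e => by rw [Finset.mem_image]; simp only [eq_comm])
        (fun e => by rw [he', Finset.mem_image]; simp only [eq_comm])
    obtain ⟨rfl, rfl, rfl⟩ := ((hm _ ht).2.congr hh).unique (hm _ ht').2 ht.2.2 ht'.2.2
    rfl

end BlockDomain

/-! ### Changing the impurities of a tree and a forest -/

namespace BlockDomain

variable {k : ℕ} {X : BlockDomain k} {T : Finset X.RootedEdge} {S : Finset X.V3}
  {J : Finset (X.V1 × X.V2)}

/-- Every impurity can be exchanged for another one which joins the same trees. -/
lemma CondQ.exists_ne (hX : X.IsImpurityDomain) (hq : X.CondQ T S J) {e : X.V1 × X.V2}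
    (he : e ∈ J) : ∃ e' : X.V1 × X.V2, e' ≠ e ∧ X.graph.Adj e'.1 e'.2 ∧
      X.subtreeOf T e'.1 = X.subtreeOf T e.1 ∧
      (X.forestGraph S).connectedComponentMk e'.2 = (X.forestGraph S).connectedComponentMk e.2 := by
  obtain ⟨h, hm, hr⟩ := exists_isMate_of_condQ hX hq
  obtain ⟨w, p⟩ := e
  obtain ⟨z, hz, hpz⟩ := (X.adj_white_black (X.isV1_of_mem w.2) (X.isV2_of_mem p.2)).1 (hq.adj _ he)
  -- The impurity and `z` form a triangle. If `z` belongs to the tree, the white end moves across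
  -- `z`, which is possible because a TI-tree has no boundary vertex; otherwise `z` belongs to the
  -- forest and the black end moves.
  rcases hm.mid hz.mem_V3 with ⟨h1, -⟩ | ⟨h1, -⟩
  · have hzT : Sum.inl ⟨z, hz.mem_V3⟩ ∈ T := (hr.mem_T ⟨z, hz.mem_V3⟩).2 h1
    have hzb : ¬ X.IsBoundary z := fun hzb => (hq.mem_TI _ he).2 ⟨⟨z, hz.mem_V3⟩, hzb, hzT, w, rfl,
      (X.adj_white_mid (X.isV1_of_mem w.2) (X.isV3_of_mem hz.mem_V3)).2 hz⟩
    have hz' := X.sees_opp hz hzb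
    have hne : (⟨opp z w, hz'.mem_V1⟩ : X.V1) ≠ w := fun h' =>
      hz.near.opp_ne (congrArg Subtype.val h')
    refine ⟨(⟨opp z w, hz'.mem_V1⟩, p), fun h' => hne (congrArg Prod.fst h'), ?_, ?_, rfl⟩
    · exact (X.adj_white_black (X.isV1_of_mem hz'.mem_V1) (X.isV2_of_mem p.2)).2 ⟨z, hz', hpz⟩
    · refine SimpleGraph.ConnectedComponent.sound (SimpleGraph.Adj.reachable ?_)
      exact ⟨fun h' => hne (Option.some.inj h'), _, hzT, X.inc_mid_some.2 hz', X.inc_mid_some.2 hz⟩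
  · have hzS : ⟨z, hz.mem_V3⟩ ∈ S := (hr.mem_S ⟨z, hz.mem_V3⟩).2 h1
    have hp2 := hpz.isV2_opp (X.isV2_of_mem p.2)
    have hp' := X.mem_V2_of_near hz.mem_V3 hp2 hpz.opp
    have hne : (⟨opp z p, hp'⟩ : X.V2) ≠ p := fun h' => hpz.opp_ne (congrArg Subtype.val h')
    refine ⟨(w, ⟨opp z p, hp'⟩), fun h' => hne (congrArg Prod.snd h'), ?_, rfl, ?_⟩
    · exact (X.adj_white_black (X.isV1_of_mem w.2) hp2).2 ⟨z, hz, hpz.opp⟩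
    · refine SimpleGraph.ConnectedComponent.sound (SimpleGraph.Adj.reachable ?_)
      rw [forestGraph_eq]
      exact ⟨hne, _, hzS, X.blackInc_iff.2 hpz.opp, X.blackInc_iff.2 hpz⟩

open Classical in
lemma CondQ.image (hq : X.CondQ T S J) (σ : X.V1 × X.V2 → X.V1 × X.V2)
    (hσ : ∀ e ∈ J, X.graph.Adj (σ e).1 (σ e).2 ∧ X.subtreeOf T (σ e).1 = X.subtreeOf T e.1 ∧
      (X.forestGraph S).connectedComponentMk (σ e).2 =
        (X.forestGraph S).connectedComponentMk e.2) : X.CondQ T S (J.image σ) where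
  types := hq.types
  card_TI := hq.card_TI
  card_TO := hq.card_TO
  card_forest := hq.card_forest
  disjoint := hq.disjoint
  card_impurities := by
    rw [Finset.card_image_of_injOn, hq.card_impurities]
    intro e he e' he' h
    refine hq.white_unique he he' ?_
    rw [← (hσ e he).2.1, ← (hσ e' he').2.1, h]
  adj := by
    intro e he
    obtain ⟨e, heJ, rfl⟩ := Finset.mem_image.1 he
    exact (hσ e heJ).1
  mem_TI := by
    intro e he
    obtain ⟨e, heJ, rfl⟩ := Finset.mem_image.1 he
    rw [(hσ e heJ).2.1]
    exact hq.mem_TI e heJ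
  pair_TI := by
    intro c hc
    obtain ⟨e, ⟨he, h1⟩, h2⟩ := hq.pair_TI c hc
    refine ⟨σ e, ⟨Finset.mem_image_of_mem _ he, (hσ e he).2.1.trans h1⟩, ?_⟩
    rintro e' ⟨he', h3⟩
    obtain ⟨e', heJ', rfl⟩ := Finset.mem_image.1 he'
    rw [h2 e' ⟨heJ', (hσ e' heJ').2.1.symm.trans h3⟩]
  pair_forest := by
    intro s
    obtain ⟨e, ⟨he, h1⟩, h2⟩ := hq.pair_forest s
    refine ⟨σ e, ⟨Finset.mem_image_of_mem _ he, (hσ e he).2.2.trans h1⟩, ?_⟩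
    rintro e' ⟨he', h3⟩
    obtain ⟨e', heJ', rfl⟩ := Finset.mem_image.1 he'
    rw [h2 e' ⟨heJ', (hσ e' heJ').2.2.symm.trans h3⟩]

lemma two_pow_mul_ncard_le (hX : X.IsImpurityDomain) :
    2 ^ k * X.spanningTreesQ.ncard ≤ X.forestTriples.ncard := by
  classical
  have hex : ∀ T : Finset X.RootedEdge, ∃ (S : Finset X.V3) (J : Finset (X.V1 × X.V2)),
      T ∈ X.spanningTreesQ → (T, S, J) ∈ X.forestTriples := by
    intro T
    by_cases hT : T ∈ X.spanningTreesQ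
    · obtain ⟨-, S, J, ht⟩ := id hT
      exact ⟨S, J, fun _ => ht⟩
    · exact ⟨∅, ∅, fun h => absurd h hT⟩
  choose S J hSJ using hex
  have hex : ∀ (T : Finset X.RootedEdge) (e : X.V1 × X.V2), ∃ e', T ∈ X.spanningTreesQ → e ∈ J T →
      e' ≠ e ∧ X.graph.Adj e'.1 e'.2 ∧ X.subtreeOf T e'.1 = X.subtreeOf T e.1 ∧
      (X.forestGraph (S T)).connectedComponentMk e'.2 =
        (X.forestGraph (S T)).connectedComponentMk e.2 := by
    intro T e
    by_cases hT : T ∈ X.spanningTreesQ ∧ e ∈ J T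
    · obtain ⟨e', he'⟩ := (hSJ T hT.1).2.2.exists_ne hX hT.2
      exact ⟨e', fun _ _ => he'⟩
    · exact ⟨e, fun h1 h2 => absurd ⟨h1, h2⟩ hT⟩
  choose a ha using hex
  -- For each tree one forest and one set `J T` of impurities are fixed, and `K` records which
  -- impurities are exchanged. The subtree at the white end still identifies every impurity, so `K`
  -- can be read off.
  set σ : Finset X.RootedEdge → Finset (X.V1 × X.V2) → X.V1 × X.V2 → X.V1 × X.V2 :=
    fun T K e => if e ∈ K then a T e else e with hσdef
  have hσ : ∀ T ∈ X.spanningTreesQ, ∀ K, ∀ e ∈ J T,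
      X.graph.Adj (σ T K e).1 (σ T K e).2 ∧ X.subtreeOf T (σ T K e).1 = X.subtreeOf T e.1 ∧
      (X.forestGraph (S T)).connectedComponentMk (σ T K e).2 =
        (X.forestGraph (S T)).connectedComponentMk e.2 := by
    intro T hT K e he
    simp only [hσdef]
    split_ifs with heK
    · exact (ha T e hT he).2
    · exact ⟨(hSJ T hT).2.2.adj e he, rfl, rfl⟩
  have hsub : ∀ T ∈ X.spanningTreesQ, ∀ K ⊆ J T, ∀ K',
      (J T).image (σ T K) = (J T).image (σ T K') → K ⊆ K' := by
    intro T hT K hK K' himg e he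
    by_contra heK'
    have heJ := hK he
    have h1 : σ T K e ∈ (J T).image (σ T K') := himg ▸ Finset.mem_image_of_mem _ heJ
    obtain ⟨e', he', h2⟩ := Finset.mem_image.1 h1
    have h3 : e' = e := (hSJ T hT).2.2.white_unique he' heJ (by
      rw [← (hσ T hT K' e' he').2.1, h2, (hσ T hT K e heJ).2.1])
    subst h3
    simp only [hσdef, he, heK', if_true, if_false] at h2
    exact (ha T e' hT heJ).1 h2.symm
  set A : Finset (Finset X.RootedEdge) := X.spanningTreesQ.toFinite.toFinset with hA
  have hAmem : ∀ T, T ∈ A ↔ T ∈ X.spanningTreesQ := fun T => by simp [hA]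
  have hcard : (A.sigma fun T => (J T).powerset).card = 2 ^ k * X.spanningTreesQ.ncard := by
    rw [Finset.card_sigma, Finset.sum_congr rfl (g := fun _ => 2 ^ k), Finset.sum_const,
      Set.ncard_eq_toFinset_card _ X.spanningTreesQ.toFinite, smul_eq_mul, mul_comm]
    intro T hT
    rw [Finset.card_powerset, (hSJ T ((hAmem T).1 hT)).2.2.card_impurities]
  rw [← hcard, ← Set.ncard_coe_finset]
  refine Set.ncard_le_ncard_of_injOn (fun t => (t.1, S t.1, (J t.1).image (σ t.1 t.2))) ?_ ?_
    (Set.toFinite _)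
  · rintro ⟨T, K⟩ ht
    have hT := (hAmem T).1 (Finset.mem_sigma.1 (Finset.mem_coe.1 ht)).1
    have h1 := hSJ T hT
    exact ⟨h1.1, h1.2.1, h1.2.2.image _ (hσ T hT K)⟩
  · rintro ⟨T, K⟩ ht ⟨T', K'⟩ ht' he
    rw [Finset.mem_coe, Finset.mem_sigma, Finset.mem_powerset] at ht ht'
    obtain rfl : T = T' := congrArg Prod.fst he
    have h1 : (J T).image (σ T K) = (J T).image (σ T K') := congrArg (fun t => t.2.2) he
    have hT := (hAmem T).1 ht.1
    rw [Finset.Subset.antisymm (hsub T hT K ht.2 K' h1) (hsub T hT K' ht'.2 K h1.symm)]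

end BlockDomain

/-! ### Counting the impurities -/

lemma Real.prod_le_sum_div_card_pow {ι : Type*} (s : Finset ι) (z : ι → ℝ) (hs : s.Nonempty)
    (hz : ∀ i ∈ s, 0 ≤ z i) : ∏ i ∈ s, z i ≤ ((∑ i ∈ s, z i) / s.card) ^ s.card := by
  have hc : (0 : ℝ) < s.card := by exact_mod_cast hs.card_pos
  have h := Real.geom_mean_le_arith_mean s (fun _ => 1) z (fun _ _ => zero_le_one) (by simpa using hs)
    hz
  simp only [Real.rpow_one, one_mul, Finset.sum_const, nsmul_eq_mul, mul_one] at h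
  have hp : 0 ≤ ∏ i ∈ s, z i := Finset.prod_nonneg hz
  calc ∏ i ∈ s, z i = ((∏ i ∈ s, z i) ^ (s.card : ℝ)⁻¹) ^ s.card := by
        rw [← Real.rpow_natCast, ← Real.rpow_mul hp, inv_mul_cancel₀ hc.ne', Real.rpow_one]
    _ ≤ _ := pow_le_pow_left₀ (Real.rpow_nonneg hp _) h _

namespace BlockDomain

variable {k : ℕ} (X : BlockDomain k)

open Classical in
/-- The edges of `G` between white and black vertices. -/
noncomputable def impurityEdges : Finset (X.V1 × X.V2) :=
  Finset.univ.filter fun e => X.graph.Adj e.1 e.2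

-- Black neighbours and middle vertices alternate around a block centre, so there are equally many.
-- A terminal has at most two black neighbours and sees at least its port, which costs one extra.
open Classical in
lemma card_adj_le (w : X.V1) : (Finset.univ.filter fun p : X.V2 => X.graph.Adj w p).card ≤
    (Finset.univ.filter fun z : X.V3 => X.Sees w z).card + if (w : Pt) ∈ X.blocks then 0 else 1 := by
  have hw1 := X.isV1_of_mem w.2
  have hadj : ∀ p : X.V2, X.graph.Adj w p ↔ ∃ z, X.Sees w z ∧ Near p z := fun p =>
    X.adj_white_black hw1 (X.isV2_of_mem p.2)
  split_ifs with hb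
  · rw [add_zero]
    have hrot : ∀ p : X.V2, Side w p → (p.1.1 - w.1.1) % 2 = 0 ∧ (p.1.2 - w.1.2) % 2 = 0 := by
      intro p hp
      unfold Side at hp
      omega
    have hside : ∀ p : X.V2, X.graph.Adj w p → Side w p := fun p hp => by
      obtain ⟨z, h1, h2⟩ := (hadj p).1 hp
      exact side_of_near h1.near h2 hw1 (X.isV2_of_mem p.2)
    rw [← Finset.card_image_of_injective (Finset.univ.filter fun z : X.V3 => X.Sees w z)
      Subtype.val_injective]
    -- Rotation about `w` by 45 degrees, scaled by `1 / √2`.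
    refine Finset.card_le_card_of_injOn (fun p : X.V2 =>
      ((w.1.1 + ((p.1.1 - w.1.1) - (p.1.2 - w.1.2)) / 2,
        w.1.2 + ((p.1.1 - w.1.1) + (p.1.2 - w.1.2)) / 2) : Pt)) ?_ ?_
    · intro p hp
      have hs := hside p (Finset.mem_filter.1 hp).2
      have hn : Near w ((w.1.1 + ((p.1.1 - w.1.1) - (p.1.2 - w.1.2)) / 2,
        w.1.2 + ((p.1.1 - w.1.1) + (p.1.2 - w.1.2)) / 2) : Pt) := by
        unfold Side at hs
        unfold Near
        simp only
        omega
      have hse : X.Sees w _ := Or.inl ⟨hb, hn⟩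
      exact Finset.mem_image.2 ⟨⟨_, hse.mem_V3⟩, Finset.mem_filter.2 ⟨Finset.mem_univ _, hse⟩, rfl⟩
    · intro p hp q hq he
      have hs := hrot p (hside p (Finset.mem_filter.1 hp).2)
      have hs' := hrot q (hside q (Finset.mem_filter.1 hq).2)
      have h1 := (pt_ext_iff.1 he).1
      have h2 := (pt_ext_iff.1 he).2
      simp only at h1 h2
      refine Subtype.ext (pt_ext_iff.2 ?_)
      omega
  · obtain ⟨i, hi⟩ := (X.mem_V1.1 w.2).resolve_left hb
    have hport : X.Sees w (X.port i) := Or.inr ⟨i, hi, rfl⟩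
    have h1 : 1 ≤ (Finset.univ.filter fun z : X.V3 => X.Sees w z).card :=
      Finset.card_pos.2 ⟨⟨X.port i, X.port_mem_V3 i⟩, Finset.mem_filter.2 ⟨Finset.mem_univ _, hport⟩⟩
    obtain ⟨q, hq, hqn⟩ := exists_isV2_near (X.port_mid i)
    have h2 : (Finset.univ.filter fun p : X.V2 => X.graph.Adj w p).card ≤
        ({q, opp (X.port i) q} : Finset Pt).card := by
      refine Finset.card_le_card_of_injOn Subtype.val ?_ Subtype.val_injective.injOn
      intro p hp
      obtain ⟨z, h3, h4⟩ := (hadj p).1 (Finset.mem_filter.1 hp).2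
      rw [← hi] at h3
      rw [terminal_sees h3] at h4
      rcases eq_or_eq_opp_of_isV2 hqn h4 hq (X.isV2_of_mem p.2) with h | h <;> simp [h]
    have h3 := Finset.card_le_two (a := q) (b := opp (X.port i) q)
    omega

-- A middle vertex is seen by at most two white vertices, one to its left and one to its right; the
-- Boolean records the side.
open Classical in
lemma sum_card_sees_le :
    ∑ w : X.V1, (Finset.univ.filter fun z : X.V3 => X.Sees w z).card ≤ 2 * X.V3.card := by
  rw [← Finset.card_sigma, mul_comm]
  have : X.V3.card * 2 = (Finset.univ : Finset (X.V3 × Bool)).card := by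
    rw [Finset.card_univ, Fintype.card_prod, Fintype.card_coe, Fintype.card_bool]
  rw [this]
  refine Finset.card_le_card_of_injOn (fun t => (t.2, decide (t.1.1.1 < t.2.1.1)))
    (fun _ _ => Finset.mem_coe.2 (Finset.mem_univ _)) ?_
  rintro ⟨w, z⟩ ht ⟨w', z'⟩ ht' he
  have hs : X.Sees w z := (Finset.mem_filter.1 (Finset.mem_sigma.1 ht).2).2
  have hs' : X.Sees w' z' := (Finset.mem_filter.1 (Finset.mem_sigma.1 ht').2).2
  obtain rfl : z = z' := congrArg Prod.fst he
  have h1 : decide (w.1.1 < z.1.1) = decide (w'.1.1 < z.1.1) := congrArg Prod.snd he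
  rw [decide_eq_decide] at h1
  rcases eq_or_eq_opp_of_isV1 hs.near hs'.near (X.isV1_of_mem w.2) (X.isV1_of_mem w'.2) with h | h
  · rw [Subtype.ext h]
  · have hn := hs.near
    rw [h] at h1
    unfold Near at hn
    simp only [opp] at h1
    omega

/-- The bounds at the single white vertices add up to at most `2 |V3| + 2k - 1`, while `N = 2 |V3| +
2k`. -/
lemma card_impurityEdges_le (hk : 1 ≤ k) (hX : X.IsImpurityDomain) :
    X.impurityEdges.card ≤ X.verts.card := by
  classical
  have h1 : X.impurityEdges.card =
      ∑ w : X.V1, (Finset.univ.filter fun p : X.V2 => X.graph.Adj w p).card := by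
    rw [impurityEdges, Finset.card_filter, Fintype.sum_prod_type]
    simp only [Finset.card_filter]
  have h2 : X.impurityEdges.card ≤ ∑ w : X.V1,
      ((Finset.univ.filter fun z : X.V3 => X.Sees w z).card +
        if (w : Pt) ∈ X.blocks then 0 else 1) := by
    rw [h1]
    exact Finset.sum_le_sum fun w _ => by convert X.card_adj_le w
  rw [Finset.sum_add_distrib] at h2
  have h3 : ∑ w : X.V1, (if (w : Pt) ∈ X.blocks then 0 else 1) = 2 * k - 1 := by
    have h4 : ∑ w : X.V1, (if (w : Pt) ∈ X.blocks then 0 else 1) =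
        ∑ w ∈ X.V1, (if w ∈ X.blocks then 0 else 1) :=
      Finset.sum_coe_sort X.V1 fun w => if w ∈ X.blocks then 0 else 1
    have h5 : (X.V1.filter fun w => ¬ w ∉ X.blocks) = X.blocks := by
      ext w
      rw [Finset.mem_filter, not_not]
      exact ⟨And.right, fun h => ⟨X.blocks_subset_V1 h, h⟩⟩
    have h6 := Finset.card_filter_add_card_filter_not (s := X.V1) (fun w => w ∉ X.blocks)
    rw [h5] at h6
    have h7 := X.card_V1
    rw [h4]
    have h8 : ∑ w ∈ X.V1, (if w ∈ X.blocks then 0 else 1) =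
        (X.V1.filter fun w => w ∉ X.blocks).card := by
      rw [Finset.card_filter]
      exact Finset.sum_congr rfl fun w _ => by split_ifs <;> simp_all
    rw [h8]
    omega
  have h4 := X.sum_card_sees_le
  have h5 := X.card_verts
  have h6 := hX.impurity_count
  omega

variable {X}

open Classical in
/-- The number of ways to choose the impurities for a given tree. -/
lemma card_choices_le (hk : 1 ≤ k) (hX : X.IsImpurityDomain) (T : Finset X.RootedEdge) :
    ((Finset.univ.filter fun J => ∃ S, X.CondQ T S J).card : ℝ) ≤
      ((X.verts.card : ℝ) / k) ^ k := by
  by_cases hex : ∃ S J, X.CondQ T S J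
  swap
  · rw [Finset.filter_false_of_mem fun J _ => by
      rintro ⟨S, hq⟩
      exact hex ⟨S, J, hq⟩]
    simp only [Finset.card_empty, Nat.cast_zero]
    positivity
  obtain ⟨S₀, J₀, hq₀⟩ := hex
  set I : Finset (X.Subtree T) := Finset.univ.filter fun c => X.IsTITree T c with hI
  have hIc : I.card = k := by
    refine Eq.trans ?_ hq₀.card_TI
    rw [hI, ← Set.ncard_coe_finset]
    congr 1
    ext c
    rw [Finset.mem_coe, Finset.mem_filter]
    exact and_iff_right (Finset.mem_univ c)
  -- `J` has exactly one edge in the class `P c` of each of the `k` TI-trees. The classes are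
  -- disjoint, so their sizes add up to at most `N`.
  set P : X.Subtree T → Finset (X.V1 × X.V2) := fun c =>
    X.impurityEdges.filter fun e => X.subtreeOf T e.1 = c with hP
  have h1 : (Finset.univ.filter fun J => ∃ S, X.CondQ T S J).card ≤
      (I.pi P).card := by
    have hg : ∀ (J : Finset (X.V1 × X.V2)) (c : X.Subtree T), ∃ e : X.V1 × X.V2,
        (∃ S, X.CondQ T S J) → c ∈ I → e ∈ J ∧ X.subtreeOf T e.1 = c := by
      intro J c
      by_cases hc : (∃ S, X.CondQ T S J) ∧ c ∈ I
      · obtain ⟨S, hq⟩ := hc.1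
        obtain ⟨e, he, -⟩ := hq.pair_TI c (Finset.mem_filter.1 hc.2).2
        exact ⟨e, fun _ _ => he⟩
      · have : Nonempty (X.V1 × X.V2) := by
          have h0 : 0 < J₀.card := by rw [hq₀.card_impurities]; omega
          obtain ⟨e, -⟩ := Finset.card_pos.1 h0
          exact ⟨e⟩
        exact ⟨Classical.arbitrary _, fun h1 h2 => absurd ⟨h1, h2⟩ hc⟩
    choose g hg using hg
    refine Finset.card_le_card_of_injOn (fun J c _ => g J c) ?_ ?_
    · intro J hJ
      obtain ⟨S, hq⟩ := (Finset.mem_filter.1 hJ).2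
      refine Finset.mem_coe.2 (Finset.mem_pi.2 fun c hc => ?_)
      obtain ⟨h1, h2⟩ := hg J c ⟨S, hq⟩ hc
      exact Finset.mem_filter.2 ⟨Finset.mem_filter.2 ⟨Finset.mem_univ _, hq.adj _ h1⟩, h2⟩
    · have key : ∀ J J' : Finset (X.V1 × X.V2), (∃ S, X.CondQ T S J) → (∃ S, X.CondQ T S J') →
          (∀ c ∈ I, g J c = g J' c) → J ⊆ J' := by
        rintro J J' ⟨S, hq⟩ hJ' hgg e he
        have hc : X.subtreeOf T e.1 ∈ I := Finset.mem_filter.2 ⟨Finset.mem_univ _, hq.mem_TI e he⟩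
        obtain ⟨h1, h2⟩ := hg J _ ⟨S, hq⟩ hc
        rw [← hq.white_unique h1 he h2, hgg _ hc]
        exact (hg J' _ hJ' hc).1
      intro J hJ J' hJ' he
      have h2 : ∀ c ∈ I, g J c = g J' c := fun c hc => congrFun (congrFun he c) hc
      exact Finset.Subset.antisymm
        (key J J' (Finset.mem_filter.1 hJ).2 (Finset.mem_filter.1 hJ').2 h2)
        (key J' J (Finset.mem_filter.1 hJ').2 (Finset.mem_filter.1 hJ).2 fun c hc => (h2 c hc).symm)
  have h2 : ∑ c ∈ I, (P c).card ≤ X.verts.card := by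
    refine le_trans ?_ (X.card_impurityEdges_le hk hX)
    rw [Finset.card_eq_sum_card_fiberwise (s := X.impurityEdges) (t := Finset.univ)
      (f := fun e => X.subtreeOf T e.1) (fun _ _ => by simp)]
    exact Finset.sum_le_sum_of_subset (Finset.subset_univ I)
  calc ((Finset.univ.filter fun J => ∃ S, X.CondQ T S J).card : ℝ)
      ≤ ((I.pi P).card : ℝ) := by exact_mod_cast h1
    _ = ∏ c ∈ I, ((P c).card : ℝ) := by rw [Finset.card_pi, Nat.cast_prod]
    _ ≤ ((∑ c ∈ I, ((P c).card : ℝ)) / I.card) ^ I.card :=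
        Real.prod_le_sum_div_card_pow I _ (Finset.card_pos.1 (by omega)) fun c _ => Nat.cast_nonneg _
    _ ≤ ((X.verts.card : ℝ) / k) ^ k := by
        rw [hIc]
        refine pow_le_pow_left₀ (div_nonneg (Finset.sum_nonneg fun _ _ => Nat.cast_nonneg _)
          (Nat.cast_nonneg _)) (div_le_div_of_nonneg_right ?_ (Nat.cast_nonneg _)) _
        rw [← Nat.cast_sum]
        exact Nat.cast_le.2 h2

/-! ### Counting dimer coverings through their trees -/

/-- Few dimer coverings have their trees in a given set. -/
lemma ncard_le_of_forall_tree (hk : 1 ≤ k) (hX : X.IsImpurityDomain)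
    (A : Finset (Finset X.RootedEdge)) (D : Set (Finset (Sym2 Pt))) (hD : D ⊆ X.dimerCoverings)
    (hA : ∀ M ∈ D, ∀ h, X.IsMate h → (∀ e, e ∈ M ↔ ∃ v ∈ X.verts, e = s(v, h v)) →
      ∀ T S J, X.Represents h T S J → (T, S, J) ∈ X.forestTriples → T ∈ A) :
    (D.ncard : ℝ) ≤ A.card * ((X.verts.card : ℝ) / k) ^ k := by
  classical
  set C : Finset X.RootedEdge → Finset (Finset (X.V1 × X.V2)) :=
    fun T => Finset.univ.filter fun J => ∃ S, X.CondQ T S J with hC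
  have hex : ∀ M : Finset (Sym2 Pt), ∃ (t : Σ _ : Finset X.RootedEdge, Finset (X.V1 × X.V2)),
      M ∈ D → ∃ h S, X.IsMate h ∧ (∀ e, e ∈ M ↔ ∃ v ∈ X.verts, e = s(v, h v)) ∧
        X.Represents h t.1 S t.2 ∧ (t.1, S, t.2) ∈ X.forestTriples := by
    intro M
    by_cases hM : M ∈ D
    · obtain ⟨h, hm, hMh⟩ := exists_isMate (hD hM)
      obtain ⟨T, S, J, hr, ht⟩ := hm.exists_represents hk hX
      exact ⟨⟨T, J⟩, fun _ => ⟨h, S, hm, hMh, hr, ht⟩⟩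
    · exact ⟨⟨∅, ∅⟩, fun h => absurd h hM⟩
  -- The code of a covering consists of its tree and its impurities; by `eqOn_of_represents` the
  -- forest need not be recorded.
  choose t ht using hex
  have h1 : D.ncard ≤ (A.sigma C).card := by
    rw [← Set.ncard_coe_finset]
    refine Set.ncard_le_ncard_of_injOn t ?_ ?_ (Set.toFinite _)
    · intro M hM
      obtain ⟨h, S, hm, hMh, hr, ht'⟩ := ht M hM
      exact Finset.mem_coe.2 (Finset.mem_sigma.2 ⟨hA M hM h hm hMh _ S _ hr ht',
        Finset.mem_filter.2 ⟨Finset.mem_univ _, S, ht'.2.2⟩⟩)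
    · intro M hM M' hM' he
      obtain ⟨h, S, hm, hMh, hr, -⟩ := ht M hM
      obtain ⟨h', S', hm', hMh', hr', -⟩ := ht M' hM'
      rw [← he] at hr'
      have h3 := hm.eqOn_of_represents hm' hk hX hr hr'
      ext e
      rw [hMh, hMh']
      exact exists_congr fun v => and_congr_right fun hv => by rw [h3 v hv]
  calc (D.ncard : ℝ) ≤ ((A.sigma C).card : ℝ) := by exact_mod_cast h1
    _ = ∑ T ∈ A, ((C T).card : ℝ) := by rw [Finset.card_sigma, Nat.cast_sum]
    _ ≤ ∑ _T ∈ A, ((X.verts.card : ℝ) / k) ^ k :=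
        Finset.sum_le_sum fun T _ => card_choices_le hk hX T
    _ = _ := by rw [Finset.sum_const, nsmul_eq_mul]

lemma image_mem_spanningTrees [DecidableEq X.RootedEdge] {f : X.V1 → X.RootedEdge}
    (hf : f ∈ X.arbs) : Finset.univ.image f ∈ X.spanningTrees :=
  X.twoEnded.isTree_image hf

lemma exists_arbs [DecidableEq X.RootedEdge] {T : Finset X.RootedEdge} (hT : T ∈ X.spanningTrees) :
    ∃ f ∈ X.arbs, Finset.univ.image f = T :=
  X.twoEnded.exists_rootedTree hT.1 hT.2

lemma ncard_spanningTrees : X.spanningTrees.ncard = X.arbs.card := by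
  classical
  have : X.spanningTrees = (fun f : X.V1 → X.RootedEdge => Finset.univ.image f) '' X.arbs := by
    ext T
    constructor
    · intro hT
      obtain ⟨f, hf, h⟩ := exists_arbs hT
      exact ⟨f, hf, h⟩
    · rintro ⟨f, hf, rfl⟩
      exact image_mem_spanningTrees hf
  rw [this, Set.InjOn.ncard_image X.twoEnded.rootedTrees_injOn, Set.ncard_coe_finset]

/-- In a TI-tree all paths to the root use the edge from a terminal. -/
lemma exitsAtTerminal_of_isTITree [DecidableEq X.RootedEdge] {f : X.V1 → X.RootedEdge}
    (hf : f ∈ X.arbs) {j : X.V1}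
    (hj : X.IsTITree (Finset.univ.image f) (X.subtreeOf (Finset.univ.image f) j)) :
    X.ExitsAtTerminal f j := by
  obtain ⟨hinc, hd⟩ := mem_rootedTrees.1 hf
  -- Along the path the subtree does not change, and having no boundary vertex it can only be left
  -- through a terminal edge.
  induction j using WellFounded.induction hd with
  | _ v ih =>
    have hfT : f v ∈ Finset.univ.image f := Finset.mem_image_of_mem _ (Finset.mem_univ v)
    rcases hs : X.oth (f v) (some v) with _ | u
    · rcases hfv : f v with z | i
      · exfalso
        have h1 := X.twoEnded.inc_oth (hinc v)
        rw [hs, hfv, inc_mid_none] at h1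
        have h2 := hinc v
        rw [hfv, inc_mid_some] at h2
        exact hj.2 ⟨z, h1, hfv ▸ hfT, v, rfl,
          (X.adj_white_mid (X.isV1_of_mem v.2) (X.isV3_of_mem z.2)).2 h2⟩
      · exact ⟨v, i, Relation.ReflTransGen.refl, hfv⟩
    · have h1 := X.twoEnded.inc_oth (hinc v)
      rw [hs] at h1
      have hne : (some u : X.RootedV1) ≠ some v := by
        rw [← hs]
        exact X.twoEnded.ne _ _ (hinc v)
      have h2 : X.subtreeOf (Finset.univ.image f) u = X.subtreeOf (Finset.univ.image f) v :=
        SimpleGraph.ConnectedComponent.sound (SimpleGraph.Adj.reachable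
          ⟨hne, f v, hfT, h1, hinc v⟩)
      obtain ⟨x, i, h3, h4⟩ := ih u hs (h2 ▸ hj)
      exact ⟨x, i, Relation.ReflTransGen.head hs h3, h4⟩

/-- The number of dimer coverings with an impurity at `j`. -/
lemma ncard_impurity_le (hk : 1 ≤ k) (hX : X.IsImpurityDomain) (j : X.V1) :
    ({M ∈ X.dimerCoverings | ∃ x : X.V2, s((x : Pt), (j : Pt)) ∈ M}.ncard : ℝ) ≤
      X.spanningTrees.ncard * X.p j * ((X.verts.card : ℝ) / k) ^ k := by
  classical
  rw [ncard_spanningTrees, card_mul_p]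
  -- An impurity at `j` puts `j` into a TI-tree, so only the trees counted by `card_mul_p` occur.
  refine (ncard_le_of_forall_tree hk hX
    ((X.arbs.filter fun f => X.ExitsAtTerminal f j).image fun f => Finset.univ.image f) _
    (fun M hM => hM.1) ?_).trans ?_
  · rintro M ⟨-, x, hx⟩ h hm hMh T S J hr ht
    obtain ⟨f, hf, rfl⟩ := exists_arbs ht.1
    refine Finset.mem_image.2 ⟨f, Finset.mem_filter.2 ⟨hf, ?_⟩, rfl⟩
    refine exitsAtTerminal_of_isTITree hf (ht.2.2.mem_TI (j, x) ((hr.mem_J j x).2 ?_))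
    obtain ⟨v, hv, he⟩ := (hMh _).1 hx
    rcases Sym2.eq_iff.1 he with ⟨rfl, h2⟩ | ⟨h1, h2⟩
    · rw [h2, hm.invol _ hv]
    · rw [h2, h1]
  · gcongr
    exact Finset.card_image_le

end BlockDomain

theorem theorem4 {k : ℕ} (hk : 1 ≤ k) (G : BlockDomain k) (hG : G.IsImpurityDomain) :
    ((2 : ℝ) ^ k * (G.spanningTreesQ.ncard : ℝ) ≤ (G.dimerCoverings.ncard : ℝ) ∧
      (G.dimerCoverings.ncard : ℝ) ≤
        |G.laplacian.det| * ((G.verts.card : ℝ) / (k : ℝ)) ^ k) ∧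
    (∀ j : G.V1,
      G.impurityProb j ≤
        ((G.spanningTrees.ncard : ℝ) * ((G.verts.card : ℝ) / (k : ℝ)) ^ k) /
          ((2 : ℝ) ^ k * (G.spanningTreesQ.ncard : ℝ)) * G.p j) ∧
    (G.laplacian.det ≠ 0 ∧ ∀ j : G.V1, HasSum (fun n : ℕ => G.hitProb n j) (G.p j)) := by
  have hlow : (2 : ℝ) ^ k * (G.spanningTreesQ.ncard : ℝ) ≤ (G.dimerCoverings.ncard : ℝ) := by
    exact_mod_cast (BlockDomain.two_pow_mul_ncard_le hG).trans (BlockDomain.ncard_forestTriples_le hG)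
  have hup : (G.dimerCoverings.ncard : ℝ) ≤
      G.spanningTrees.ncard * ((G.verts.card : ℝ) / k) ^ k := by
    have h := BlockDomain.ncard_le_of_forall_tree hk hG G.spanningTrees.toFinite.toFinset
      G.dimerCoverings subset_rfl fun M _ h _ _ T S J _ ht => by simpa using ht.1
    rwa [← Set.ncard_eq_toFinset_card] at h
  refine ⟨⟨hlow, ?_⟩, fun j => ?_, G.det_laplacian_pos.ne', G.hasSum_hitProb⟩
  · rwa [abs_of_pos G.det_laplacian_pos, G.det_laplacian, ← BlockDomain.ncard_spanningTrees]
  · have hj := BlockDomain.ncard_impurity_le hk hG j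
    rw [BlockDomain.impurityProb]
    -- If no tree satisfies the condition, there is no covering either, and both sides are zero
    -- because division by zero gives zero.
    rcases Nat.eq_zero_or_pos G.spanningTreesQ.ncard with h0 | h0
    · have hD : G.dimerCoverings = ∅ := by
        by_contra hne
        obtain ⟨M, hM⟩ := Set.nonempty_iff_ne_empty.2 hne
        obtain ⟨h, hm, -⟩ := BlockDomain.exists_isMate hM
        obtain ⟨T, S, J, -, ht⟩ := hm.exists_represents hk hG
        rw [Set.ncard_eq_zero (Set.toFinite _)] at h0
        exact Set.notMem_empty T (h0 ▸ ⟨ht.1, S, J, ht⟩)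
      simp [hD, h0]
    · have hQ : (0 : ℝ) < 2 ^ k * G.spanningTreesQ.ncard := by positivity
      refine (div_le_div_of_nonneg_left (Nat.cast_nonneg _) hQ hlow).trans ?_
      rw [div_mul_eq_mul_div]
      refine div_le_div_of_nonneg_right (hj.trans_eq ?_) hQ.le
      ring
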